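/- **Conventions.** Partitions are drawn in the English convention. For integers $a\le b$, a *bumpless pipe dream* (BPD) of a permutation $w$ of $[a,b]=\{a,\dots,b\}$ is a tiling of the grid with rows and columns indexed by $[a,b]$ (matrix coordinates) by the six tiles blank, cross, horizontal, vertical, $\mathsf r$ (joining south and east), $\mathsf j$ (joining north and west), forming $b-a+1$ pipes that enter from the south border and leave through the east border, such that no two pipes cross twice and, when pipes are labelled by their columns on the south border, the pipe leaving in row $i$ has label $w(i)$. The permutation $w$ is $k$-Grassmannian if it has no descent at a position other than $k$; its partition has the parts $w(i)-i$, $i=k,k-1,\dots,a$. A droop move on a BPD lets the pipe with an $\mathsf r$-tile at $(i,j)$ droop into a blank tile at $(i+1,j+1)$; the blank tile, with its label, moves to $(i,j)$. For a BPD $D$ of a $k$-Grassmannian permutation, $T_D$ is the tableau obtained by labelling each blank tile with its row index and performing all possible droop moves; if blank tiles are marked, the marks are carried along. Let $\mu=(\mu_1,\dots,\mu_l)\subseteq\nu=(\nu_1,\dots,\nu_m)$ be partitions with positive parts, $l<m\le k$, and let $T$ be a semistandard tableau of shape $\nu/\mu$ with entries in $[1,k]$. Let $T'$ be the marked tableau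 of shape $\nu$ obtained from $T$ by filling each box of $\mu$ in row $i$ with the marked number $i-l$, $1\le i\le l$. Put $a=1-l$ and let $b\ge k+\nu_1$. **Algorithm on marked tableaux.** While there are marks, pick a SE-most marked number as active, and repeat the following pass until the active number is deleted. (a) Increment the active number by $1$; as long as it equals the number below, increment the number below and move the mark there. If now the active number exceeds $k$ (it is $k+1$ and at the SE border), delete it and end the iteration. (b) Otherwise, if the active number equals the number to its right, move the mark to the rightmost number with this value in its row. **Algorithm on marked BPDs.** While there are marked blank tiles, pick a SE-most one as active, and repeat the following. (1) If it is not the rightmost tile of a contiguous block of blank tiles in its row, slide the mark to the rightmost one. (2) If the active tile is $(i,j)$ and the pipe through $(i,j+1)$ has a $\mathsf j$-tile at $(i',j+1)$ with $i'>i$, perform the column move: undroop this pipe into $(i,j)$, shift the kinks of the other pipes (and the blank tiles) in columns $j,j+1$ strictly between rows $i$ and $i'$ from column $j$ to column $j+1$, and move the mark to $(i',j+1)$. (3) Otherwise replace the crossing of the pipes $j$ and $j+1$ at $(i',j+1)$ by a bump, undroop the resulting $\mathsf j$-elbow into $(i,j)$, adjusting the pipes in between in the same way; this removes the mark and ends the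 iteration. **Proposition.** 1. For every $k$-Grassmannian permutation $w$ of $[a,b]$ with partition $\lambda$, the map $D\mapsto T_D$ is well defined and a bijection from the BPDs of $w$ to the semistandard tableaux of shape $\lambda$ with entries in $[a,k]$. 2. $T'$ is semistandard, and the algorithm on $T'$ can always be continued while there are marks, and always terminates. It simulates jeu de taquin on $T$: erase all marked numbers, regarding the active box as the active empty box. Then picking an active mark corresponds to picking the same SE-most empty box; part (a) of a pass corresponds to (zero or more) consecutive vertical slides; part (b), when it moves the mark, corresponds to consecutive horizontal slides; and deletion corresponds to consecutive vertical slides after which the active empty box is on the SE border and the jeu de taquin slide ends. In particular, the results of complete runs of the algorithm on $T'$ are exactly the results of complete runs of jeu de taquin on $T$. 3. The algorithm agrees in each step with the algorithm on marked BPDs. That is, every marked tableau that occurs in a run from $T'$ corresponds, under $D\mapsto T_D$ with marks and active mark carried along, to exactly one marked BPD of a $k$-Grassmannian permutation of $[a,b]$; for $T'$ the marked tiles are those of the diagram $\mu$ placed at the NW corner of the grid; and if a marked tableau and a marked BPD correspond, then each step of one algorithm is matched by a step of the same kind of the other algorithm with corresponding results, where (a) without deletion is matched with a column move (2), a move of the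 mark in (b) with a slide (1), and (a) with deletion with the removal (3). -/

import Mathlib

namespace Taquin

/-! ### Tableaux and jeu de taquin

Boxes are pairs `(row, column)` in `ℕ × ℕ`, counted from `0`, in the English convention. -/

/-- A filling of some boxes by integers; `none` means that the box is empty. -/
abbrev Filling := ℕ × ℕ → Option ℤ

/-- `T` is a semistandard tableau of skew shape `ν / μ` with entries in `[lo, hi]`. -/
structure IsSSYT (ν μ : YoungDiagram) (lo hi : ℤ) (T : Filling) : Prop where
  shape : ∀ p, (T p).isSome ↔ p ∈ ν ∧ p ∉ μ
  bounds : ∀ p x, T p = some x → lo ≤ x ∧ x ≤ hi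
  row_weak : ∀ r c x y, T (r, c) = some x → T (r, c + 1) = some y → x ≤ y
  col_strict : ∀ r c x y, T (r, c) = some x → T (r + 1, c) = some y → x < y

/-- A stage of jeu de taquin: the empty boxes of the NW region that have not been treated yet,
the numbers that are present, and the active empty box, if there is one. -/
structure JdtState where
  inner : Finset (ℕ × ℕ)
  filling : Filling
  active : Option (ℕ × ℕ)

/-- A SE-most box of the empty NW region becomes active. -/
inductive JdtPick : JdtState → JdtState → Prop
  | mk (J : JdtState) (p : ℕ × ℕ) (h : J.active = none) (hp : Maximal (· ∈ J.inner) p) :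
      JdtPick J ⟨J.inner.erase p, J.filling, some p⟩

/-- A vertical slide: the number `x` below the active box moves up.  It is the smaller of the
numbers below and to the right (in a tie the one below is chosen). -/
inductive JdtUp : JdtState → JdtState → Prop
  | mk (J : JdtState) (r c : ℕ) (x : ℤ) (h : J.active = some (r, c))
      (hx : J.filling (r + 1, c) = some x)
      (hy : ∀ y, J.filling (r, c + 1) = some y → x ≤ y) :
      JdtUp J ⟨J.inner,
        Function.update (Function.update J.filling (r, c) (some x)) (r + 1, c) none,
        some (r + 1, c)⟩

/-- A horizontal slide: the number `y` to the right of the active box moves left.  It is strictly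
smaller than the number below, if there is one. -/
inductive JdtLeft : JdtState → JdtState → Prop
  | mk (J : JdtState) (r c : ℕ) (y : ℤ) (h : J.active = some (r, c))
      (hy : J.filling (r, c + 1) = some y)
      (hx : ∀ x, J.filling (r + 1, c) = some x → y < x) :
      JdtLeft J ⟨J.inner,
        Function.update (Function.update J.filling (r, c) (some y)) (r, c + 1) none,
        some (r, c + 1)⟩

/-- The active empty box has reached the SE border, and the current slide is finished. -/
inductive JdtStop : JdtState → JdtState → Prop
  | mk (J : JdtState) (r c : ℕ) (h : J.active = some (r, c))
      (hx : J.filling (r + 1, c) = none) (hy : J.filling (r, c + 1) = none) :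
      JdtStop J ⟨J.inner, J.filling, none⟩

/-- One elementary step of jeu de taquin. -/
def JdtStep (J J' : JdtState) : Prop :=
  JdtPick J J' ∨ JdtUp J J' ∨ JdtLeft J J' ∨ JdtStop J J'

/-- `R` is the result of a complete run of jeu de taquin on the skew tableau `T` whose
empty NW region is `μ`. -/
def JdtRectifiesTo (μ : YoungDiagram) (T R : Filling) : Prop :=
  Relation.ReflTransGen JdtStep ⟨μ.cells, T, none⟩ ⟨∅, R, none⟩

/-! ### The rectification algorithm on marked tableaux -/

/-- The kinds of steps of the two rectification algorithms.

* `pick`: a SE-most mark becomes active.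
* `move`: (tableaux) the active number is incremented and the mark is pushed down;
  (bumpless pipe dreams) a column move.
* `slide`: the mark is moved to the right along a row.
* `remove`: the mark is deleted; this ends the iteration. -/
inductive StepKind
  | pick
  | move
  | slide
  | remove

/-- A marked tableau.  `marks` is the set of all marked boxes, the active one included.  The flag
`checkRight` is set when, after an increment, the number to the right has still to be
compared with the active number. -/
structure MarkedTableau where
  entries : Filling
  marks : Finset (ℕ × ℕ)
  active : Option (ℕ × ℕ)
  checkRight : Bool

/-- The active number equals the number below: increment the number below and move the
mark there. -/
inductive PushDown : Filling × (ℕ × ℕ) → Filling × (ℕ × ℕ) → Prop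
  | mk (E : Filling) (r c : ℕ) (x : ℤ) (h : E (r, c) = some x) (h' : E (r + 1, c) = some x) :
      PushDown (E, (r, c)) (Function.update E (r + 1, c) (some (x + 1)), (r + 1, c))

/-- Starting from the active box `p` of `E`: increment the active number, and then push the mark
down as long as the active number equals the number below.  The result is the filling `E'` with
the mark at `p'`. -/
def IncrementPush (E : Filling) (p : ℕ × ℕ) (E' : Filling) (p' : ℕ × ℕ) : Prop :=
  ∃ x, E p = some x ∧
    Relation.ReflTransGen PushDown (Function.update E p (some (x + 1)), p) (E', p') ∧
    ¬ ∃ S, PushDown (E', p') S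

/-- The number at `p` exceeds `k` (it is `k + 1`) and `p` is at the SE border. -/
def Deletable (k : ℤ) (E : Filling) (p : ℕ × ℕ) : Prop :=
  E p = some (k + 1) ∧ E (p.1 + 1, p.2) = none ∧ E (p.1, p.2 + 1) = none

/-- The number to the right of `p` equals the number at `p`. -/
def EqualRight (E : Filling) (p : ℕ × ℕ) : Prop :=
  ∃ x, E p = some x ∧ E (p.1, p.2 + 1) = some x

/-- The steps of the rectification algorithm on marked tableaux. -/
inductive TableauStep (k : ℤ) : StepKind → MarkedTableau → MarkedTableau → Prop
  | pick (s : MarkedTableau) (p : ℕ × ℕ) (h : s.active = none)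
      (hp : Maximal (· ∈ s.marks) p) :
      TableauStep k .pick s ⟨s.entries, s.marks, some p, false⟩
  | move (s : MarkedTableau) (p p' : ℕ × ℕ) (E' : Filling) (h : s.active = some p)
      (hr : ¬ (s.checkRight = true ∧ EqualRight s.entries p))
      (hi : IncrementPush s.entries p E' p') (hd : ¬ Deletable k E' p') :
      TableauStep k .move s ⟨E', insert p' (s.marks.erase p), some p', true⟩
  | remove (s : MarkedTableau) (p p' : ℕ × ℕ) (E' : Filling) (h : s.active = some p)
      (hr : ¬ (s.checkRight = true ∧ EqualRight s.entries p))
      (hi : IncrementPush s.entries p E' p') (hd : Deletable k E' p') :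
      TableauStep k .remove s
        ⟨Function.update E' p' none, s.marks.erase p, none, false⟩
  | slide (s : MarkedTableau) (r c c' : ℕ) (x : ℤ) (h : s.active = some (r, c))
      (hr : s.checkRight = true ∧ EqualRight s.entries (r, c))
      (hx : s.entries (r, c) = some x) (hc : c < c') (hc' : s.entries (r, c') = some x)
      (hmax : ∀ c'', c' < c'' → s.entries (r, c'') ≠ some x) :
      TableauStep k .slide s
        ⟨s.entries, insert (r, c') (s.marks.erase (r, c)), some (r, c'), false⟩

/-- The completed tableau: with `ℓ` the number of rows of `μ`, the boxes of `μ` in the `i`-th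
row (counted from `1`) receive the marked number `i - ℓ`. -/
def completion (μ : YoungDiagram) (T : Filling) : MarkedTableau where
  entries := fun p => if p ∈ μ.cells then some ((p.1 : ℤ) + 1 - (μ.colLen 0 : ℤ)) else T p
  marks := μ.cells
  active := none
  checkRight := false

/-- `s` occurs in a run of the algorithm that starts with the completion of `T`. -/
def Reachable (k : ℤ) (μ : YoungDiagram) (T : Filling) (s : MarkedTableau) : Prop :=
  Relation.ReflTransGen (fun s s' => ∃ κ, TableauStep k κ s s') (completion μ T) s

/-- Erase the marked numbers: the active box becomes the active empty box, and the other marked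
boxes are the empty boxes that have not been treated yet. -/
def MarkedTableau.unmark (s : MarkedTableau) : JdtState where
  inner := s.marks.filter (fun p => s.active ≠ some p)
  filling := fun p => if p ∈ s.marks then none else s.entries p
  active := s.active

/-! ### Bumpless pipe dreams -/

/-- The six tiles.  A pipe in `are` connects south and east, a pipe in `jay` connects
north and west. -/
inductive Tile
  | blank
  | cross
  | horiz
  | vert
  | are
  | jay

namespace Tile

/-- Does a pipe meet the north side of the tile? -/
def north : Tile → Bool
  | cross | vert | jay => true
  | _ => false

/-- Does a pipe meet the south side of the tile? -/
def south : Tile → Bool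
  | cross | vert | are => true
  | _ => false

/-- Does a pipe meet the east side of the tile? -/
def east : Tile → Bool
  | cross | horiz | are => true
  | _ => false

/-- Does a pipe meet the west side of the tile? -/
def west : Tile → Bool
  | cross | horiz | jay => true
  | _ => false

end Tile

/-- A tiling; positions are matrix coordinates `(row, column)`. -/
abbrev Tiling := ℤ × ℤ → Tile

/-- Positions of the grid with rows and columns in `[a, b]`. -/
def InGrid (a b : ℤ) (p : ℤ × ℤ) : Prop :=
  (a ≤ p.1 ∧ p.1 ≤ b) ∧ (a ≤ p.2 ∧ p.2 ≤ b)

/-- `Visits b D p true (i, j)`: the pipe with label `p` (its column on the south border) enters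
the tile at `(i, j)` from the south; with `false` in place of `true`, from the west. -/
inductive Visits (b : ℤ) (D : Tiling) (p : ℤ) : Bool → ℤ × ℤ → Prop
  | start : Visits b D p true (b, p)
  | up (i j : ℤ) (h : Visits b D p true (i, j)) (ht : D (i, j) = .vert ∨ D (i, j) = .cross) :
      Visits b D p true (i - 1, j)
  | turnEast (i j : ℤ) (h : Visits b D p true (i, j)) (ht : D (i, j) = .are) :
      Visits b D p false (i, j + 1)
  | right (i j : ℤ) (h : Visits b D p false (i, j)) (ht : D (i, j) = .horiz ∨ D (i, j) = .cross) :
      Visits b D p false (i, j + 1)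
  | turnNorth (i j : ℤ) (h : Visits b D p false (i, j)) (ht : D (i, j) = .jay) :
      Visits b D p true (i - 1, j)

/-- The pipes `p` and `q` cross at `c`, with `p` vertical and `q` horizontal. -/
def CrossAt (b : ℤ) (D : Tiling) (p q : ℤ) (c : ℤ × ℤ) : Prop :=
  D c = .cross ∧ Visits b D p true c ∧ Visits b D q false c

/-- `D` is a (reduced) bumpless pipe dream of the permutation `w` of `[a, b]`.  Outside of the
grid, `D` carries no information and is normalized to be blank. -/
structure IsBPD (a b : ℤ) (w : Equiv.Perm ℤ) (D : Tiling) : Prop where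
  outside : ∀ p, ¬ InGrid a b p → D p = .blank
  vertical : ∀ i j, a ≤ i → i < b → a ≤ j → j ≤ b → (D (i, j)).south = (D (i + 1, j)).north
  horizontal : ∀ i j, a ≤ i → i ≤ b → a ≤ j → j < b → (D (i, j)).east = (D (i, j + 1)).west
  border : ∀ t, a ≤ t → t ≤ b → (D (a, t)).north = false ∧ (D (t, a)).west = false ∧
    (D (b, t)).south = true ∧ (D (t, b)).east = true
  perm : ∀ i, a ≤ i → i ≤ b → Visits b D (w i) false (i, b + 1)
  reduced : ∀ p q, a ≤ p → p ≤ b → a ≤ q → q ≤ b → ∀ c c',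
    (CrossAt b D p q c ∨ CrossAt b D q p c) → (CrossAt b D p q c' ∨ CrossAt b D q p c') → c = c'

/-- `w` is a permutation of `[a, b]` (extended by the identity) without descents at positions
other than `k`. -/
def IsGrassmannian (a b k : ℤ) (w : Equiv.Perm ℤ) : Prop :=
  (∀ i, ¬ (a ≤ i ∧ i ≤ b) → w i = i) ∧ ∀ i, a ≤ i → i < b → i ≠ k → w i < w (i + 1)

/-- `lam` is the partition of the `k`-Grassmannian permutation `w` of `[a, b]`: its parts are
`w i - i` for `i = k, k - 1, …, a`. -/
def IsShapeOf (a k : ℤ) (w : Equiv.Perm ℤ) (lam : YoungDiagram) : Prop :=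
  ∀ r c : ℕ, (r, c) ∈ lam ↔ a ≤ k - r ∧ (c : ℤ) < w (k - r) - (k - r)

/-- A tiling together with a label on each blank tile (labels at other tiles are irrelevant). -/
abbrev LabeledTiling := Tiling × (ℤ × ℤ → ℤ × ℤ)

/-- A droop move: the pipe with an `are`-tile at `(i, j)` droops into the blank tile at
`(i + 1, j + 1)`.  The blank tile moves to `(i, j)`, together with its label. -/
inductive Droop (a b : ℤ) : LabeledTiling → LabeledTiling → Prop
  | mk (D D' : Tiling) (L : ℤ × ℤ → ℤ × ℤ) (i j : ℤ)
      (hg : InGrid a b (i, j)) (hg' : InGrid a b (i + 1, j + 1))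
      (hr : D (i, j) = .are) (hb : D (i + 1, j + 1) = .blank)
      (nw : D' (i, j) = .blank) (se : D' (i + 1, j + 1) = .jay)
      (ne : (D (i, j + 1) = .horiz ∧ D' (i, j + 1) = .are) ∨
        (D (i, j + 1) = .jay ∧ D' (i, j + 1) = .vert))
      (sw : (D (i + 1, j) = .vert ∧ D' (i + 1, j) = .are) ∨
        (D (i + 1, j) = .jay ∧ D' (i + 1, j) = .horiz))
      (rest : ∀ p, p ≠ (i, j) → p ≠ (i + 1, j + 1) → p ≠ (i, j + 1) → p ≠ (i + 1, j) →
        D' p = D p) :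
      Droop a b (D, L) (D', Function.update L (i, j) (L (i + 1, j + 1)))

/-- Label each blank tile of `D` by its position, and perform droop moves until none is possible.
Then `O (r, c)` is the label of the blank tile in box `(r, c)` of the NW corner of the grid. -/
def OriginTableau (a b : ℤ) (D : Tiling) (O : ℕ × ℕ → Option (ℤ × ℤ)) : Prop :=
  ∃ F : LabeledTiling, Relation.ReflTransGen (Droop a b) (D, id) F ∧ (¬ ∃ G, Droop a b F G) ∧
    ∀ (r c : ℕ) (q : ℤ × ℤ), O (r, c) = some q ↔
      InGrid a b (a + r, a + c) ∧ F.1 (a + r, a + c) = .blank ∧ F.2 (a + r, a + c) = q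

/-- `S` is the tableau obtained from `D` by labeling each blank tile with its row and performing
all possible droop moves. -/
def IsTableauOf (a b : ℤ) (D : Tiling) (S : Filling) : Prop :=
  ∃ O, OriginTableau a b D O ∧ ∀ p, S p = (O p).map Prod.fst

/-! ### Rectification of marked bumpless pipe dreams -/

/-- A tiling with a set of marked blank tiles, the active one included. -/
structure MarkedBPD where
  tiles : Tiling
  marks : Finset (ℤ × ℤ)
  active : Option (ℤ × ℤ)

/-- How a column move changes two neighboring tiles in a row strictly between the top and the
bottom row of the move: the vertical strand of the moving pipe goes from the right to the left
column, and the kinks of other pipes go from the left to the right column. -/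
def shiftPair : Tile → Tile → Tile × Tile
  | .blank, .vert => (.vert, .blank)
  | .horiz, .cross => (.cross, .horiz)
  | .are, .cross => (.vert, .are)
  | .jay, .vert => (.cross, .jay)
  | s, t => (s, t)

/-- The column move in rows `[i, i']` and columns `j, j + 1`, where `(i, j)` is blank.
If `(i', j + 1)` is a `jay`-tile, then its pipe is undrooped into `(i, j)`.
If `(i', j + 1)` is a cross, then the cross is replaced by a bump of a `jay`-elbow and an
`are`-elbow, and the `jay`-elbow is undrooped into `(i, j)`. -/
def columnMove (D : Tiling) (i i' j : ℤ) : Tiling := fun p =>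
  if p = (i, j) then .are
  else if p = (i, j + 1) then
    match D p with
    | .are => .horiz
    | .vert => .jay
    | t => t
  else if p = (i', j) then
    match D p with
    | .are => .vert
    | .horiz => .jay
    | t => t
  else if p = (i', j + 1) then
    match D p with
    | .jay => .blank
    | .cross => .are
    | t => t
  else if i < p.1 ∧ p.1 < i' ∧ p.2 = j then (shiftPair (D (p.1, j)) (D (p.1, j + 1))).1
  else if i < p.1 ∧ p.1 < i' ∧ p.2 = j + 1 then (shiftPair (D (p.1, j)) (D (p.1, j + 1))).2
  else D p

/-- The pipe through `(i, j + 1)` comes up column `j + 1` from a `jay`-tile at `(i', j + 1)`. -/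
def CanUndroop (D : Tiling) (i i' j : ℤ) : Prop :=
  i < i' ∧ D (i', j + 1) = .jay ∧
    ∀ r, i < r → r < i' → D (r, j + 1) = .vert ∨ D (r, j + 1) = .cross

/-- The steps of the rectification algorithm on marked bumpless pipe dreams. -/
inductive BPDStep (b : ℤ) : StepKind → MarkedBPD → MarkedBPD → Prop
  | pick (M : MarkedBPD) (p : ℤ × ℤ) (h : M.active = none)
      (hp : Maximal (· ∈ M.marks) p) :
      BPDStep b .pick M ⟨M.tiles, M.marks, some p⟩
  | slide (M : MarkedBPD) (i j j' : ℤ) (h : M.active = some (i, j)) (hj : j < j')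
      (hb : ∀ y, j < y → y ≤ j' → M.tiles (i, y) = .blank)
      (he : M.tiles (i, j' + 1) ≠ .blank) :
      BPDStep b .slide M
        ⟨M.tiles, insert (i, j') (M.marks.erase (i, j)), some (i, j')⟩
  | move (M : MarkedBPD) (i i' j : ℤ) (h : M.active = some (i, j))
      (hr : M.tiles (i, j + 1) ≠ .blank) (hu : CanUndroop M.tiles i i' j) :
      BPDStep b .move M
        ⟨columnMove M.tiles i i' j, insert (i', j + 1) (M.marks.erase (i, j)), some (i', j + 1)⟩
  | remove (M : MarkedBPD) (i i' j : ℤ) (h : M.active = some (i, j))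
      (hr : M.tiles (i, j + 1) ≠ .blank) (hu : ¬ ∃ i'', CanUndroop M.tiles i i'' j)
      (hi : i < i') (hc : CrossAt b M.tiles (j + 1) j (i', j + 1)) :
      BPDStep b .remove M ⟨columnMove M.tiles i i' j, M.marks.erase (i, j), none⟩

/-- The marked bumpless pipe dream `M` of a `k`-Grassmannian permutation of `[a, b]` corresponds
to the marked tableau `s`: the droop moves carry the blank tiles of `M`, labeled with their rows,
to the boxes of `s`, marked tiles to marked boxes, and the active tile to the active box. -/
structure Corresponds (a b k : ℤ) (s : MarkedTableau) (M : MarkedBPD) : Prop where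
  bpd : ∃ w, IsGrassmannian a b k w ∧ IsBPD a b w M.tiles
  marks_blank : ∀ q ∈ M.marks, InGrid a b q ∧ M.tiles q = .blank
  droops : ∃ O, OriginTableau a b M.tiles O ∧
    (∀ p, s.entries p = (O p).map Prod.fst) ∧
    (∀ p, p ∈ s.marks ↔ ∃ q ∈ M.marks, O p = some q) ∧
    s.active.map O = M.active.map some

end Taquin

open Taquin

namespace Taquin

/-! ### Matched tilings -/

/-! Everything rests on one change of coordinates: the number `x` in box `(r, c)` of a tableau
stands for a blank tile at `(x, x + c - r)` (`tilePos`). Droop moves push blank tiles along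
diagonals, so the box fixes the diagonal and the entry fixes the row.

Pipes. In a bumpless pipe dream of a `k`-Grassmannian permutation, each pipe goes straight up below
row `k` until it turns right for good or enters row `k`. In the rows up to `k` the pipes appear in
the order in which they have to leave; a crossing there would put two pipes into the wrong order,
which only a second crossing could repair, against reducedness. So these pipe dreams are tilings
described by local conditions (`IsGrassTiling`): no crosses up to row `k`, and neither blank tiles
nor `jay`-tiles below it. Conversely such a tiling is a pipe dream of the permutation read off from
the columns in which pipes enter row `k` from below (`IsBPD.isGrassTiling`, `IsGrassTiling.isBPD`).
It is determined by its blank tiles (`IsGrassTiling.eq_of_blank`).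

Bijection. When no droop is possible, the blank tiles form a Young diagram in the NW corner, which
corresponds to the tableau with constant rows `a, a + 1, …`. Undoing a droop increases one entry by
1, and the tableau remains semistandard because the two neighboring tiles are not blank
(`IsGrassTiling.exists_tableau`). As the blank positions determine the tableau
(`IsSSYT.eq_of_tilePos`), the order of the droops is irrelevant. Conversely, every semistandard
tableau is reached from the minimal one by unit increments, each realized by an undroop
(`IsSSYT.exists_tiling`). Droops do not affect the lower edges of row `k`, and these encode the
partition.

Jeu de taquin. Part (a) of a pass adds 1 to a maximal run `x, x + 1, …, x + m` going down a column
from the active box (`bump`). If the marked numbers are erased, this looks like moving `x + 1, …, x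
+ m` up by one box, that is, `m` vertical slides. Moving the mark along equal entries looks like
horizontal slides. The invariant `RunInv` keeps the entries semistandard with the active number
included; this shows that each slide is the one required by jeu de taquin, and that a number
exceeding `k` is at the SE border. Jeu de taquin is deterministic while a box is active, so complete
runs agree once the picks agree.

Agreement. The run `x, …, x + m` corresponds to a vertical block of blank tiles in a single column
`j`, and increasing it moves the block one step to the SE. This is the effect of a column move: next
to the block runs a vertical pipe, which ends in a `jay` if `x + m < k`, and passes on to a crossing
of the pipes `j` and `j + 1` below row `k` if `x + m = k` (`IsGrassTiling.column_move`,
`IsGrassTiling.column_remove`). Steps on tableaux are thereby matched by steps on pipe dreams; the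
converse holds because the latter are deterministic once a tile is active (`BPDStep.deterministic`).
-/

theorem Tile.ext_edges {s t : Tile} (hn : s.north = t.north) (hs : s.south = t.south)
    (he : s.east = t.east) (hw : s.west = t.west) : s = t := by
  cases s <;> cases t <;> simp_all [Tile.north, Tile.south, Tile.east, Tile.west]

/-- A tiling by pipes of the grid `[a, b]`, without conditions on the pipes. -/
structure IsMatched (a b : ℤ) (D : Tiling) : Prop where
  outside : ∀ p, ¬ InGrid a b p → D p = .blank
  vertical : ∀ i j, a ≤ i → i < b → a ≤ j → j ≤ b → (D (i, j)).south = (D (i + 1, j)).north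
  horizontal : ∀ i j, a ≤ i → i ≤ b → a ≤ j → j < b → (D (i, j)).east = (D (i, j + 1)).west
  border : ∀ t, a ≤ t → t ≤ b → (D (a, t)).north = false ∧ (D (t, a)).west = false ∧
    (D (b, t)).south = true ∧ (D (t, b)).east = true

theorem IsBPD.isMatched {a b : ℤ} {w : Equiv.Perm ℤ} {D : Tiling} (h : IsBPD a b w D) :
    IsMatched a b D :=
  ⟨h.outside, h.vertical, h.horizontal, h.border⟩

/-- A horizontal tile or a cross. -/
def Tile.Thru (t : Tile) : Prop := t = .horiz ∨ t = .cross

theorem Tile.Thru.west {t : Tile} (h : t.Thru) : t.west = true := by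
  rcases h with rfl | rfl <;> rfl

theorem Tile.Thru.east {t : Tile} (h : t.Thru) : t.east = true := by
  rcases h with rfl | rfl <;> rfl

theorem Tile.Thru.ne_are {t : Tile} (h : t.Thru) : t ≠ .are := by
  rcases h with rfl | rfl <;> simp

theorem Tile.Thru.ne_jay {t : Tile} (h : t.Thru) : t ≠ .jay := by
  rcases h with rfl | rfl <;> simp

theorem Tile.thru_of_west {t : Tile} (h : t.west = true) (hj : t ≠ .jay) : t.Thru := by
  cases t <;> simp_all [Tile.west, Tile.Thru]

theorem Tile.thru_of_east {t : Tile} (h : t.east = true) (hj : t ≠ .are) : t.Thru := by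
  cases t <;> simp_all [Tile.east, Tile.Thru]

theorem IsMatched.inGrid_of_ne {a b : ℤ} {D : Tiling} (h : IsMatched a b D) {p : ℤ × ℤ}
    (hp : D p ≠ .blank) : InGrid a b p := by
  by_contra hc
  exact hp (h.outside p hc)

/-- Follow a pipe to the left until it turns. -/
theorem IsMatched.run_left {a b : ℤ} {D : Tiling} (h : IsMatched a b D) {i j : ℤ}
    (hj : (D (i, j)).east = true) :
    ∃ y, a ≤ y ∧ y ≤ j ∧ D (i, y) = .are ∧ ∀ z, y < z → z ≤ j → (D (i, z)).Thru := by
  have key : ∀ n : ℕ, ∀ j, j - a = n → (D (i, j)).east = true →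
      ∃ y, a ≤ y ∧ y ≤ j ∧ D (i, y) = .are ∧ ∀ z, y < z → z ≤ j → (D (i, z)).Thru := by
    intro n
    induction n with
    | zero =>
      intro j hn hj
      have hg : InGrid a b (i, j) := h.inGrid_of_ne (by intro h0; simp [h0, Tile.east] at hj)
      obtain ⟨⟨h1, h2⟩, h3, h4⟩ := hg
      simp only at h1 h2 h3 h4
      have hja : j = a := by omega
      subst hja
      have hw := (h.border i h1 h2).2.1
      refine ⟨j, le_rfl, le_rfl, ?_, fun z hz hz' => by omega⟩
      cases hD : D (i, j) <;> simp_all [Tile.east, Tile.west]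
    | succ n ih =>
      intro j hn hj
      have hg : InGrid a b (i, j) := h.inGrid_of_ne (by intro h0; simp [h0, Tile.east] at hj)
      obtain ⟨⟨h1, h2⟩, h3, h4⟩ := hg
      simp only at h1 h2 h3 h4
      by_cases hr : D (i, j) = .are
      · exact ⟨j, h3, le_rfl, hr, fun z hz hz' => by omega⟩
      have hthru : (D (i, j)).Thru := Tile.thru_of_east hj hr
      have he := h.horizontal i (j - 1) h1 h2 (by omega) (by omega)
      rw [sub_add_cancel, hthru.west] at he
      obtain ⟨y, hy1, hy2, hy3, hy4⟩ := ih (j - 1) (by omega) he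
      refine ⟨y, hy1, by omega, hy3, fun z hz hz' => ?_⟩
      rcases eq_or_lt_of_le hz' with rfl | hlt
      · exact hthru
      · exact hy4 z hz (by omega)
  have hg : InGrid a b (i, j) := h.inGrid_of_ne (by intro h0; simp [h0, Tile.east] at hj)
  obtain ⟨⟨h1, h2⟩, h3, h4⟩ := hg
  exact key (j - a).toNat j (by simp only at h3; omega) hj

/-- Follow a pipe to the right until it turns or leaves the grid. -/
theorem IsMatched.run_right {a b : ℤ} {D : Tiling} (h : IsMatched a b D) {i y : ℤ}
    (hy : (D (i, y)).east = true) :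
    (∃ z, y < z ∧ z ≤ b ∧ D (i, z) = .jay ∧ ∀ x, y < x → x < z → (D (i, x)).Thru) ∨
      ∀ x, y < x → x ≤ b → (D (i, x)).Thru := by
  have key : ∀ n : ℕ, ∀ y, b - y = n → (D (i, y)).east = true →
    (∃ z, y < z ∧ z ≤ b ∧ D (i, z) = .jay ∧ ∀ x, y < x → x < z → (D (i, x)).Thru) ∨
      ∀ x, y < x → x ≤ b → (D (i, x)).Thru := by
    intro n
    induction n with
    | zero =>
      intro y hn _
      exact Or.inr fun x hx hx' => by omega
    | succ n ih =>
      intro y hn hy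
      have hg : InGrid a b (i, y) := h.inGrid_of_ne (by intro h0; simp [h0, Tile.east] at hy)
      obtain ⟨⟨h1, h2⟩, h3, h4⟩ := hg
      simp only at h1 h2 h3 h4
      have he := h.horizontal i y h1 h2 h3 (by omega)
      rw [hy] at he
      by_cases hj : D (i, y + 1) = .jay
      · exact Or.inl ⟨y + 1, by omega, by omega, hj, fun x _ _ => by omega⟩
      have hthru : (D (i, y + 1)).Thru := Tile.thru_of_west he.symm hj
      have hext : ∀ x, y < x → (y + 1 < x → (D (i, x)).Thru) → (D (i, x)).Thru := by
        intro x hx hx'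
        by_cases hxy : x = y + 1
        · rw [hxy]; exact hthru
        · exact hx' (by omega)
      rcases ih (y + 1) (by omega) hthru.east with ⟨z, hz1, hz2, hz3, hz4⟩ | hr
      · exact Or.inl ⟨z, by omega, hz2, hz3, fun x hx hx' => hext x hx fun hx2 => hz4 x hx2 hx'⟩
      · exact Or.inr fun x hx hx' => hext x hx fun hx2 => hr x hx2 hx'
  have hg : InGrid a b (i, y) := h.inGrid_of_ne (by intro h0; simp [h0, Tile.east] at hy)
  obtain ⟨⟨h1, h2⟩, h3, h4⟩ := hg
  exact key (b - y).toNat y (by simp only at h4; omega) hy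

/-! ### Following labeled pipes -/

theorem visits_true_iff {b : ℤ} {D : Tiling} {p i j : ℤ} :
    Visits b D p true (i, j) ↔ (i = b ∧ j = p) ∨
      (Visits b D p true (i + 1, j) ∧ (D (i + 1, j) = .vert ∨ D (i + 1, j) = .cross)) ∨
      (Visits b D p false (i + 1, j) ∧ D (i + 1, j) = .jay) := by
  constructor
  · intro h
    generalize hc : (i, j) = c at h
    generalize hd : true = d at h
    cases h with
    | start => simp only [Prod.mk.injEq] at hc; exact Or.inl hc
    | up i' j' h1 ht =>
      simp only [Prod.mk.injEq] at hc
      obtain ⟨rfl, rfl⟩ := hc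
      exact Or.inr (Or.inl (by simpa using ⟨h1, ht⟩))
    | turnNorth i' j' h1 ht =>
      simp only [Prod.mk.injEq] at hc
      obtain ⟨rfl, rfl⟩ := hc
      exact Or.inr (Or.inr (by simpa using ⟨h1, ht⟩))
    | turnEast => simp at hd
    | right => simp at hd
  · rintro (⟨rfl, rfl⟩ | ⟨h, ht⟩ | ⟨h, ht⟩)
    · exact .start
    · simpa using Visits.up _ _ h ht
    · simpa using Visits.turnNorth _ _ h ht

theorem visits_false_iff {b : ℤ} {D : Tiling} {p i j : ℤ} :
    Visits b D p false (i, j) ↔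
      (Visits b D p true (i, j - 1) ∧ D (i, j - 1) = .are) ∨
      (Visits b D p false (i, j - 1) ∧ (D (i, j - 1)).Thru) := by
  constructor
  · intro h
    generalize hc : (i, j) = c at h
    generalize hd : false = d at h
    cases h with
    | start => simp at hd
    | up => simp at hd
    | turnNorth => simp at hd
    | turnEast i' j' h1 ht =>
      simp only [Prod.mk.injEq] at hc
      obtain ⟨rfl, rfl⟩ := hc
      exact Or.inl (by simpa using ⟨h1, ht⟩)
    | right i' j' h1 ht =>
      simp only [Prod.mk.injEq] at hc
      obtain ⟨rfl, rfl⟩ := hc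
      exact Or.inr (by simpa [Tile.Thru] using ⟨h1, ht⟩)
  · rintro (⟨h, ht⟩ | ⟨h, ht⟩)
    · simpa using Visits.turnEast _ _ h ht
    · simpa using Visits.right _ _ h ht

theorem IsMatched.blank_below {a b : ℤ} {D : Tiling} (h : IsMatched a b D) (j : ℤ) :
    D (b + 1, j) = .blank :=
  h.outside _ fun hg => by have := hg.1.2; simp only at this; omega

theorem IsMatched.blank_right {a b : ℤ} {D : Tiling} (h : IsMatched a b D) (i : ℤ) :
    D (i, b + 1) = .blank :=
  h.outside _ fun hg => by have := hg.2.2; simp only at this; omega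

/-- A tile and the side by which a pipe leaves it determine the side by which the pipe came in, so
both labels can be followed back simultaneously. The blank row `b + 1` ensures that this does not
continue beyond the south border, where an edge is labeled by its column. -/
theorem IsMatched.label_unique {a b : ℤ} {D : Tiling} (h : IsMatched a b D) {p q : ℤ} {d : Bool}
    {c : ℤ × ℤ} (hp : Visits b D p d c) (hq : Visits b D q d c) : p = q := by
  have hbl := h.blank_below
  induction hp with
  | start =>
    rcases visits_true_iff.1 hq with ⟨_, h1⟩ | ⟨_, h1⟩ | ⟨_, h1⟩
    · exact h1
    · simp [hbl] at h1
    · simp [hbl] at h1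
  | up i j h1 ht ih =>
    rcases visits_true_iff.1 hq with ⟨h2, _⟩ | ⟨h2, _⟩ | ⟨h2, h3⟩
    · obtain rfl : i = b + 1 := by omega
      simp [hbl] at ht
    · exact ih (by simpa using h2)
    · rw [sub_add_cancel] at h3; simp [h3] at ht
  | turnEast i j h1 ht ih =>
    rcases visits_false_iff.1 hq with ⟨h2, _⟩ | ⟨h2, h3⟩
    · exact ih (by simpa using h2)
    · rw [add_sub_cancel_right] at h3; exact absurd ht h3.ne_are
  | right i j h1 ht ih =>
    rcases visits_false_iff.1 hq with ⟨h2, h3⟩ | ⟨h2, h3⟩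
    · rw [add_sub_cancel_right] at h3; simp [h3] at ht
    · exact ih (by simpa using h2)
  | turnNorth i j h1 ht ih =>
    rcases visits_true_iff.1 hq with ⟨h2, _⟩ | ⟨_, h3⟩ | ⟨h2, _⟩
    · obtain rfl : i = b + 1 := by omega
      simp [hbl] at ht
    · rw [sub_add_cancel] at h3; simp [ht] at h3
    · exact ih (by simpa using h2)

theorem visits_run {b : ℤ} {D : Tiling} {p i y : ℤ} (h : Visits b D p true (i, y))
    (ht : D (i, y) = .are) {z : ℤ} (hz : y < z) (hr : ∀ x, y < x → x < z → (D (i, x)).Thru) :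
    Visits b D p false (i, z) := by
  have key : ∀ n : ℕ, ∀ z, z - y = n + 1 → (∀ x, y < x → x < z → (D (i, x)).Thru) →
      Visits b D p false (i, z) := by
    intro n
    induction n with
    | zero =>
      intro z hz _
      obtain rfl : z = y + 1 := by push_cast at hz; omega
      exact .turnEast _ _ h ht
    | succ n ih =>
      intro z hz hr
      refine visits_false_iff.2 (Or.inr ⟨ih (z - 1) (by push_cast at hz ⊢; omega) fun x hx hx' =>
        hr x hx (by omega), hr _ (by omega) (by omega)⟩)
  exact key (z - y - 1).toNat z (by omega) hr

/-- The edges on a pipe are edges of the tiling. -/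
theorem IsMatched.visits_edge {a b : ℤ} {D : Tiling} (h : IsMatched a b D) {p : ℤ} (hp : a ≤ p)
    (hp' : p ≤ b) {d : Bool} {c : ℤ × ℤ} (hv : Visits b D p d c) :
    (d = true → a - 1 ≤ c.1 ∧ c.1 ≤ b ∧ a ≤ c.2 ∧ c.2 ≤ b ∧ (a ≤ c.1 → (D c).south = true)) ∧
      (d = false → a ≤ c.1 ∧ c.1 ≤ b ∧ a < c.2 ∧ c.2 ≤ b + 1 ∧
        (c.2 ≤ b → (D c).west = true)) := by
  have hin : ∀ i j, D (i, j) ≠ .blank → a ≤ i ∧ i ≤ b ∧ a ≤ j ∧ j ≤ b := by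
    intro i j hb
    obtain ⟨⟨h1, h2⟩, h3, h4⟩ := h.inGrid_of_ne hb
    exact ⟨h1, h2, h3, h4⟩
  have hup : ∀ i j, (D (i, j)).north = true →
      a - 1 ≤ i - 1 ∧ i - 1 ≤ b ∧ a ≤ j ∧ j ≤ b ∧ (a ≤ i - 1 → (D (i - 1, j)).south = true) := by
    intro i j hn
    obtain ⟨h1, h2, h3, h4⟩ := hin i j (by intro h0; simp [h0, Tile.north] at hn)
    refine ⟨by omega, by omega, h3, h4, fun ha => ?_⟩
    rw [h.vertical _ _ ha (by omega) h3 h4, sub_add_cancel, hn]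
  have hright : ∀ i j, (D (i, j)).east = true →
      a ≤ i ∧ i ≤ b ∧ a < j + 1 ∧ j + 1 ≤ b + 1 ∧ (j + 1 ≤ b → (D (i, j + 1)).west = true) := by
    intro i j hn
    obtain ⟨h1, h2, h3, h4⟩ := hin i j (by intro h0; simp [h0, Tile.east] at hn)
    refine ⟨by omega, by omega, by omega, by omega, fun ha => ?_⟩
    rw [← h.horizontal _ _ h1 h2 h3 (by omega), hn]
  cases hv with
  | start =>
    have := (h.border p hp hp').2.2.1
    refine ⟨fun _ => ⟨?_, ?_, ?_, ?_, ?_⟩, fun h0 => by simp at h0⟩ <;> simp only <;> grind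
  | up i j h1 ht =>
    exact ⟨fun _ => hup i j (by rcases ht with ht | ht <;> simp [ht, Tile.north]),
      fun h0 => by simp at h0⟩
  | turnNorth i j h1 ht =>
    exact ⟨fun _ => hup i j (by simp [ht, Tile.north]), fun h0 => by simp at h0⟩
  | turnEast i j h1 ht =>
    exact ⟨fun h0 => by simp at h0, fun _ => hright i j (by simp [ht, Tile.east])⟩
  | right i j h1 ht =>
    exact ⟨fun h0 => by simp at h0,
      fun _ => hright i j (by rcases ht with ht | ht <;> simp [ht, Tile.east])⟩

/-- A pipe that leaves the grid in row `i` does not go up beyond this row. -/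
theorem IsMatched.le_of_exit {a b : ℤ} {D : Tiling} (h : IsMatched a b D) {p i i' j : ℤ}
    (he : Visits b D p false (i, b + 1)) (hv : Visits b D p true (i', j)) : i ≤ i' := by
  -- The successor relation on edges of pipes. It is functional and never increases the row index,
  -- so any two edges of one pipe are comparable. The edge at column `b + 1` has no successor, hence
  -- every vertical edge of the pipe comes before it.
  let R : Bool × ℤ × ℤ → Bool × ℤ × ℤ → Prop := fun e e' =>
    (e.1 = true ∧ (D e.2 = .vert ∨ D e.2 = .cross) ∧ e' = (true, e.2.1 - 1, e.2.2)) ∨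
    (e.1 = true ∧ D e.2 = .are ∧ e' = (false, e.2.1, e.2.2 + 1)) ∨
    (e.1 = false ∧ (D e.2 = .horiz ∨ D e.2 = .cross) ∧ e' = (false, e.2.1, e.2.2 + 1)) ∨
    (e.1 = false ∧ D e.2 = .jay ∧ e' = (true, e.2.1 - 1, e.2.2))
  have hR : ∀ d c, Visits b D p d c → Relation.ReflTransGen R (true, b, p) (d, c) := by
    intro d c hv
    induction hv with
    | start => exact .refl
    | up i j h ht ih => exact ih.tail (Or.inl ⟨rfl, ht, rfl⟩)
    | turnEast i j h ht ih => exact ih.tail (Or.inr (Or.inl ⟨rfl, ht, rfl⟩))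
    | right i j h ht ih => exact ih.tail (Or.inr (Or.inr (Or.inl ⟨rfl, ht, rfl⟩)))
    | turnNorth i j h ht ih => exact ih.tail (Or.inr (Or.inr (Or.inr ⟨rfl, ht, rfl⟩)))
  have hU : Relator.RightUnique R := by
    intro x y z h1 h2
    rcases h1 with ⟨h1, h1', rfl⟩ | ⟨h1, h1', rfl⟩ | ⟨h1, h1', rfl⟩ | ⟨h1, h1', rfl⟩ <;>
    rcases h2 with ⟨h2, h2', rfl⟩ | ⟨h2, h2', rfl⟩ | ⟨h2, h2', rfl⟩ | ⟨h2, h2', rfl⟩ <;>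
    simp_all
  have hmono : ∀ e e', Relation.ReflTransGen R e e' → e'.2.1 ≤ e.2.1 := by
    intro e e' hee
    induction hee with
    | refl => exact le_rfl
    | tail _ h2 ih =>
      rcases h2 with ⟨_, _, rfl⟩ | ⟨_, _, rfl⟩ | ⟨_, _, rfl⟩ | ⟨_, _, rfl⟩ <;> simp only <;> omega
  rcases Relation.ReflTransGen.total_of_right_unique hU (hR _ _ he) (hR _ _ hv) with h1 | h1
  · rcases h1.cases_head with h2 | ⟨e, h2, _⟩
    · simp at h2
    · have hb := h.blank_right i
      rcases h2 with ⟨h2, _⟩ | ⟨h2, _⟩ | ⟨_, h2, _⟩ | ⟨_, h2, _⟩ <;> simp [hb] at h2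
  · exact hmono _ _ h1

/-! ### Grassmannian permutations -/

namespace IsGrassmannian

variable {a b k : ℤ} {w : Equiv.Perm ℤ}

theorem mem (h : IsGrassmannian a b k w) {i : ℤ} (hi : a ≤ i) (hi' : i ≤ b) :
    a ≤ w i ∧ w i ≤ b := by
  by_contra hc
  have h1 := h.1 (w i) hc
  have h2 := w.injective h1
  rw [h2] at hc
  exact hc ⟨hi, hi'⟩

theorem symm_mem (h : IsGrassmannian a b k w) {j : ℤ} (hj : a ≤ j) (hj' : j ≤ b) :
    a ≤ w.symm j ∧ w.symm j ≤ b := by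
  by_contra hc
  have h1 := h.1 _ hc
  rw [Equiv.apply_symm_apply] at h1
  rw [← h1] at hc
  exact hc ⟨hj, hj'⟩

theorem lt_of_avoid (h : IsGrassmannian a b k w) {s t : ℤ} (hs : a ≤ s) (hst : s < t)
    (ht : t ≤ b) (hk : t ≤ k ∨ k < s) : w s < w t := by
  have key : ∀ n : ℕ, ∀ t, t - s = n + 1 → t ≤ b → (t ≤ k ∨ k < s) → w s < w t := by
    intro n
    induction n with
    | zero =>
      intro t hn ht hk
      obtain rfl : t = s + 1 := by push_cast at hn; omega
      exact h.2 s hs (by omega) (by omega)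
    | succ n ih =>
      intro t hn ht hk
      have h1 := ih (t - 1) (by push_cast at hn ⊢; omega) (by omega) (by omega)
      have h2 := h.2 (t - 1) (by push_cast at hn; omega) (by omega) (by push_cast at hn; omega)
      rw [sub_add_cancel] at h2
      exact h1.trans h2
  exact key (t - s - 1).toNat t (by omega) ht hk

/-- In the rows below `k`, the columns to the left of the turn of the pipe are in use. -/
theorem symm_lt (h : IsGrassmannian a b k w) {i j : ℤ} (ha : a ≤ k + 1) (hi : k < i)
    (hi' : i ≤ b) (hj : a ≤ j) (hj' : j < w i) : w.symm j < i := by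
  by_contra hc
  have hb := (h.mem (by omega : a ≤ i) hi').2
  have h1 := h.symm_mem hj (by omega)
  rcases eq_or_lt_of_le (not_lt.1 hc) with h2 | h2
  · rw [h2, Equiv.apply_symm_apply] at hj'; omega
  · have := h.lt_of_avoid (by omega) h2 h1.2 (Or.inr hi)
    rw [Equiv.apply_symm_apply] at this
    omega

end IsGrassmannian

/-! ### Rows without crosses -/

/-- `x t` is the column in which the pipe that leaves in row `t` enters row `i`. -/
structure PipesAt (a b : ℤ) (w : Equiv.Perm ℤ) (D : Tiling) (i : ℤ) (x : ℤ → ℤ) : Prop where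
  mono : ∀ s t, a ≤ s → s < t → t ≤ i → x s < x t
  mem : ∀ t, a ≤ t → t ≤ i → a ≤ x t ∧ x t ≤ b ∧ (D (i, x t)).south = true ∧
    Visits b D (w t) true (i, x t)
  all : ∀ j, a ≤ j → j ≤ b → (D (i, j)).south = true → ∃ t, a ≤ t ∧ t ≤ i ∧ x t = j

/-- Without crosses, a pipe that turns right must turn up again before the column of the next pipe,
or leave the grid. So the rightmost pipe leaves in row `i`, and the columns of the other pipes in
the next row interlace with the old ones; in particular the order is kept. -/
theorem PipesAt.step {a b : ℤ} {w : Equiv.Perm ℤ} {D : Tiling} {i : ℤ} {x : ℤ → ℤ}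
    (hx : PipesAt a b w D i x) (h : IsMatched a b D) (hi : a ≤ i) (hi' : i ≤ b)
    (hc : ∀ j, D (i, j) ≠ .cross) :
    Visits b D (w i) false (i, b + 1) ∧ (a < i → ∃ x', PipesAt a b w D (i - 1) x') := by
  have hhor : ∀ {j}, (D (i, j)).Thru → D (i, j) = .horiz := fun hj => hj.resolve_right (hc _)
  have hns : ∀ {j}, (D (i, j)).Thru → (D (i, j)).south ≠ true := by
    intro j hj; rw [hhor hj]; simp [Tile.south]
  obtain ⟨y0, hy1, hy2, hy3, hy4⟩ := h.run_left (i := i) (j := b) (h.border i hi hi').2.2.2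
  obtain ⟨t0, ht1, ht2, rfl⟩ := hx.all y0 hy1 hy2 (by rw [hy3]; rfl)
  -- The tiles from this `are` to the east border are all horizontal, so no pipe enters from the
  -- south to the right of it; it belongs to the pipe with the largest index.
  obtain rfl : t0 = i := by
    by_contra hne
    have h1 := hx.mono t0 i ht1 (by omega) le_rfl
    obtain ⟨_, h2, h3, _⟩ := hx.mem i hi le_rfl
    exact hns (hy4 _ h1 h2) h3
  refine ⟨visits_run (hx.mem t0 hi le_rfl).2.2.2 hy3 (by omega) fun z hz hz' =>
    hy4 z hz (by omega), fun hai => ?_⟩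
  -- `y` is the column in which pipe `t` leaves the row upwards, either straight or at the `jay`
  -- where its horizontal run ends. The bounds `x t ≤ y < x (t + 1)` give monotonicity.
  have hstep : ∀ t, ∃ y, a ≤ t → t < t0 → x t ≤ y ∧ y < x (t + 1) ∧ (D (t0, y)).north = true ∧
      Visits b D (w t) true (t0 - 1, y) ∧ ((D (t0, x t) = .vert ∧ y = x t) ∨
        (D (t0, x t) = .are ∧ x t < y ∧ D (t0, y) = .jay ∧
          ∀ z, x t < z → z < y → (D (t0, z)).Thru)) := by
    intro t
    by_cases ht : a ≤ t ∧ t < t0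
    swap
    · exact ⟨0, fun h1 h2 => absurd ⟨h1, h2⟩ ht⟩
    obtain ⟨h1, h2, h3, h4⟩ := hx.mem t ht.1 ht.2.le
    obtain ⟨g1, g2, g3, g4⟩ := hx.mem (t + 1) (by omega) (by omega)
    have hlt := hx.mono t (t + 1) ht.1 (by omega) (by omega)
    by_cases hv : D (t0, x t) = .vert
    · exact ⟨x t, fun _ _ => ⟨le_rfl, hlt, by rw [hv]; rfl, .up _ _ h4 (Or.inl hv),
        Or.inl ⟨hv, rfl⟩⟩⟩
    have hr : D (t0, x t) = .are := by
      have := hc (x t)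
      cases hD : D (t0, x t) <;> simp_all [Tile.south]
    rcases h.run_right (i := t0) (y := x t) (by rw [hr]; rfl) with ⟨z, z1, z2, z3, z4⟩ | hrun
    · have hz : z < x (t + 1) := by
        by_contra hz
        rcases eq_or_lt_of_le (not_lt.1 hz) with h5 | h5
        · rw [h5, z3] at g3; simp [Tile.south] at g3
        · exact hns (z4 _ hlt h5) g3
      exact ⟨z, fun _ _ => ⟨z1.le, hz, by rw [z3]; rfl,
        .turnNorth _ _ (visits_run h4 hr z1 z4) z3, Or.inr ⟨hr, z1, z3, z4⟩⟩⟩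
    · exact absurd g3 (hns (hrun _ hlt g2))
  choose y hy using hstep
  refine ⟨y, ⟨fun s t hs hst ht => ?_, fun t ht ht' => ?_, fun j hj hj' hs => ?_⟩⟩
  · obtain ⟨_, h2, _⟩ := hy s hs (by omega)
    obtain ⟨h1, _⟩ := hy t (by omega) (by omega)
    rcases eq_or_lt_of_le (by omega : s + 1 ≤ t) with h3 | h3
    · rw [h3] at h2; omega
    · have := hx.mono (s + 1) t (by omega) h3 (by omega); omega
  · obtain ⟨h1, h2, h3, h4, _⟩ := hy t ht (by omega)
    have h5 := (hx.mem t ht (by omega)).1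
    have h6 := (hx.mem (t + 1) (by omega) (by omega)).2.1
    refine ⟨by omega, by omega, ?_, h4⟩
    rw [h.vertical _ _ (by omega) (by omega) (by omega) (by omega), sub_add_cancel, h3]
  -- Conversely, an edge going up out of the row lies on a vertical tile or a `jay`. From a `jay`
  -- the pipe is followed left to its `are`; the first `jay` to the right of that `are` is unique,
  -- so it is the one chosen for this pipe.
  · rw [h.vertical _ _ (by omega) (by omega) hj hj', sub_add_cancel] at hs
    by_cases hv : D (t0, j) = .vert
    · obtain ⟨t, h1, h2, rfl⟩ := hx.all j hj hj' (by rw [hv]; rfl)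
      have hne : t ≠ t0 := by rintro rfl; simp [hv] at hy3
      obtain ⟨_, _, _, _, h5⟩ := hy t h1 (by omega)
      refine ⟨t, h1, by omega, ?_⟩
      rcases h5 with h5 | h5
      · exact h5.2
      · rw [hv] at h5; simp at h5
    · have hjay : D (t0, j) = .jay := by
        have := hc j
        cases hD : D (t0, j) <;> simp_all [Tile.north]
      have haj : a < j := by
        rcases eq_or_lt_of_le hj with rfl | h1
        · have := (h.border t0 hi hi').2.1; rw [hjay] at this; simp [Tile.west] at this
        · exact h1
      have he := h.horizontal t0 (j - 1) hi hi' (by omega) (by omega)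
      rw [sub_add_cancel, hjay] at he
      obtain ⟨z, z1, z2, z3, z4⟩ := h.run_left he
      obtain ⟨t, h1, h2, rfl⟩ := hx.all z z1 (by omega) (by rw [z3]; rfl)
      have hne : t ≠ t0 := by
        rintro rfl; exact (hy4 j (by omega) hj').ne_jay hjay
      obtain ⟨_, _, _, _, h5⟩ := hy t h1 (by omega)
      refine ⟨t, h1, by omega, ?_⟩
      rcases h5 with h5 | ⟨_, g1, g2, g3⟩
      · rw [z3] at h5; simp at h5
      · rcases lt_trichotomy (y t) j with h6 | h6 | h6
        · exact absurd g2 (z4 _ g1 (by omega)).ne_jay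
        · exact h6
        · exact absurd hjay (g3 _ (by omega) h6).ne_jay

/-! ### Bumpless pipe dreams of Grassmannian permutations -/

/-- A tiling without crosses in the rows up to `k`, where all pipes go straight up in the
rows below `k` until they turn right and leave the grid. -/
structure IsGrassTiling (a b k : ℤ) (D : Tiling) : Prop extends IsMatched a b D where
  top : ∀ i j, i ≤ k → D (i, j) ≠ .cross
  bottom : ∀ i j, k < i → i ≤ b → a ≤ j → j ≤ b → D (i, j) ≠ .blank ∧ D (i, j) ≠ .jay

/-- The pipes of the rows below `k`. -/
theorem IsBPD.below {a b k : ℤ} {w : Equiv.Perm ℤ} {D : Tiling} (h : IsBPD a b w D)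
    (hw : IsGrassmannian a b k w) (ha : a ≤ k) (hk : k ≤ b) :
    (∀ i, k ≤ i → i ≤ b → ∀ j, a ≤ j → j ≤ b →
      ((D (i, j)).south = true ↔ w.symm j ≤ i) ∧ (w.symm j ≤ i → Visits b D j true (i, j))) ∧
    ∀ i j, k < i → i ≤ b → a ≤ j → j ≤ b → D (i, j) ≠ .blank ∧ D (i, j) ≠ .jay := by
  have hm := h.isMatched
  -- The pipe that leaves in row `i` turns at an `are`, whose column is its label since the pipes
  -- come straight up from the border; hence the column is `w i`. To the left of it all columns
  -- carry a pipe from below by `symm_lt`, and a tile that is open to the south and closed to the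
  -- east is vertical.
  have row : ∀ i, k < i → i ≤ b → (∀ j, a ≤ j → j ≤ b →
      ((D (i, j)).south = true ↔ w.symm j ≤ i) ∧ (w.symm j ≤ i → Visits b D j true (i, j))) →
      (D (i, w i) = .are ∧ (∀ j, a ≤ j → j < w i → D (i, j) = .vert) ∧
        ∀ j, w i < j → j ≤ b → (D (i, j)).Thru) := by
    intro i hi hi' hrow
    obtain ⟨y, hy1, hy2, hy3, hy4⟩ := hm.run_left (i := i) (j := b)
      (hm.border i (by omega) hi').2.2.2
    have hyw : y = w i := by
      have h1 := ((hrow y hy1 hy2).1.1 (by rw [hy3]; rfl))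
      have h2 := visits_run ((hrow y hy1 hy2).2 h1) hy3 (z := b + 1) (by omega)
        fun z hz hz' => hy4 z hz (by omega)
      exact hm.label_unique h2 (h.perm i (by omega) hi')
    subst hyw
    refine ⟨hy3, ?_, hy4⟩
    have key : ∀ n : ℕ, ∀ j, w i - j = n + 1 → a ≤ j → D (i, j) = .vert := by
      intro n
      induction n with
      | zero =>
        intro j hn hj
        have he := hm.horizontal i j (by omega) hi' hj (by omega)
        rw [show j + 1 = w i by push_cast at hn; omega, hy3] at he
        have hs := (hrow j hj (by omega)).1.2 (hw.symm_lt (by omega) hi hi' hj (by omega)).le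
        cases hD : D (i, j) <;> simp [hD, Tile.south, Tile.east, Tile.west] at hs he ⊢
      | succ n ih =>
        intro j hn hj
        have he := hm.horizontal i j (by omega) hi' hj (by push_cast at hn; omega)
        rw [ih (j + 1) (by push_cast at hn ⊢; omega) (by omega)] at he
        have hs := (hrow j hj (by push_cast at hn; omega)).1.2
          (hw.symm_lt (by omega) hi hi' hj (by push_cast at hn; omega)).le
        cases hD : D (i, j) <;> simp [hD, Tile.south, Tile.east, Tile.west] at hs he ⊢
    exact fun j hj hj' => key (w i - j - 1).toNat j (by omega) hj
  -- Upward induction from the south border: exactly the pipe `w (i + 1)` is lost in row `i + 1`,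
  -- and all other pipes pass through it vertically.
  have rows : ∀ n : ℕ, ∀ i, b - i = n → k ≤ i → ∀ j, a ≤ j → j ≤ b →
      ((D (i, j)).south = true ↔ w.symm j ≤ i) ∧ (w.symm j ≤ i → Visits b D j true (i, j)) := by
    intro n
    induction n with
    | zero =>
      intro i hn hi j hj hj'
      obtain rfl : i = b := by push_cast at hn; omega
      have h1 := (hm.border j hj hj').2.2.1
      exact ⟨⟨fun _ => (hw.symm_mem hj hj').2, fun _ => h1⟩, fun _ => .start⟩
    | succ n ih =>
      intro i hn hi j hj hj'
      have hprev := ih (i + 1) (by push_cast at hn; omega) (by omega)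
      obtain ⟨r1, r2, r3⟩ := row (i + 1) (by omega) (by push_cast at hn; omega) hprev
      have hv := hm.vertical i j (by omega) (by push_cast at hn; omega) hj hj'
      obtain ⟨h1, h2⟩ := hprev j hj hj'
      rw [hv]
      rcases lt_trichotomy j (w (i + 1)) with hlt | heq | hgt
      · have := hw.symm_lt (by omega) (by omega : k < i + 1) (by push_cast at hn; omega) hj hlt
        have hD := r2 j hj hlt
        exact ⟨⟨fun _ => by omega, fun _ => by rw [hD]; rfl⟩, fun _ =>
          visits_true_iff.2 (Or.inr (Or.inl ⟨h2 (by omega), Or.inl hD⟩))⟩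
      · rw [heq, r1, Equiv.symm_apply_apply]
        exact ⟨⟨fun h0 => by simp [Tile.north] at h0, fun h0 => by omega⟩, fun h0 => by omega⟩
      · have hD := r3 j hgt hj'
        have hne : w.symm j ≠ i + 1 := by
          intro h0; rw [← h0, Equiv.apply_symm_apply] at hgt; omega
        have hiff : (D (i + 1, j)).north = true ↔ w.symm j ≤ i := by
          have h3 : (D (i + 1, j)).north = (D (i + 1, j)).south := by
            rcases hD with hD | hD <;> rw [hD] <;> rfl
          rw [h3, h1]; omega
        refine ⟨hiff, fun h0 => visits_true_iff.2 (Or.inr (Or.inl ⟨h2 (by omega), Or.inr ?_⟩))⟩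
        refine hD.resolve_left fun h4 => ?_
        have := hiff.2 h0
        rw [h4] at this; simp [Tile.north] at this
  have hrows : ∀ i, k ≤ i → i ≤ b → _ := fun i hi hi' => rows (b - i).toNat i (by omega) hi
  refine ⟨hrows, fun i j hi hi' hj hj' => ?_⟩
  obtain ⟨r1, r2, r3⟩ := row i hi hi' (hrows i hi.le hi')
  rcases lt_trichotomy j (w i) with hlt | heq | hgt
  · rw [r2 j hj hlt]; simp
  · rw [heq, r1]; simp
  · rcases r3 j hgt hj' with hD | hD <;> rw [hD] <;> simp

/-- Pipe `t'` has to leave below pipe `t`, but is to the left of it. If `t'` turns right, then it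
must turn up before the column of `t`, as it would cross `t` there. Pipe `t` only moves up and to
the right, and it cannot leave in row `i ≥ t' > t`. So the wrong order persists in the next row. -/
theorem IsBPD.wrong_order_step {a b k : ℤ} {w : Equiv.Perm ℤ} {D : Tiling} (h : IsBPD a b w D)
    (hw : IsGrassmannian a b k w) {t t' i : ℤ} (ht : a ≤ t) (htt : t < t') (hi : t' ≤ i)
    (hi' : i ≤ b) (hno : ∀ j, ¬ CrossAt b D (w t) (w t') (i, j)) {jq jp : ℤ}
    (hq : Visits b D (w t') true (i, jq)) (hp : Visits b D (w t) true (i, jp)) (hlt : jq < jp) :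
    ∃ jq' jp', Visits b D (w t') true (i - 1, jq') ∧ Visits b D (w t) true (i - 1, jp') ∧
      jq' < jp' := by
  have hm := h.isMatched
  obtain ⟨m1, m2⟩ := hw.mem ht (by omega : t ≤ b)
  obtain ⟨m3, m4⟩ := hw.mem (by omega : a ≤ t') (by omega)
  obtain ⟨q1, q2, q3, q4, q5⟩ := (hm.visits_edge m3 m4 hq).1 rfl
  obtain ⟨p1, p2, p3, p4, p5⟩ := (hm.visits_edge m1 m2 hp).1 rfl
  simp only at q1 q2 q3 q4 q5 p1 p2 p3 p4 p5
  have hqs := q5 (by omega)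
  have hps := p5 (by omega)
  have hQ : ∃ jq', jq' < jp ∧ Visits b D (w t') true (i - 1, jq') := by
    by_cases hu : D (i, jq) = .vert ∨ D (i, jq) = .cross
    · exact ⟨jq, hlt, .up _ _ hq hu⟩
    have hr : D (i, jq) = .are := by
      cases hD : D (i, jq) <;> simp_all [Tile.south]
    have hbad : (∀ x, jq < x → x < jp → (D (i, x)).Thru) → ¬ (D (i, jp)).Thru := by
      intro hx hthru
      refine hno jp ⟨?_, hp, visits_run hq hr hlt hx⟩
      refine hthru.resolve_left fun h0 => ?_
      rw [h0] at hps; simp [Tile.south] at hps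
    rcases hm.run_right (i := i) (y := jq) (by rw [hr]; rfl) with ⟨z, z1, z2, z3, z4⟩ | hrun
    · refine ⟨z, ?_, .turnNorth _ _ (visits_run hq hr z1 z4) z3⟩
      by_contra hz
      rcases eq_or_lt_of_le (not_lt.1 hz) with h5 | h5
      · rw [h5, z3] at hps; simp [Tile.south] at hps
      · exact hbad (fun x hx hx' => z4 x hx (by omega)) (z4 jp hlt h5)
    · exact absurd (hrun jp hlt p4) (hbad fun x hx hx' => hrun x hx (by omega))
  have hP : ∃ jp', jp ≤ jp' ∧ Visits b D (w t) true (i - 1, jp') := by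
    by_cases hu : D (i, jp) = .vert ∨ D (i, jp) = .cross
    · exact ⟨jp, le_rfl, .up _ _ hp hu⟩
    have hr : D (i, jp) = .are := by
      cases hD : D (i, jp) <;> simp_all [Tile.south]
    rcases hm.run_right (i := i) (y := jp) (by rw [hr]; rfl) with ⟨z, z1, z2, z3, z4⟩ | hrun
    · exact ⟨z, z1.le, .turnNorth _ _ (visits_run hp hr z1 z4) z3⟩
    · have hexit := visits_run hp hr (z := b + 1) (by omega) fun z hz hz' => hrun z hz (by omega)
      have := w.injective (hm.label_unique hexit (h.perm i (by omega) hi'))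
      omega
  obtain ⟨jq', h1, h2⟩ := hQ
  obtain ⟨jp', h3, h4⟩ := hP
  exact ⟨jq', jp', h2, h4, by omega⟩

/-- Two pipes which are in the wrong order have to cross again. -/
theorem IsBPD.wrong_order {a b k : ℤ} {w : Equiv.Perm ℤ} {D : Tiling} (h : IsBPD a b w D)
    (hw : IsGrassmannian a b k w) {t t' : ℤ} (ht : a ≤ t) (htt : t < t') :
    ∀ n : ℕ, ∀ i, i - t' = n → i ≤ b → (∀ c : ℤ × ℤ, c.1 ≤ i → ¬ CrossAt b D (w t) (w t') c) →
      ∀ jq jp, Visits b D (w t') true (i, jq) → Visits b D (w t) true (i, jp) → ¬ jq < jp := by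
  intro n
  induction n with
  | zero =>
    intro i hn hi hno jq jp hq hp hlt
    obtain ⟨jq', jp', h1, -, -⟩ := h.wrong_order_step hw ht htt (by omega) hi
      (fun j => hno _ le_rfl) hq hp hlt
    -- In row `t'` the wrong order would still force pipe `t'` to go up, beyond the row in which it
    -- leaves.
    have := h.isMatched.le_of_exit (h.perm t' (by omega) (by omega)) h1
    omega
  | succ n ih =>
    intro i hn hi hno jq jp hq hp hlt
    obtain ⟨jq', jp', h1, h2, h3⟩ := h.wrong_order_step hw ht htt (by omega) hi
      (fun j => hno _ le_rfl) hq hp hlt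
    exact ih (i - 1) (by push_cast at hn; omega) (by omega)
      (fun c hc => hno c (by omega)) jq' jp' h1 h2 h3

/-- The pipes of the rows up to `k` do not cross. -/
theorem IsBPD.no_cross {a b k : ℤ} {w : Equiv.Perm ℤ} {D : Tiling} (h : IsBPD a b w D)
    (hw : IsGrassmannian a b k w) {i : ℤ} (hi : a ≤ i) (hi' : i ≤ b) {x : ℤ → ℤ}
    (hx : PipesAt a b w D i x) (j : ℤ) : D (i, j) ≠ .cross := by
  intro hc
  have hm := h.isMatched
  obtain ⟨⟨_, _⟩, h3, h4⟩ := hm.inGrid_of_ne (p := (i, j)) (by rw [hc]; simp)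
  simp only at h3 h4
  obtain ⟨t', t1, t2, rfl⟩ := hx.all j h3 h4 (by rw [hc]; rfl)
  have haj : a < x t' := by
    rcases eq_or_lt_of_le h3 with h1 | h1
    · have := (hm.border i hi hi').2.1; rw [h1, hc] at this; simp [Tile.west] at this
    · exact h1
  have he := hm.horizontal i (x t' - 1) hi hi' (by omega) (by omega)
  rw [sub_add_cancel, hc] at he
  obtain ⟨z, z1, z2, z3, z4⟩ := hm.run_left he
  obtain ⟨t, s1, s2, rfl⟩ := hx.all z z1 (by omega) (by rw [z3]; rfl)
  -- The horizontal pipe of the cross turned right in a column further left, so it is the one that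
  -- has to leave higher up.
  have htt : t < t' := by
    rcases lt_trichotomy t t' with h1 | h1 | h1
    · exact h1
    · subst h1; omega
    · have := hx.mono t' t t1 h1 s2; omega
  have hq := (hx.mem t' t1 t2).2.2.2
  have hp := (hx.mem t s1 s2).2.2.2
  have hpj := visits_run hp z3 (z := x t') (by omega) fun y hy hy' => z4 y hy (by omega)
  have hcr : CrossAt b D (w t') (w t) (i, x t') := ⟨hc, hq, hpj⟩
  have hq' : Visits b D (w t') true (i - 1, x t') := .up _ _ hq (Or.inr hc)
  have hthru : ∀ y, x t < y → y < x t' + 1 → (D (i, y)).Thru := by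
    intro y hy hy'
    rcases eq_or_lt_of_le (by omega : y ≤ x t') with h1 | h1
    · rw [h1]; exact Or.inr hc
    · exact z4 y hy (by omega)
  -- After the crossing, pipe `t` goes up to the right of pipe `t'`: it cannot leave in row `i`,
  -- because `t < t' ≤ i`. Now the two pipes are in the wrong order, and a second crossing in a row
  -- above `i` would be needed.
  have hp' : ∃ jp, x t' < jp ∧ Visits b D (w t) true (i - 1, jp) := by
    rcases hm.run_right (i := i) (y := x t') (by rw [hc]; rfl) with ⟨y, y1, y2, y3, y4⟩ | hrun
    · refine ⟨y, y1, .turnNorth _ _ (visits_run hp z3 (by omega) fun u hu hu' => ?_) y3⟩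
      by_cases h1 : u ≤ x t'
      · exact hthru u hu (by omega)
      · exact y4 u (by omega) hu'
    · have hexit := visits_run hp z3 (z := b + 1) (by omega) fun u hu hu' => by
        by_cases h1 : u ≤ x t'
        · exact hthru u hu (by omega)
        · exact hrun u (by omega) (by omega)
      have := w.injective (hm.label_unique hexit (h.perm i hi hi'))
      omega
  obtain ⟨jp, hlt, hp'⟩ := hp'
  have hti : t' ≤ i - 1 := hm.le_of_exit (h.perm t' t1 (by omega)) hq'
  obtain ⟨m1, m2⟩ := hw.mem s1 (by omega : t ≤ b)
  obtain ⟨m3, m4⟩ := hw.mem t1 (by omega : t' ≤ b)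
  refine h.wrong_order hw s1 htt (i - 1 - t').toNat (i - 1) (by omega) (by omega)
    (fun c hc' hcr' => ?_) _ _ hq' hp' hlt
  have := h.reduced (w t) (w t') m1 m2 m3 m4 _ c (Or.inr hcr) (Or.inl hcr')
  rw [← this] at hc'
  simp only at hc'
  omega

/-- The bumpless pipe dreams of Grassmannian permutations are Grassmannian tilings. -/
theorem IsBPD.isGrassTiling {a b k : ℤ} {w : Equiv.Perm ℤ} {D : Tiling} (h : IsBPD a b w D)
    (hw : IsGrassmannian a b k w) (ha : a ≤ k) (hk : k ≤ b) : IsGrassTiling a b k D := by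
  have hm := h.isMatched
  obtain ⟨hrows, hbot⟩ := h.below hw ha hk
  -- In row `k` the columns are given by `w` itself, which is increasing up to `k`; from there the
  -- order is carried upwards, using that no crosses occur.
  have key : ∀ n : ℕ, ∀ i, k - i = n → a ≤ i → ∃ x, PipesAt a b w D i x := by
    intro n
    induction n with
    | zero =>
      intro i hn hi
      obtain rfl : i = k := by push_cast at hn; omega
      refine ⟨w, ⟨fun s t hs hst ht => hw.lt_of_avoid hs hst (by omega) (Or.inl ht),
        fun t ht ht' => ?_, fun j hj hj' hs => ?_⟩⟩
      · obtain ⟨m1, m2⟩ := hw.mem ht (by omega : t ≤ b)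
        obtain ⟨r1, r2⟩ := hrows i le_rfl hk (w t) m1 m2
        rw [Equiv.symm_apply_apply] at r1 r2
        exact ⟨m1, m2, r1.2 ht', r2 ht'⟩
      · exact ⟨w.symm j, (hw.symm_mem hj hj').1, (hrows i le_rfl hk j hj hj').1.1 hs, by simp⟩
    | succ n ih =>
      intro i hn hi
      obtain ⟨x, hx⟩ := ih (i + 1) (by push_cast at hn; omega) (by omega)
      have hb : i + 1 ≤ b := by push_cast at hn; omega
      have := (hx.step hm (by omega) hb (h.no_cross hw (by omega) hb hx)).2 (by omega)
      rwa [add_sub_cancel_right] at this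
  refine { hm with top := fun i j hi hc => ?_, bottom := hbot }
  obtain ⟨⟨h1, h2⟩, -, -⟩ := hm.inGrid_of_ne (p := (i, j)) (by rw [hc]; simp)
  simp only at h1 h2
  obtain ⟨x, hx⟩ := key (k - i).toNat i (by omega) h1
  exact h.no_cross hw h1 h2 hx j hc

/-- A Grassmannian tiling is a bumpless pipe dream of the permutation that can be read off
from row `k`. -/
theorem IsGrassTiling.isBPD {a b k : ℤ} {w : Equiv.Perm ℤ} {D : Tiling}
    (h : IsGrassTiling a b k D) (hw : IsGrassmannian a b k w) (ha : a ≤ k) (hk : k ≤ b)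
    (hV : ∀ j, a ≤ j → j ≤ b → ((D (k, j)).south = true ↔ w.symm j ≤ k)) : IsBPD a b w D := by
  have hm := h.toIsMatched
  have row : ∀ i, k < i → i ≤ b →
      (∀ j, a ≤ j → j ≤ b → ((D (i, j)).north = true ↔ w.symm j ≤ i - 1)) →
      (D (i, w i) = .are ∧ (∀ j, a ≤ j → j < w i → D (i, j) = .vert) ∧
        ∀ j, w i < j → j ≤ b → (D (i, j)).Thru) := by
    intro i hi hi' hn
    obtain ⟨y, hy1, hy2, hy3, hy4⟩ := hm.run_left (i := i) (j := b)
      (hm.border i (by omega) hi').2.2.2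
    have hleft : ∀ n : ℕ, ∀ j, y - j = n + 1 → a ≤ j → D (i, j) = .vert := by
      intro n
      induction n with
      | zero =>
        intro j hn hj
        have he := hm.horizontal i j (by omega) hi' hj (by omega)
        rw [show j + 1 = y by push_cast at hn; omega, hy3] at he
        obtain ⟨b1, b2⟩ := h.bottom i j hi hi' hj (by omega)
        cases hD : D (i, j) <;> simp_all [Tile.east, Tile.west]
      | succ n ih =>
        intro j hn hj
        have he := hm.horizontal i j (by omega) hi' hj (by push_cast at hn; omega)
        rw [ih (j + 1) (by push_cast at hn ⊢; omega) (by omega)] at he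
        obtain ⟨b1, b2⟩ := h.bottom i j hi hi' hj (by push_cast at hn; omega)
        cases hD : D (i, j) <;> simp_all [Tile.east, Tile.west]
    have hleft' : ∀ j, a ≤ j → j < y → D (i, j) = .vert :=
      fun j hj hj' => hleft (y - j - 1).toNat j (by omega) hj
    obtain ⟨m1, m2⟩ := hw.mem (by omega : a ≤ i) hi'
    have hyw : y = w i := by
      rcases lt_trichotomy y (w i) with h1 | h1 | h1
      · have := (hn y hy1 hy2).2 (by have := hw.symm_lt (by omega) hi hi' hy1 h1; omega)
        rw [hy3] at this; simp [Tile.north] at this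
      · exact h1
      · have h2 := hleft' (w i) m1 h1
        have := (hn (w i) m1 m2).1 (by rw [h2]; rfl)
        rw [Equiv.symm_apply_apply] at this; omega
    subst hyw
    exact ⟨hy3, hleft', hy4⟩
  have hsouth : ∀ n : ℕ, ∀ i, i - k = n → i ≤ b →
      ∀ j, a ≤ j → j ≤ b → ((D (i, j)).south = true ↔ w.symm j ≤ i) := by
    intro n
    induction n with
    | zero =>
      intro i hn hi
      obtain rfl : i = k := by push_cast at hn; omega
      exact hV
    | succ n ih =>
      intro i hn hi
      have hn' : ∀ j, a ≤ j → j ≤ b → ((D (i, j)).north = true ↔ w.symm j ≤ i - 1) := by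
        intro j hj hj'
        rw [← ih (i - 1) (by push_cast at hn; omega) (by omega) j hj hj',
          hm.vertical _ _ (by push_cast at hn; omega) (by omega) hj hj', sub_add_cancel]
      obtain ⟨r1, r2, r3⟩ := row i (by push_cast at hn; omega) hi hn'
      intro j hj hj'
      rcases lt_trichotomy j (w i) with hlt | heq | hgt
      · have := hw.symm_lt (by omega) (by push_cast at hn; omega : k < i) hi hj hlt
        exact ⟨fun _ => this.le, fun _ => by rw [r2 j hj hlt]; rfl⟩
      · rw [heq, r1]; simp [Tile.south]
      · have hne : w.symm j ≠ i := by
          intro h0; rw [← h0, Equiv.apply_symm_apply] at hgt; omega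
        have h3 : (D (i, j)).south = (D (i, j)).north := by
          rcases r3 j hgt hj' with hD | hD <;> rw [hD] <;> rfl
        rw [h3, hn' j hj hj']; omega
  have hrow : ∀ i, k < i → i ≤ b →
      (D (i, w i) = .are ∧ (∀ j, a ≤ j → j < w i → D (i, j) = .vert) ∧
        ∀ j, w i < j → j ≤ b → (D (i, j)).Thru) := by
    intro i hi hi'
    refine row i hi hi' fun j hj hj' => ?_
    rw [← hsouth (i - 1 - k).toNat (i - 1) (by omega) (by omega) j hj hj',
      hm.vertical _ _ (by omega) (by omega) hj hj', sub_add_cancel]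
  have hvis : ∀ n : ℕ, ∀ i, b - i = n → k ≤ i → ∀ j, a ≤ j → j ≤ b → w.symm j ≤ i →
      Visits b D j true (i, j) := by
    intro n
    induction n with
    | zero =>
      intro i hn hi j hj hj' _
      obtain rfl : i = b := by push_cast at hn; omega
      exact .start
    | succ n ih =>
      intro i hn hi j hj hj' hs
      refine visits_true_iff.2 (Or.inr (Or.inl ⟨ih (i + 1) (by push_cast at hn; omega) (by omega)
        j hj hj' (by omega), ?_⟩))
      have hnor := (hsouth (i - k).toNat i (by omega) (by push_cast at hn; omega) j hj hj').2 hs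
      rw [hm.vertical _ _ (by omega) (by push_cast at hn; omega) hj hj'] at hnor
      have := (h.bottom (i + 1) j (by omega) (by push_cast at hn; omega) hj hj').2
      cases hD : D (i + 1, j) <;> simp_all [Tile.north]
  have hvis' : ∀ i, k ≤ i → i ≤ b → ∀ j, a ≤ j → j ≤ b → w.symm j ≤ i →
      Visits b D j true (i, j) := fun i hi hi' => hvis (b - i).toNat i (by omega) hi
  have hpipes : ∀ n : ℕ, ∀ i, k - i = n → a ≤ i → ∃ x, PipesAt a b w D i x := by
    intro n
    induction n with
    | zero =>
      intro i hn hi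
      obtain rfl : i = k := by push_cast at hn; omega
      refine ⟨w, ⟨fun s t hs hst ht => hw.lt_of_avoid hs hst (by omega) (Or.inl ht),
        fun t ht ht' => ?_, fun j hj hj' hs => ?_⟩⟩
      · obtain ⟨m1, m2⟩ := hw.mem ht (by omega : t ≤ b)
        have hwt : w.symm (w t) ≤ i := by simpa using ht'
        exact ⟨m1, m2, (hV _ m1 m2).2 hwt, hvis' i le_rfl hk _ m1 m2 hwt⟩
      · exact ⟨w.symm j, (hw.symm_mem hj hj').1, (hV j hj hj').1 hs, by simp⟩
    | succ n ih =>
      intro i hn hi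
      obtain ⟨x, hx⟩ := ih (i + 1) (by push_cast at hn; omega) (by omega)
      have := (hx.step hm (by omega) (by push_cast at hn; omega)
        fun j => h.top _ _ (by push_cast at hn; omega)).2 (by omega)
      rwa [add_sub_cancel_right] at this
  have hexit : ∀ i, k < i → i ≤ b → ∀ j, w i < j → j ≤ b + 1 → Visits b D (w i) false (i, j) := by
    intro i hi hi' j hj hj'
    obtain ⟨m1, m2⟩ := hw.mem (by omega : a ≤ i) hi'
    exact visits_run (hvis' i hi.le hi' _ m1 m2 (by simp)) (hrow i hi hi').1 hj
      fun z hz hz' => (hrow i hi hi').2.2 z hz (by omega)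
  refine { hm with perm := fun i hi hi' => ?_, reduced := ?_ }
  · by_cases hik : i ≤ k
    · obtain ⟨x, hx⟩ := hpipes (k - i).toNat i (by omega) hi
      exact (hx.step hm hi hi' fun j => h.top _ _ hik).1
    · exact hexit i (by omega) hi' _ (by have := (hw.mem hi hi').2; omega) le_rfl
  -- A cross lies in a row `i > k`, where the vertical pipe is labeled by its column and the
  -- horizontal one is `w i`. The two labels therefore determine the position of the cross.
  · have hcross : ∀ p q c, CrossAt b D p q c → k < c.1 ∧ c.1 ≤ b ∧ w c.1 < c.2 ∧ p = c.2 ∧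
        q = w c.1 := by
      rintro p q ⟨i, j⟩ ⟨hc, hp, hq⟩
      obtain ⟨⟨h1, h2⟩, h3, h4⟩ := hm.inGrid_of_ne (p := (i, j)) (by rw [hc]; simp)
      simp only at h1 h2 h3 h4
      have hki : k < i := not_le.1 fun h0 => h.top i j h0 hc
      obtain ⟨r1, r2, r3⟩ := hrow i hki h2
      have hlt : w i < j := by
        rcases lt_trichotomy j (w i) with h5 | h5 | h5
        · rw [r2 j h3 h5] at hc; simp at hc
        · rw [h5, r1] at hc; simp at hc
        · exact h5
      refine ⟨hki, h2, hlt, hm.label_unique hp (hvis' i hki.le h2 j h3 h4 ?_),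
        hm.label_unique hq (hexit i hki h2 j hlt (by omega))⟩
      exact (hsouth (i - k).toNat i (by omega) h2 j h3 h4).1 (by rw [hc]; rfl)
    -- The vertical pipe leaves above the horizontal one, so the permutation decides which of the
    -- two labels is the vertical one; the mixed cases below are thus contradictory.
    have hcross' : ∀ p q c, CrossAt b D p q c ∨ CrossAt b D q p c →
        (p = c.2 ∧ q = w c.1 ∧ w.symm p < w.symm q) ∨
          (q = c.2 ∧ p = w c.1 ∧ w.symm q < w.symm p) := by
      have hsy : ∀ p q c, CrossAt b D p q c → p = c.2 ∧ q = w c.1 ∧ w.symm p < w.symm q := by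
        rintro p q ⟨i, j⟩ hc
        obtain ⟨h1, h2, h3, h4, h5⟩ := hcross p q _ hc
        simp only at h1 h2 h3 h4 h5
        refine ⟨h4, h5, ?_⟩
        subst h4 h5
        obtain ⟨⟨_, _⟩, h6, h7⟩ := hm.inGrid_of_ne (p := (i, p)) (by rw [hc.1]; simp)
        have h8 := (hsouth (i - k).toNat i (by omega) h2 p h6 h7).1 (by rw [hc.1]; rfl)
        have hne : w.symm p ≠ i := by
          intro h0; rw [← h0, Equiv.apply_symm_apply] at h3; omega
        simp only [Equiv.symm_apply_apply]
        omega
      rintro p q c (hc | hc)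
      · exact Or.inl (hsy _ _ _ hc)
      · exact Or.inr (hsy _ _ _ hc)
    rintro p q - - - - ⟨i, j⟩ ⟨i', j'⟩ hc hc'
    rcases hcross' _ _ _ hc with ⟨h1, h2, h3⟩ | ⟨h1, h2, h3⟩ <;>
    rcases hcross' _ _ _ hc' with ⟨g1, g2, g3⟩ | ⟨g1, g2, g3⟩
    · simp only at h1 h2 g1 g2
      rw [Prod.mk.injEq]
      exact ⟨w.injective (h2.symm.trans g2), h1.symm.trans g1⟩
    · omega
    · omega
    · simp only at h1 h2 g1 g2
      rw [Prod.mk.injEq]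
      exact ⟨w.injective (h2.symm.trans g2), h1.symm.trans g1⟩

/-! ### Local changes of tilings -/

/-- Matching means that the two tiles at an interior edge agree on whether a pipe uses it. Toggling
both sides of interior edges preserves this, whatever the tiles are. `V p` and `E p` refer to the
south and the east edge of `p`. -/
theorem IsMatched.toggle {a b : ℤ} {D D' : Tiling} (h : IsMatched a b D) (V E : ℤ × ℤ → Bool)
    (hV : ∀ p, V p = true → a ≤ p.1 ∧ p.1 < b ∧ a ≤ p.2 ∧ p.2 ≤ b)
    (hE : ∀ p, E p = true → a ≤ p.1 ∧ p.1 ≤ b ∧ a ≤ p.2 ∧ p.2 < b)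
    (hs : ∀ i j, (D' (i, j)).south = ((D (i, j)).south ^^ V (i, j)))
    (hn : ∀ i j, (D' (i, j)).north = ((D (i, j)).north ^^ V (i - 1, j)))
    (he : ∀ i j, (D' (i, j)).east = ((D (i, j)).east ^^ E (i, j)))
    (hw : ∀ i j, (D' (i, j)).west = ((D (i, j)).west ^^ E (i, j - 1))) : IsMatched a b D' := by
  have hV' : ∀ i j, ¬ (a ≤ i ∧ i < b ∧ a ≤ j ∧ j ≤ b) → V (i, j) = false := fun i j hc =>
    Bool.eq_false_iff.2 fun h0 => hc (hV _ h0)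
  have hE' : ∀ i j, ¬ (a ≤ i ∧ i ≤ b ∧ a ≤ j ∧ j < b) → E (i, j) = false := fun i j hc =>
    Bool.eq_false_iff.2 fun h0 => hc (hE _ h0)
  refine ⟨?_, fun i j h1 h2 h3 h4 => ?_, fun i j h1 h2 h3 h4 => ?_, fun t h1 h2 => ?_⟩
  · rintro ⟨i, j⟩ hp
    have hD := h.outside _ hp
    simp only [InGrid] at hp
    apply Tile.ext_edges
    · rw [hn, hD, hV' _ _ (by omega)]; rfl
    · rw [hs, hD, hV' _ _ (by omega)]; rfl
    · rw [he, hD, hE' _ _ (by omega)]; rfl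
    · rw [hw, hD, hE' _ _ (by omega)]; rfl
  · rw [hs, hn, add_sub_cancel_right, h.vertical i j h1 h2 h3 h4]
  · rw [he, hw, add_sub_cancel_right, h.horizontal i j h1 h2 h3 h4]
  · obtain ⟨b1, b2, b3, b4⟩ := h.border t h1 h2
    rw [hs, hn, he, hw, hV' _ _ (by omega), hV' _ _ (by omega), hE' _ _ (by omega),
      hE' _ _ (by omega), b1, b2, b3, b4]
    simp

/-- `D'` arises from `D` by drooping a pipe from `(i, j)` into `(i + 1, j + 1)`. -/
structure IsFlip (i j : ℤ) (D D' : Tiling) : Prop where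
  are : D (i, j) = .are
  blank : D (i + 1, j + 1) = .blank
  nw : D' (i, j) = .blank
  se : D' (i + 1, j + 1) = .jay
  ne : (D (i, j + 1) = .horiz ∧ D' (i, j + 1) = .are) ∨
    (D (i, j + 1) = .jay ∧ D' (i, j + 1) = .vert)
  sw : (D (i + 1, j) = .vert ∧ D' (i + 1, j) = .are) ∨
    (D (i + 1, j) = .jay ∧ D' (i + 1, j) = .horiz)
  rest : ∀ p, p ≠ (i, j) → p ≠ (i + 1, j + 1) → p ≠ (i, j + 1) → p ≠ (i + 1, j) → D' p = D p

theorem droop_iff {a b : ℤ} {D D' : Tiling} {L L' : ℤ × ℤ → ℤ × ℤ} :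
    Droop a b (D, L) (D', L') ↔ ∃ i j, InGrid a b (i, j) ∧ InGrid a b (i + 1, j + 1) ∧
      IsFlip i j D D' ∧ L' = Function.update L (i, j) (L (i + 1, j + 1)) := by
  constructor
  · rintro ⟨_, _, _, i, j, hg, hg', hr, hb, nw, se, ne, sw, rest⟩
    exact ⟨i, j, hg, hg', ⟨hr, hb, nw, se, ne, sw, rest⟩, rfl⟩
  · rintro ⟨i, j, hg, hg', ⟨hr, hb, nw, se, ne, sw, rest⟩, rfl⟩
    exact ⟨_, _, _, i, j, hg, hg', hr, hb, nw, se, ne, sw, rest⟩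

namespace IsFlip

variable {i j : ℤ} {D D' : Tiling}

/-- The vertical edges which are changed by a droop move. -/
def vEdge (i j : ℤ) (p : ℤ × ℤ) : Bool := decide (p.1 = i ∧ (p.2 = j ∨ p.2 = j + 1))

/-- The horizontal edges which are changed by a droop move. -/
def hEdge (i j : ℤ) (p : ℤ × ℤ) : Bool := decide (p.2 = j ∧ (p.1 = i ∨ p.1 = i + 1))

/-- A droop toggles exactly the four inner edges of its 2 × 2 square. This covers all shapes of the
two off-diagonal tiles and reduces matching to `IsMatched.toggle`. -/
theorem edges (h : IsFlip i j D D') (x y : ℤ) :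
    (D' (x, y)).south = ((D (x, y)).south ^^ vEdge i j (x, y)) ∧
    (D' (x, y)).north = ((D (x, y)).north ^^ vEdge i j (x - 1, y)) ∧
    (D' (x, y)).east = ((D (x, y)).east ^^ hEdge i j (x, y)) ∧
    (D' (x, y)).west = ((D (x, y)).west ^^ hEdge i j (x, y - 1)) := by
  obtain ⟨h1, h2, h3, h4, h5, h6, h7⟩ := h
  have e1 : ¬ (i - 1 = i) := by omega
  have e2 : ¬ (j - 1 = j) := by omega
  have e3 : ¬ (i - 1 = i + 1) := by omega
  have e4 : ¬ (j - 1 = j + 1) := by omega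
  by_cases c1 : (x, y) = (i, j)
  · rw [c1, h1, h3]; simp only [Prod.mk.injEq] at c1; obtain ⟨rfl, rfl⟩ := c1
    simp [vEdge, hEdge, Tile.north, Tile.south, Tile.east, Tile.west]
  by_cases c2 : (x, y) = (i + 1, j + 1)
  · rw [c2, h2, h4]; simp only [Prod.mk.injEq] at c2; obtain ⟨rfl, rfl⟩ := c2
    simp [vEdge, hEdge, Tile.north, Tile.south, Tile.east, Tile.west]
  by_cases c3 : (x, y) = (i, j + 1)
  · simp only [Prod.mk.injEq] at c3; obtain ⟨rfl, rfl⟩ := c3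
    rcases h5 with ⟨h5, h5'⟩ | ⟨h5, h5'⟩ <;> rw [h5, h5'] <;>
    simp [vEdge, hEdge, Tile.north, Tile.south, Tile.east, Tile.west]
  by_cases c4 : (x, y) = (i + 1, j)
  · simp only [Prod.mk.injEq] at c4; obtain ⟨rfl, rfl⟩ := c4
    rcases h6 with ⟨h6, h6'⟩ | ⟨h6, h6'⟩ <;> rw [h6, h6'] <;>
    simp [vEdge, hEdge, Tile.north, Tile.south, Tile.east, Tile.west]
  rw [h7 _ c1 c2 c3 c4]
  simp only [Prod.mk.injEq] at c1 c2 c3 c4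
  have v1 : vEdge i j (x, y) = false := by simp [vEdge]; omega
  have v2 : vEdge i j (x - 1, y) = false := by simp [vEdge]; omega
  have v3 : hEdge i j (x, y) = false := by simp [hEdge]; omega
  have v4 : hEdge i j (x, y - 1) = false := by simp [hEdge]; omega
  simp [v1, v2, v3, v4]

theorem isMatched_iff {a b : ℤ} (h : IsFlip i j D D') (hg : InGrid a b (i, j))
    (hg' : InGrid a b (i + 1, j + 1)) : IsMatched a b D ↔ IsMatched a b D' := by
  simp only [InGrid] at hg hg'
  have hx : ∀ x y z : Bool, x = (y ^^ z) → y = (x ^^ z) := by decide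
  have hV : ∀ p, vEdge i j p = true → a ≤ p.1 ∧ p.1 < b ∧ a ≤ p.2 ∧ p.2 ≤ b := by
    intro p hp; simp only [vEdge, decide_eq_true_eq] at hp; omega
  have hE : ∀ p, hEdge i j p = true → a ≤ p.1 ∧ p.1 ≤ b ∧ a ≤ p.2 ∧ p.2 < b := by
    intro p hp; simp only [hEdge, decide_eq_true_eq] at hp; omega
  constructor
  · exact fun hm => hm.toggle _ _ hV hE (fun x y => (h.edges x y).1) (fun x y => (h.edges x y).2.1)
      (fun x y => (h.edges x y).2.2.1) fun x y => (h.edges x y).2.2.2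
  · exact fun hm => hm.toggle _ _ hV hE (fun x y => hx _ _ _ (h.edges x y).1)
      (fun x y => hx _ _ _ (h.edges x y).2.1) (fun x y => hx _ _ _ (h.edges x y).2.2.1)
      fun x y => hx _ _ _ (h.edges x y).2.2.2

/-- The tiles away from the corners of a droop move. -/
theorem cases_tile (h : IsFlip i j D D') (p : ℤ × ℤ) : p = (i, j) ∨ p = (i + 1, j + 1) ∨
    ((p = (i, j + 1) ∨ p = (i + 1, j)) ∧
      (D p = .vert ∨ D p = .horiz ∨ D p = .jay) ∧
      (D' p = .are ∨ D' p = .horiz ∨ D' p = .vert)) ∨ D' p = D p := by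
  by_cases c1 : p = (i, j)
  · exact Or.inl c1
  by_cases c2 : p = (i + 1, j + 1)
  · exact Or.inr (Or.inl c2)
  by_cases c3 : p = (i, j + 1)
  · subst c3; have := h.ne; tauto
  by_cases c4 : p = (i + 1, j)
  · subst c4; have := h.sw; tauto
  exact Or.inr (Or.inr (Or.inr (h.rest p c1 c2 c3 c4)))

theorem blank_iff (h : IsFlip i j D D') (p : ℤ × ℤ) :
    D' p = .blank ↔ p = (i, j) ∨ (p ≠ (i + 1, j + 1) ∧ D p = .blank) := by
  have h1 := h.are
  have h2 := h.blank
  have h3 := h.nw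
  have h4 := h.se
  rcases h.cases_tile p with rfl | rfl | ⟨hp, h5, h6⟩ | h5
  · simp [h3]
  · simp [h4]
  · have : D p ≠ .blank := by rcases h5 with h5 | h5 | h5 <;> simp [h5]
    have h7 : D' p ≠ .blank := by rcases h6 with h6 | h6 | h6 <;> simp [h6]
    have h8 : p ≠ (i, j) := by rcases hp with rfl | rfl <;> simp
    tauto
  · rw [h5]
    have : D p = .blank → p ≠ (i + 1, j + 1) := by
      rintro h6 rfl; rw [h6, h4] at h5; simp at h5
    have h7 : p = (i, j) → D p = .blank := by rintro rfl; rw [← h5, h3]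
    tauto

/-- The SE corner of the square is blank before and a `jay` after the droop. Neither occurs below
row `k`, so the square lies in the rows up to `k`; there no crosses are created. -/
theorem isGrassTiling_iff {a b k : ℤ} (h : IsFlip i j D D') (hg : InGrid a b (i, j))
    (hg' : InGrid a b (i + 1, j + 1)) : IsGrassTiling a b k D ↔ IsGrassTiling a b k D' := by
  simp only [InGrid] at hg hg'
  constructor
  · intro hD
    have hik : i + 1 ≤ k := not_lt.1 fun h0 =>
      (hD.bottom (i + 1) (j + 1) h0 hg'.1.2 hg'.2.1 hg'.2.2).1 h.blank
    refine { (h.isMatched_iff hg hg').1 hD.toIsMatched with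
      top := fun x y hx => ?_, bottom := fun x y hx hx' hy hy' => ?_ }
    · rcases h.cases_tile (x, y) with h1 | h1 | ⟨-, -, h1 | h1 | h1⟩ | h1
      · rw [h1, h.nw]; simp
      · rw [h1, h.se]; simp
      · rw [h1]; simp
      · rw [h1]; simp
      · rw [h1]; simp
      · rw [h1]; exact hD.top x y hx
    · rw [h.rest]
      · exact hD.bottom x y hx hx' hy hy'
      all_goals simp only [ne_eq, Prod.mk.injEq]; omega
  · intro hD
    have hik : i + 1 ≤ k := not_lt.1 fun h0 =>
      (hD.bottom (i + 1) (j + 1) h0 hg'.1.2 hg'.2.1 hg'.2.2).2 h.se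
    refine { (h.isMatched_iff hg hg').2 hD.toIsMatched with
      top := fun x y hx => ?_, bottom := fun x y hx hx' hy hy' => ?_ }
    · rcases h.cases_tile (x, y) with h1 | h1 | ⟨-, h1 | h1 | h1, -⟩ | h1
      · rw [h1, h.are]; simp
      · rw [h1, h.blank]; simp
      · rw [h1]; simp
      · rw [h1]; simp
      · rw [h1]; simp
      · rw [← h1]; exact hD.top x y hx
    · rw [← h.rest]
      · exact hD.bottom x y hx hx' hy hy'
      all_goals simp only [ne_eq, Prod.mk.injEq]; omega

end IsFlip

/-- An `are`-tile can droop into a blank tile. -/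
theorem IsGrassTiling.exists_flip {a b k : ℤ} {D : Tiling} (h : IsGrassTiling a b k D) {i j : ℤ}
    (hi : a ≤ i) (hj : a ≤ j) (hi' : i < b) (hj' : j < b) (hr : D (i, j) = .are)
    (hb : D (i + 1, j + 1) = .blank) : ∃ D', IsFlip i j D D' := by
  -- Each off-diagonal tile has one side that is not fixed by its neighbors in the square; this side
  -- selects between the two alternatives of `ne` and `sw`.
  let D' : Tiling := fun p => if p = (i, j) then .blank else if p = (i + 1, j + 1) then .jay
    else if p = (i, j + 1) then (if (D p).north = true then .vert else .are)
    else if p = (i + 1, j) then (if (D p).west = true then .horiz else .are) else D p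
  have h1 := h.horizontal i j hi hi'.le hj hj'
  have h2 := h.vertical i (j + 1) hi hi' (by omega) (by omega)
  have h3 := h.vertical i j hi hi' hj hj'.le
  have h4 := h.horizontal (i + 1) j (by omega) (by omega) hj hj'
  rw [hr] at h1 h3
  rw [hb] at h2 h4
  refine ⟨D', hr, hb, by simp [D'], by simp [D'], ?_, ?_, ?_⟩
  · simp only [D']
    cases hD : D (i, j + 1) <;> simp_all [Tile.north, Tile.south, Tile.east, Tile.west]
  · simp only [D']
    cases hD : D (i + 1, j) <;> simp_all [Tile.north, Tile.south, Tile.east, Tile.west]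
  · intro p c1 c2 c3 c4
    simp [D', c1, c2, c3, c4]

/-- A `jay`-tile can undroop into a blank tile. -/
theorem IsGrassTiling.exists_unflip {a b k : ℤ} {D' : Tiling} (h : IsGrassTiling a b k D')
    {i j : ℤ} (hi : a ≤ i) (hj : a ≤ j) (hi' : i < b) (hj' : j < b) (hb : D' (i, j) = .blank)
    (hr : D' (i + 1, j + 1) = .jay) : ∃ D, IsFlip i j D D' := by
  let D : Tiling := fun p => if p = (i, j) then .are else if p = (i + 1, j + 1) then .blank
    else if p = (i, j + 1) then (if (D' p).north = true then .jay else .horiz)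
    else if p = (i + 1, j) then (if (D' p).west = true then .jay else .vert) else D' p
  have h1 := h.horizontal i j hi hi'.le hj hj'
  have h2 := h.vertical i (j + 1) hi hi' (by omega) (by omega)
  have h3 := h.vertical i j hi hi' hj hj'.le
  have h4 := h.horizontal (i + 1) j (by omega) (by omega) hj hj'
  rw [hb] at h1 h3
  rw [hr] at h2 h4
  refine ⟨D, by simp [D], by simp [D], hb, hr, ?_, ?_, ?_⟩
  · simp only [D]
    cases hD : D' (i, j + 1) <;> simp_all [Tile.north, Tile.south, Tile.east, Tile.west]
  · simp only [D]
    cases hD : D' (i + 1, j) <;> simp_all [Tile.north, Tile.south, Tile.east, Tile.west]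
  · intro p c1 c2 c3 c4
    simp [D, c1, c2, c3, c4]

/-- A Grassmannian tiling is determined by its blank tiles. -/
theorem IsGrassTiling.eq_of_blank {a b k : ℤ} {D D' : Tiling} (h : IsGrassTiling a b k D)
    (h' : IsGrassTiling a b k D')
    (hb : ∀ p, InGrid a b p → (D p = .blank ↔ D' p = .blank)) : D = D' := by
  -- The north and west sides determine the tile: with both open it is a `jay` up to row `k` and a
  -- cross below, with one open it goes straight, and with none open it is an `are` or blank. The
  -- tiling can thus be recovered row by row from the NW corner.
  have tile : ∀ i j, InGrid a b (i, j) → (D (i, j)).north = (D' (i, j)).north →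
      (D (i, j)).west = (D' (i, j)).west → D (i, j) = D' (i, j) := by
    intro i j hg hn hw
    have h1 := hb _ hg
    by_cases hik : i ≤ k
    · have h2 := h.top i j hik
      have h3 := h'.top i j hik
      cases hD : D (i, j) <;> cases hD' : D' (i, j) <;> simp_all [Tile.north, Tile.west]
    · have h2 := h.bottom i j (by omega) hg.1.2 hg.2.1 hg.2.2
      have h3 := h'.bottom i j (by omega) hg.1.2 hg.2.1 hg.2.2
      cases hD : D (i, j) <;> cases hD' : D' (i, j) <;> simp_all [Tile.north, Tile.west]
  have rows : ∀ n : ℕ, ∀ i, i - a = n → i ≤ b → ∀ j, a ≤ j → j ≤ b → D (i, j) = D' (i, j) := by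
    intro n
    induction n with
    | zero =>
      intro i hn hi
      obtain rfl : i = a := by push_cast at hn; omega
      have cols : ∀ m : ℕ, ∀ j, j - i = m → j ≤ b → D (i, j) = D' (i, j) := by
        intro m
        induction m with
        | zero =>
          intro j hm hj
          obtain rfl : j = i := by push_cast at hm; omega
          refine tile _ _ ⟨⟨le_rfl, hi⟩, le_rfl, hi⟩ ?_ ?_
          · rw [(h.border j le_rfl hi).1, (h'.border j le_rfl hi).1]
          · rw [(h.border j le_rfl hi).2.1, (h'.border j le_rfl hi).2.1]
        | succ m ihm =>
          intro j hm hj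
          push_cast at hm
          refine tile _ _ ⟨⟨le_rfl, hi⟩, by simp only; omega, hj⟩ ?_ ?_
          · rw [(h.border j (by omega) hj).1, (h'.border j (by omega) hj).1]
          · have e1 := h.horizontal i (j - 1) le_rfl hi (by omega) (by omega)
            have e2 := h'.horizontal i (j - 1) le_rfl hi (by omega) (by omega)
            rw [sub_add_cancel] at e1 e2
            rw [← e1, ← e2, ihm (j - 1) (by omega) (by omega)]
      exact fun j hj hj' => cols (j - i).toNat j (by omega) hj'
    | succ n ih =>
      intro i hn hi
      push_cast at hn
      have cols : ∀ m : ℕ, ∀ j, j - a = m → j ≤ b → D (i, j) = D' (i, j) := by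
        have hnorth : ∀ j, a ≤ j → j ≤ b → (D (i, j)).north = (D' (i, j)).north := by
          intro j hj hj'
          have e1 := h.vertical (i - 1) j (by omega) (by omega) hj hj'
          have e2 := h'.vertical (i - 1) j (by omega) (by omega) hj hj'
          rw [sub_add_cancel] at e1 e2
          rw [← e1, ← e2, ih (i - 1) (by omega) (by omega) j hj hj']
        intro m
        induction m with
        | zero =>
          intro j hm hj
          obtain rfl : j = a := by push_cast at hm; omega
          refine tile _ _ ⟨⟨by simp only; omega, hi⟩, le_rfl, hj⟩ (hnorth j le_rfl hj) ?_
          rw [(h.border i (by omega) hi).2.1, (h'.border i (by omega) hi).2.1]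
        | succ m ihm =>
          intro j hm hj
          push_cast at hm
          refine tile _ _ ⟨⟨by simp only; omega, hi⟩, by simp only; omega, hj⟩
            (hnorth j (by omega) hj) ?_
          have e1 := h.horizontal i (j - 1) (by omega) hi (by omega) (by omega)
          have e2 := h'.horizontal i (j - 1) (by omega) hi (by omega) (by omega)
          rw [sub_add_cancel] at e1 e2
          rw [← e1, ← e2, ihm (j - 1) (by omega) (by omega)]
      exact fun j hj hj' => cols (j - a).toNat j (by omega) hj'
  funext ⟨i, j⟩
  by_cases hg : InGrid a b (i, j)
  · obtain ⟨⟨h1, h2⟩, h3, h4⟩ := hg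
    simp only at h1 h2 h3 h4
    exact rows (i - a).toNat i (by omega) h2 j h3 h4
  · rw [h.outside _ hg, h'.outside _ hg]

/-! ### Semistandard tableaux of straight shape -/

namespace IsSSYT

variable {lam : YoungDiagram} {lo hi : ℤ} {S : Filling}

theorem isSome_iff (h : IsSSYT lam ⊥ lo hi S) (q : ℕ × ℕ) : (S q).isSome ↔ q ∈ lam := by
  rw [h.shape]; simp

theorem mem_of_eq (h : IsSSYT lam ⊥ lo hi S) {q : ℕ × ℕ} {x : ℤ} (hx : S q = some x) : q ∈ lam :=
  (h.isSome_iff q).1 (by simp [hx])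

theorem exists_eq (h : IsSSYT lam ⊥ lo hi S) {q : ℕ × ℕ} (hq : q ∈ lam) : ∃ x, S q = some x :=
  Option.isSome_iff_exists.1 ((h.isSome_iff q).2 hq)

theorem shape_unique {lam' : YoungDiagram} {lo' hi' : ℤ} (h : IsSSYT lam ⊥ lo hi S)
    (h' : IsSSYT lam' ⊥ lo' hi' S) : lam = lam' := by
  ext q
  rw [YoungDiagram.mem_cells, YoungDiagram.mem_cells, ← h.isSome_iff, h'.isSome_iff]

theorem le_of_row (h : IsSSYT lam ⊥ lo hi S) {r c : ℕ} {x : ℤ} (hx : S (r, c) = some x) (n : ℕ)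
    {y : ℤ} (hy : S (r, c + n) = some y) : x ≤ y := by
  induction n generalizing y with
  | zero => rw [add_zero, hx] at hy; simp only [Option.some.injEq] at hy; exact hy.le
  | succ n ih =>
    obtain ⟨z, hz⟩ := h.exists_eq (lam.up_left_mem le_rfl (by omega : c + n ≤ c + (n + 1))
      (h.mem_of_eq hy))
    exact (ih hz).trans (h.row_weak _ _ _ _ hz hy)

theorem le_of_col (h : IsSSYT lam ⊥ lo hi S) {r c : ℕ} {x : ℤ} (hx : S (r, c) = some x) (n : ℕ)
    {y : ℤ} (hy : S (r + n, c) = some y) : x + n ≤ y := by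
  induction n generalizing y with
  | zero => rw [add_zero, hx] at hy; simp only [Option.some.injEq] at hy; simp [hy]
  | succ n ih =>
    obtain ⟨z, hz⟩ := h.exists_eq (lam.up_left_mem (by omega : r + n ≤ r + (n + 1)) le_rfl
      (h.mem_of_eq hy))
    have := h.col_strict _ _ _ _ hz hy
    have := ih hz
    push_cast
    omega

theorem le_of_le (h : IsSSYT lam ⊥ lo hi S) {r c r' c' : ℕ} {x y : ℤ} (hr : r ≤ r') (hc : c ≤ c')
    (hx : S (r, c) = some x) (hy : S (r', c') = some y) : x + (r' - r) ≤ y := by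
  obtain ⟨n, rfl⟩ := Nat.exists_eq_add_of_le hr
  obtain ⟨m, rfl⟩ := Nat.exists_eq_add_of_le hc
  obtain ⟨z, hz⟩ := h.exists_eq (lam.up_left_mem hr le_rfl (h.mem_of_eq hy))
  have h1 := h.le_of_row hx m hz
  have h2 := h.le_of_col hz n hy
  push_cast
  omega

theorem lo_add_le (h : IsSSYT lam ⊥ lo hi S) {r c : ℕ} {x : ℤ} (hx : S (r, c) = some x) :
    lo + r ≤ x := by
  obtain ⟨z, hz⟩ := h.exists_eq (lam.up_left_mem (Nat.zero_le r) le_rfl (h.mem_of_eq hx))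
  have h1 := (h.bounds _ _ hz).1
  have h2 := h.le_of_le (Nat.zero_le r) le_rfl hz hx
  simp only [Nat.cast_zero] at h2
  omega

end IsSSYT

/-- The position of the blank tile which corresponds to a box of a tableau. -/
def tilePos (S : Filling) (q : ℕ × ℕ) : Option (ℤ × ℤ) :=
  (S q).map fun x => (x, x + q.2 - q.1)

theorem tilePos_eq_some {S : Filling} {r c : ℕ} {p : ℤ × ℤ} :
    tilePos S (r, c) = some p ↔ S (r, c) = some p.1 ∧ p.2 = p.1 + c - r := by
  obtain ⟨i, j⟩ := p
  simp only [tilePos, Option.map_eq_some_iff, Prod.mk.injEq]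
  constructor
  · rintro ⟨x, h1, rfl, rfl⟩; exact ⟨h1, rfl⟩
  · rintro ⟨h1, rfl⟩; exact ⟨i, h1, rfl, rfl⟩

theorem tilePos_map_fst (S : Filling) (q : ℕ × ℕ) : (tilePos S q).map Prod.fst = S q := by
  simp only [tilePos, Option.map_map]
  exact congrFun Option.map_id (S q)

/-- Boxes on the same diagonal have different entries. -/
theorem IsSSYT.tilePos_inj {lam : YoungDiagram} {lo hi : ℤ} {S : Filling}
    (h : IsSSYT lam ⊥ lo hi S) {q q' : ℕ × ℕ} {p : ℤ × ℤ} (hq : tilePos S q = some p)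
    (hq' : tilePos S q' = some p) : q = q' := by
  obtain ⟨r, c⟩ := q
  obtain ⟨r', c'⟩ := q'
  obtain ⟨h1, h2⟩ := tilePos_eq_some.1 hq
  obtain ⟨h3, h4⟩ := tilePos_eq_some.1 hq'
  rcases le_total r r' with hr | hr
  · have := h.le_of_le hr (by omega) h1 h3
    rw [Prod.mk.injEq]; omega
  · have := h.le_of_le hr (by omega) h3 h1
    rw [Prod.mk.injEq]; omega

/-- A semistandard tableau is determined by the positions of its blank tiles. -/
theorem IsSSYT.eq_of_tilePos {lam lam' : YoungDiagram} {lo hi lo' hi' : ℤ} {S S' : Filling}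
    (h : IsSSYT lam ⊥ lo hi S) (h' : IsSSYT lam' ⊥ lo' hi' S')
    (hp : ∀ p, (∃ q, tilePos S q = some p) ↔ ∃ q, tilePos S' q = some p) : S = S' := by
  have step : ∀ (lam lam' : YoungDiagram) (lo hi lo' hi' : ℤ) (S S' : Filling),
      IsSSYT lam ⊥ lo hi S → IsSSYT lam' ⊥ lo' hi' S' →
      (∀ p, (∃ q, tilePos S q = some p) ↔ ∃ q, tilePos S' q = some p) → ∀ r,
      (∀ r' < r, ∀ c, S (r', c) = S' (r', c)) → ∀ c x, S (r, c) = some x →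
      S' (r, c) = some x := by
    intro lam lam' lo hi lo' hi' S S' h h' hp r ih c x hx
    -- The box of `S'` with the same blank position is on the same diagonal, where entries increase
    -- strictly. If it is higher up, then the rows already known to agree give a contradiction. If
    -- it is further down, then `S'` has a smaller entry `y` in `(r, c)`, whose position has no
    -- possible box in `S`.
    obtain ⟨⟨r', c'⟩, hq'⟩ := (hp (x, x + c - r)).1 ⟨(r, c), tilePos_eq_some.2 ⟨hx, rfl⟩⟩
    obtain ⟨h1, h2⟩ := tilePos_eq_some.1 hq'
    simp only at h1 h2
    rcases lt_trichotomy r' r with hlt | heq | hgt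
    · have h3 := h1
      rw [← ih r' hlt] at h3
      have := h.le_of_le hlt.le (by omega) h3 hx
      omega
    · obtain rfl : c' = c := by omega
      rwa [heq] at h1
    · obtain ⟨y, hy⟩ := h'.exists_eq (lam'.up_left_mem hgt.le (by omega : c ≤ c')
        (h'.mem_of_eq h1))
      have hyx := h'.le_of_le hgt.le (by omega) hy h1
      obtain ⟨⟨r₂, c₂⟩, hq₂⟩ := (hp (y, y + c - r)).2 ⟨(r, c), tilePos_eq_some.2 ⟨hy, rfl⟩⟩
      obtain ⟨h3, h4⟩ := tilePos_eq_some.1 hq₂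
      simp only at h3 h4
      by_cases hr : r ≤ r₂
      · have := h.le_of_le hr (by omega) hx h3; omega
      · rw [ih r₂ (by omega)] at h3
        have := h'.le_of_le (by omega : r₂ ≤ r) (by omega) h3 hy; omega
  funext ⟨r, c⟩
  induction r using Nat.strong_induction_on generalizing c with
  | _ r ih =>
    have h1 := step _ _ _ _ _ _ S S' h h' hp r (fun r' hr' c => ih r' hr' c) c
    have h2 := step _ _ _ _ _ _ S' S h' h (fun p => (hp p).symm) r
      (fun r' hr' c => (ih r' hr' c).symm) c
    cases hS : S (r, c) with
    | some x => rw [h1 x hS]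
    | none =>
      cases hS' : S' (r, c) with
      | some x => rw [h2 x hS'] at hS; simp at hS
      | none => rfl

/-! ### Tilings without possible droop moves -/

/-- The blank tiles of `D` are in the positions that are given by `S`. -/
def BlanksAt (a b : ℤ) (S : Filling) (D : Tiling) : Prop :=
  ∀ p, (InGrid a b p ∧ D p = .blank) ↔ ∃ q, tilePos S q = some p

/-- The columns in which pipes enter row `k` from below are given by the partition `lam`. -/
def EntersAt (a b k : ℤ) (lam : YoungDiagram) (D : Tiling) : Prop :=
  ∀ j, a ≤ j → j ≤ b →
    ((D (k, j)).south = true ↔ ∃ s : ℕ, a + s ≤ k ∧ j = k - s + lam.rowLen s)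

theorem IsGrassTiling.le_of_blank {a b k : ℤ} {D : Tiling} (h : IsGrassTiling a b k D) {i j : ℤ}
    (hg : InGrid a b (i, j)) (hb : D (i, j) = .blank) : i ≤ k :=
  not_lt.1 fun h0 => (h.bottom i j h0 hg.1.2 hg.2.1 hg.2.2).1 hb

section Terminal

variable {a b k : ℤ} {F : Tiling}

/-- Suppose that the tile above a blank one is not blank. It is closed to the south, so its pipe
comes from the west. The tile to its left is no `are`, as this could droop, so it is horizontal; but
then the tile below that one is blank as well. This moves the counterexample to the left, and in
column `a` nothing comes from the west. -/
theorem IsGrassTiling.blank_up (h : IsGrassTiling a b k F)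
    (hF : ∀ i j, a ≤ i → a ≤ j → i < b → j < b → F (i, j) = .are → F (i + 1, j + 1) ≠ .blank)
    {i : ℤ} (hi : a < i) (hi' : i ≤ b) : ∀ n : ℕ, ∀ j, j - a = n → j ≤ b → F (i, j) = .blank →
      F (i - 1, j) = .blank := by
  have tile : ∀ j, a ≤ j → j ≤ b → F (i, j) = .blank → F (i - 1, j) ≠ .blank →
      (F (i - 1, j)).west = true := by
    intro j hj hj' hb hne
    have hv := h.vertical (i - 1) j (by omega) (by omega) hj hj'
    rw [sub_add_cancel, hb] at hv
    cases hD : F (i - 1, j) <;> simp_all [Tile.south, Tile.north, Tile.west]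
  intro n
  induction n with
  | zero =>
    intro j hn hj hb
    obtain rfl : j = a := by push_cast at hn; omega
    by_contra hne
    have := tile j le_rfl hj hb hne
    rw [(h.border (i - 1) (by omega) (by omega)).2.1] at this
    simp at this
  | succ n ih =>
    intro j hn hj hb
    push_cast at hn
    have hik := h.le_of_blank (i := i) (j := j) ⟨⟨hi.le, hi'⟩, by simp only; omega, hj⟩ hb
    by_contra hne
    have hw := tile j (by omega) hj hb hne
    have he := h.horizontal (i - 1) (j - 1) (by omega) (by omega) (by omega) (by omega)
    rw [sub_add_cancel, hw] at he
    have hnr : F (i - 1, j - 1) ≠ .are := by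
      intro hr
      have := hF (i - 1) (j - 1) (by omega) (by omega) (by omega) (by omega) hr
      rw [sub_add_cancel, sub_add_cancel] at this
      exact this hb
    have hhor : F (i - 1, j - 1) = .horiz :=
      (Tile.thru_of_east he hnr).resolve_right (h.top _ _ (by omega))
    have h1 := h.vertical (i - 1) (j - 1) (by omega) (by omega) (by omega) (by omega)
    have h2 := h.horizontal i (j - 1) (by omega) (by omega) (by omega) (by omega)
    rw [sub_add_cancel, hhor] at h1
    rw [sub_add_cancel, hb] at h2
    have hb' : F (i, j - 1) = .blank := by
      cases hD : F (i, j - 1) <;> simp_all [Tile.south, Tile.north, Tile.west, Tile.east]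
    have := ih (j - 1) (by omega) (by omega) hb'
    rw [hhor] at this; simp at this

/-- The argument of `blank_up` with rows and columns exchanged: the counterexample moves up until it
reaches row `a`, where nothing comes from the north. -/
theorem IsGrassTiling.blank_left (h : IsGrassTiling a b k F)
    (hF : ∀ i j, a ≤ i → a ≤ j → i < b → j < b → F (i, j) = .are → F (i + 1, j + 1) ≠ .blank)
    {j : ℤ} (hj : a < j) (hj' : j ≤ b) : ∀ n : ℕ, ∀ i, i - a = n → i ≤ b → F (i, j) = .blank →
      F (i, j - 1) = .blank := by
  have tile : ∀ i, a ≤ i → i ≤ b → F (i, j) = .blank → F (i, j - 1) ≠ .blank →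
      (F (i, j - 1)).north = true := by
    intro i hi hi' hb hne
    have hv := h.horizontal i (j - 1) hi hi' (by omega) (by omega)
    rw [sub_add_cancel, hb] at hv
    cases hD : F (i, j - 1) <;> simp_all [Tile.west, Tile.north, Tile.east]
  intro n
  induction n with
  | zero =>
    intro i hn hi hb
    obtain rfl : i = a := by push_cast at hn; omega
    by_contra hne
    have := tile i le_rfl hi hb hne
    rw [(h.border (j - 1) (by omega) (by omega)).1] at this
    simp at this
  | succ n ih =>
    intro i hn hi hb
    push_cast at hn
    have hik := h.le_of_blank (i := i) (j := j) ⟨⟨by simp only; omega, hi⟩, hj.le, hj'⟩ hb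
    by_contra hne
    have hw := tile i (by omega) hi hb hne
    have he := h.vertical (i - 1) (j - 1) (by omega) (by omega) (by omega) (by omega)
    rw [sub_add_cancel, hw] at he
    have hnr : F (i - 1, j - 1) ≠ .are := by
      intro hr
      have := hF (i - 1) (j - 1) (by omega) (by omega) (by omega) (by omega) hr
      rw [sub_add_cancel, sub_add_cancel] at this
      exact this hb
    have hnc := h.top (i - 1) (j - 1) (by omega)
    have hver : F (i - 1, j - 1) = .vert := by
      cases hD : F (i - 1, j - 1) <;> simp_all [Tile.south]
    have h1 := h.horizontal (i - 1) (j - 1) (by omega) (by omega) (by omega) (by omega)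
    have h2 := h.vertical (i - 1) j (by omega) (by omega) (by omega) (by omega)
    rw [sub_add_cancel, hver] at h1
    rw [sub_add_cancel, hb] at h2
    have hb' : F (i - 1, j) = .blank := by
      cases hD : F (i - 1, j) <;> simp_all [Tile.south, Tile.north, Tile.west, Tile.east]
    have := ih (i - 1) (by omega) (by omega) hb'
    rw [hver] at this; simp at this

/-- If no droop move is possible, then the blank tiles form a Young diagram. -/
theorem IsGrassTiling.exists_shape (h : IsGrassTiling a b k F)
    (hF : ∀ i j, a ≤ i → a ≤ j → i < b → j < b → F (i, j) = .are → F (i + 1, j + 1) ≠ .blank) :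
    ∃ lam : YoungDiagram, ∀ r c : ℕ, (r, c) ∈ lam ↔
      InGrid a b (a + r, a + c) ∧ F (a + r, a + c) = .blank := by
  classical
  let N := (b - a + 1).toNat
  have hstep : ∀ (P : ℕ → Prop), (∀ n, P (n + 1) → P n) → ∀ m n, m ≤ n → P n → P m := by
    intro P hP m n hmn
    induction hmn with
    | refl => exact id
    | step _ ih => exact fun h0 => ih (hP _ h0)
  let Q : ℕ × ℕ → Prop := fun q => InGrid a b (a + q.1, a + q.2) ∧ F (a + q.1, a + q.2) = .blank
  have hQ1 : ∀ r c, Q (r + 1, c) → Q (r, c) := by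
    rintro r c ⟨⟨⟨h1, h2⟩, h3, h4⟩, hb⟩
    simp only [Nat.cast_add, Nat.cast_one] at h1 h2 h3 h4 hb
    refine ⟨⟨⟨?_, ?_⟩, h3, h4⟩, ?_⟩
    · simp only; omega
    · simp only; omega
    · have := h.blank_up hF (i := a + (r + 1)) (by omega) h2 c (a + c) (by omega) h4 hb
      rwa [show a + ((r : ℤ) + 1) - 1 = a + r by ring] at this
  have hQ2 : ∀ r c, Q (r, c + 1) → Q (r, c) := by
    rintro r c ⟨⟨⟨h1, h2⟩, h3, h4⟩, hb⟩
    simp only [Nat.cast_add, Nat.cast_one] at h1 h2 h3 h4 hb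
    refine ⟨⟨⟨h1, h2⟩, ?_, ?_⟩, ?_⟩
    · simp only; omega
    · simp only; omega
    · have := h.blank_left hF (j := a + (c + 1)) (by omega) h4 r (a + r) (by omega) h2 hb
      rwa [show a + ((c : ℤ) + 1) - 1 = a + c by ring] at this
  refine ⟨⟨(Finset.range N ×ˢ Finset.range N).filter Q, ?_⟩, fun r c => ?_⟩
  · rintro ⟨r, c⟩ ⟨r', c'⟩ hle hm
    simp only [Finset.coe_filter, Set.mem_ofPred_eq, Finset.mem_product, Finset.mem_range] at hm ⊢
    obtain ⟨hr, hc⟩ := Prod.mk_le_mk.1 hle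
    refine ⟨by omega, ?_⟩
    exact hstep (fun n => Q (n, c')) (fun n => hQ1 n c') r' r hr
      (hstep (fun n => Q (r, n)) (fun n => hQ2 r n) c' c hc hm.2)
  · rw [← YoungDiagram.mem_cells]
    simp only [Finset.mem_filter, Finset.mem_product, Finset.mem_range]
    refine ⟨fun h0 => h0.2, fun h0 => ⟨?_, h0⟩⟩
    obtain ⟨⟨h1, h2⟩, h3, h4⟩ := h0.1
    simp only at h1 h2 h3 h4
    omega

/-- On nonblank tiles other than crosses, `south` is the negation of `west`, and `east` the negation
of `north`. Hence in each row the first nonblank tile, in column `a + lam.rowLen r`, starts one new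
upper-left turn, and to the right of it a tile is open to the south iff the tile above its left
neighbor is. So every pipe moves one column to the right per row, and the one from row `a + s`
reaches column `k - s + lam.rowLen s` at row `k`. -/
theorem IsGrassTiling.entersAt (h : IsGrassTiling a b k F) (ha : a ≤ k) (hk : k ≤ b)
    {lam : YoungDiagram} (hlam : ∀ r c : ℕ, (r, c) ∈ lam ↔
      InGrid a b (a + r, a + c) ∧ F (a + r, a + c) = .blank) : EntersAt a b k lam F := by
  have hblank : ∀ (r : ℕ) (j : ℤ), a + r ≤ b → a ≤ j → j ≤ b →
      (F (a + r, j) = .blank ↔ j < a + lam.rowLen r) := by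
    intro r j hr hj hj'
    obtain ⟨c, rfl⟩ : ∃ c : ℕ, j = a + c := ⟨(j - a).toNat, by omega⟩
    have h1 := hlam r c
    rw [YoungDiagram.mem_iff_lt_rowLen] at h1
    rw [show (a + (c : ℤ) < a + lam.rowLen r) ↔ c < lam.rowLen r by omega, h1]
    exact ⟨fun h0 => ⟨⟨⟨by simp only; omega, hr⟩, hj, hj'⟩, h0⟩, fun h0 => h0.2⟩
  have tile : ∀ i j, i ≤ k → F (i, j) ≠ .blank → (F (i, j)).south = !(F (i, j)).west ∧
      (F (i, j)).east = !(F (i, j)).north := by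
    intro i j hi hb
    have := h.top i j hi
    cases hD : F (i, j) <;> simp_all [Tile.south, Tile.west, Tile.north, Tile.east]
  have key : ∀ r : ℕ, a + r ≤ k → ∀ j, a ≤ j → j ≤ b →
      ((F (a + r, j)).south = true ↔ ∃ s : ℕ, s ≤ r ∧ j = a + r - s + lam.rowLen s) := by
    intro r
    induction r with
    | zero =>
      intro hr j hj hj'
      rcases lt_trichotomy j (a + lam.rowLen 0) with hlt | heq | hgt
      · rw [(hblank 0 j (by simpa using hr.trans hk) hj hj').2 hlt]
        simp only [Tile.south, Bool.false_eq_true, false_iff, not_exists, not_and]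
        intro s hs
        obtain rfl : s = 0 := by omega
        push_cast; omega
      · have hnb : F (a + (0 : ℕ), j) ≠ .blank := by
          rw [Ne, hblank 0 j (by simpa using hr.trans hk) hj hj']; omega
        have hw : (F (a + (0 : ℕ), j)).west = false := by
          by_cases hja : j = a
          · rw [hja]; exact (h.border _ (by omega) (by omega)).2.1
          · have := h.horizontal (a + (0 : ℕ)) (j - 1) (by omega) (by omega) (by omega) (by omega)
            rw [sub_add_cancel] at this
            rw [← this, (hblank 0 (j - 1) (by omega) (by omega) (by omega)).2 (by omega)]; rfl
        rw [(tile _ _ hr hnb).1, hw]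
        exact ⟨fun _ => ⟨0, le_rfl, by push_cast; omega⟩, fun _ => rfl⟩
      · have hnb : F (a + (0 : ℕ), j) ≠ .blank := by
          rw [Ne, hblank 0 j (by simpa using hr.trans hk) hj hj']; omega
        have hnb' : F (a + (0 : ℕ), j - 1) ≠ .blank := by
          rw [Ne, hblank 0 (j - 1) (by omega) (by omega) (by omega)]; omega
        have h1 := h.horizontal (a + (0 : ℕ)) (j - 1) (by omega) (by omega) (by omega) (by omega)
        rw [sub_add_cancel] at h1
        have h2 := (h.border (j - 1) (by omega) (by omega)).1
        rw [(tile _ _ hr hnb).1, ← h1, (tile _ _ hr hnb').2]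
        rw [show a + ((0 : ℕ) : ℤ) = a by simp, h2]
        simp only [Bool.not_false, Bool.not_true, Bool.false_eq_true, false_iff, not_exists,
          not_and]
        intro s hs
        obtain rfl : s = 0 := by omega
        push_cast; omega
    | succ r ih =>
      intro hr j hj hj'
      have hrb := hr.trans hk
      rcases lt_trichotomy j (a + lam.rowLen (r + 1)) with hlt | heq | hgt
      · rw [(hblank (r + 1) j hrb hj hj').2 hlt]
        simp only [Tile.south, Bool.false_eq_true, false_iff, not_exists, not_and]
        intro s hs
        have := lam.rowLen_anti s (r + 1) hs
        push_cast; omega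
      · have hnb : F (a + (r + 1 : ℕ), j) ≠ .blank := by
          rw [Ne, hblank (r + 1) j hrb hj hj']; omega
        have hw : (F (a + (r + 1 : ℕ), j)).west = false := by
          by_cases hja : j = a
          · rw [hja]; exact (h.border _ (by omega) (by omega)).2.1
          · have := h.horizontal (a + (r + 1 : ℕ)) (j - 1) (by omega) (by omega) (by omega)
              (by omega)
            rw [sub_add_cancel] at this
            rw [← this, (hblank (r + 1) (j - 1) (by omega) (by omega) (by omega)).2 (by omega)]; rfl
        rw [(tile _ _ hr hnb).1, hw]
        exact ⟨fun _ => ⟨r + 1, le_rfl, by push_cast; omega⟩, fun _ => rfl⟩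
      · have hnb : F (a + (r + 1 : ℕ), j) ≠ .blank := by
          rw [Ne, hblank (r + 1) j hrb hj hj']; omega
        have hnb' : F (a + (r + 1 : ℕ), j - 1) ≠ .blank := by
          rw [Ne, hblank (r + 1) (j - 1) (by omega) (by omega) (by omega)]; omega
        have h1 := h.horizontal (a + (r + 1 : ℕ)) (j - 1) (by omega) (by omega) (by omega)
          (by omega)
        rw [sub_add_cancel] at h1
        have h2 := h.vertical (a + r) (j - 1) (by omega) (by push_cast at hrb; omega) (by omega)
          (by omega)
        rw [show a + (r : ℤ) + 1 = a + (r + 1 : ℕ) by push_cast; ring] at h2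
        rw [(tile _ _ hr hnb).1, ← h1, (tile _ _ hr hnb').2, ← h2, Bool.not_not,
          ih (by push_cast at hr; omega) (j - 1) (by omega) (by omega)]
        constructor
        · rintro ⟨s, hs, hs'⟩
          exact ⟨s, by omega, by push_cast; omega⟩
        · rintro ⟨s, hs, hs'⟩
          have : s ≠ r + 1 := by rintro rfl; push_cast at hs'; omega
          exact ⟨s, by omega, by push_cast at hs'; omega⟩
  intro j hj hj'
  obtain ⟨r, rfl⟩ : ∃ r : ℕ, k = a + r := ⟨(k - a).toNat, by omega⟩
  rw [key r le_rfl j hj hj']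
  exact exists_congr fun s => by constructor <;> rintro ⟨h1, h2⟩ <;> exact ⟨by omega, h2⟩

end Terminal

/-! ### Droop moves and tableaux -/

/-- Droop moves do not change row `k` from below. -/
theorem IsFlip.entersAt_iff {a b k i j : ℤ} {D D' : Tiling} (h : IsFlip i j D D') (hik : i + 1 ≤ k)
    (lam : YoungDiagram) : EntersAt a b k lam D ↔ EntersAt a b k lam D' := by
  have : ∀ y, (D' (k, y)).south = (D (k, y)).south := by
    intro y
    rw [(h.edges k y).1]
    have : IsFlip.vEdge i j (k, y) = false := by simp [IsFlip.vEdge]; omega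
    simp [this]
  simp only [EntersAt, this]

/-- Change one entry of a tableau. -/
theorem IsSSYT.update {lam : YoungDiagram} {lo k : ℤ} {S : Filling} (h : IsSSYT lam ⊥ lo k S)
    {r c : ℕ} {z : ℤ} (hm : (r, c) ∈ lam) (hlo : lo ≤ z) (hk : z ≤ k)
    (left : ∀ c' y, c' + 1 = c → S (r, c') = some y → y ≤ z)
    (right : ∀ y, S (r, c + 1) = some y → z ≤ y)
    (above : ∀ r' y, r' + 1 = r → S (r', c) = some y → y < z)
    (below : ∀ y, S (r + 1, c) = some y → z < y) :
    IsSSYT lam ⊥ lo k (Function.update S (r, c) (some z)) := by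
  refine ⟨fun p => ?_, fun p y hy => ?_, fun r' c' y y' hy hy' => ?_, fun r' c' y y' hy hy' => ?_⟩
  · rw [← h.shape]
    by_cases hp : p = (r, c)
    · subst hp; simpa using (h.isSome_iff _).2 hm
    · rw [Function.update_of_ne hp]
  · by_cases hp : p = (r, c)
    · subst hp
      simp only [Function.update_self, Option.some.injEq] at hy
      omega
    · rw [Function.update_of_ne hp] at hy; exact h.bounds _ _ hy
  · simp only [Function.update_apply, Prod.mk.injEq] at hy hy'
    split_ifs at hy hy' with h1 h2 h2
    · omega
    · obtain ⟨rfl, rfl⟩ := h1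
      have := right _ hy'
      simp only [Option.some.injEq] at hy; omega
    · obtain ⟨rfl, h2⟩ := h2
      have := left _ _ h2 hy
      simp only [Option.some.injEq] at hy'; omega
    · exact h.row_weak _ _ _ _ hy hy'
  · simp only [Function.update_apply, Prod.mk.injEq] at hy hy'
    split_ifs at hy hy' with h1 h2 h2
    · omega
    · obtain ⟨rfl, rfl⟩ := h1
      have := below _ hy'
      simp only [Option.some.injEq] at hy; omega
    · obtain ⟨h2, rfl⟩ := h2
      have := above _ _ h2 hy
      simp only [Option.some.injEq] at hy'; omega
    · exact h.col_strict _ _ _ _ hy hy'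

/-- Undrooping a blank tile increases an entry of the tableau. -/
theorem IsSSYT.increment {lam : YoungDiagram} {lo k : ℤ} {S : Filling} (h : IsSSYT lam ⊥ lo k S)
    {r c : ℕ} {x : ℤ} (hx : S (r, c) = some x) (hk : x < k)
    (hright : S (r, c + 1) ≠ some x) (hbelow : S (r + 1, c) ≠ some (x + 1)) :
    IsSSYT lam ⊥ lo k (Function.update S (r, c) (some (x + 1))) := by
  refine h.update (h.mem_of_eq hx) ?_ (by omega) ?_ ?_ ?_ ?_
  · have := (h.bounds _ _ hx).1; omega
  · rintro c' y rfl hy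
    have := h.row_weak _ _ _ _ hy hx; omega
  · intro y hy
    have := h.row_weak _ _ _ _ hx hy
    have : y ≠ x := by rintro rfl; exact hright hy
    omega
  · rintro r' y rfl hy
    have := h.col_strict _ _ _ _ hy hx; omega
  · intro y hy
    have := h.col_strict _ _ _ _ hx hy
    have : y ≠ x + 1 := by rintro rfl; exact hbelow hy
    omega

/-- The positions of the blank tiles after an entry has been increased. -/
theorem tilePos_increment {S : Filling} {r c : ℕ} {i j : ℤ} (hx : tilePos S (r, c) = some (i, j))
    (q : ℕ × ℕ) : tilePos (Function.update S (r, c) (some (i + 1))) q =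
      if q = (r, c) then some (i + 1, j + 1) else tilePos S q := by
  obtain ⟨h1, h2⟩ := tilePos_eq_some.1 hx
  simp only at h2
  split_ifs with hq
  · subst hq
    simp [tilePos, h2]; ring
  · simp [tilePos, Function.update_of_ne hq]

theorem IsFlip.blanksAt {a b : ℤ} {lam : YoungDiagram} {lo hi : ℤ} {S : Filling} {D D' : Tiling}
    {i j : ℤ} (h : IsFlip i j D D') (hg' : InGrid a b (i + 1, j + 1))
    (hS : IsSSYT lam ⊥ lo hi S) (hD' : BlanksAt a b S D') {r c : ℕ}
    (hx : tilePos S (r, c) = some (i, j)) :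
    BlanksAt a b (Function.update S (r, c) (some (i + 1))) D := by
  intro p
  have h1 := hD' p
  rw [h.blank_iff] at h1
  simp only [tilePos_increment hx]
  have hbl := h.blank
  constructor
  · rintro ⟨hp, hb⟩
    by_cases hpe : p = (i + 1, j + 1)
    · exact ⟨(r, c), by simp [hpe]⟩
    · obtain ⟨q, hq⟩ := h1.1 ⟨hp, Or.inr ⟨hpe, hb⟩⟩
      refine ⟨q, ?_⟩
      rw [if_neg, hq]
      rintro rfl
      rw [hx] at hq
      simp only [Option.some.injEq] at hq
      rw [← hq, h.are] at hb
      simp at hb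
  · rintro ⟨q, hq⟩
    split_ifs at hq with hqe
    · simp only [Option.some.injEq] at hq
      rw [← hq]; exact ⟨hg', hbl⟩
    · obtain ⟨hp, h2⟩ := h1.2 ⟨q, hq⟩
      refine ⟨hp, ?_⟩
      rcases h2 with rfl | h2
      · exact absurd (hS.tilePos_inj hq hx) hqe
      · exact h2.2

open Classical in
/-- The tableau with the smallest possible entries. -/
def minTableau (a : ℤ) (lam : YoungDiagram) : Filling :=
  fun q => if q ∈ lam then some (a + q.1) else none

theorem minTableau_eq_some {a : ℤ} {lam : YoungDiagram} {r c : ℕ} {x : ℤ} :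
    minTableau a lam (r, c) = some x ↔ (r, c) ∈ lam ∧ x = a + r := by
  simp only [minTableau]
  split_ifs with h <;> simp [h, eq_comm]

theorem tilePos_minTableau {a : ℤ} {lam : YoungDiagram} {r c : ℕ} {p : ℤ × ℤ} :
    tilePos (minTableau a lam) (r, c) = some p ↔ (r, c) ∈ lam ∧ p = (a + r, a + c) := by
  obtain ⟨i, j⟩ := p
  rw [tilePos_eq_some, minTableau_eq_some, Prod.mk.injEq]
  simp only
  constructor
  · rintro ⟨⟨h1, h2⟩, h3⟩; exact ⟨h1, h2, by omega⟩
  · rintro ⟨h1, h2, h3⟩; exact ⟨⟨h1, h2⟩, by omega⟩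

theorem IsGrassTiling.minTableau {a b k : ℤ} {F : Tiling} (hF : IsGrassTiling a b k F)
    {lam : YoungDiagram} (hlam : ∀ r c : ℕ, (r, c) ∈ lam ↔
      InGrid a b (a + r, a + c) ∧ F (a + r, a + c) = .blank) :
    IsSSYT lam ⊥ a k (minTableau a lam) ∧ BlanksAt a b (minTableau a lam) F := by
  refine ⟨⟨fun p => ?_, ?_, ?_, ?_⟩, ?_⟩
  · simp only [Taquin.minTableau]; split_ifs with h <;> simp [h]
  · rintro ⟨r, c⟩ x hx
    obtain ⟨h1, rfl⟩ := minTableau_eq_some.1 hx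
    obtain ⟨h2, h3⟩ := (hlam r c).1 h1
    exact ⟨by omega, hF.le_of_blank h2 h3⟩
  · intro r c x y hx hy
    rw [(minTableau_eq_some.1 hx).2, (minTableau_eq_some.1 hy).2]
  · intro r c x y hx hy
    rw [(minTableau_eq_some.1 hx).2, (minTableau_eq_some.1 hy).2]; push_cast; omega
  · rintro ⟨i, j⟩
    constructor
    · rintro ⟨⟨⟨h1, h2⟩, h3, h4⟩, hb⟩
      simp only at h1 h2 h3 h4
      obtain ⟨r, rfl⟩ : ∃ r : ℕ, i = a + r := ⟨(i - a).toNat, by omega⟩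
      obtain ⟨c, rfl⟩ : ∃ c : ℕ, j = a + c := ⟨(j - a).toNat, by omega⟩
      exact ⟨(r, c), tilePos_minTableau.2 ⟨(hlam r c).2 ⟨⟨⟨h1, h2⟩, h3, h4⟩, hb⟩, rfl⟩⟩
    · rintro ⟨⟨r, c⟩, hq⟩
      obtain ⟨h1, h2⟩ := tilePos_minTableau.1 hq
      rw [h2]; exact (hlam r c).1 h1

/-- The tableau of a tiling, obtained by following droop moves backwards. -/
theorem IsGrassTiling.exists_tableau {a b k : ℤ} (ha : a ≤ k) (hk : k ≤ b) {X F : LabeledTiling}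
    (hX : IsGrassTiling a b k X.1) (hXF : Relation.ReflTransGen (Droop a b) X F)
    (hF : ¬ ∃ G, Droop a b F G) :
    ∃ lam S, IsSSYT lam ⊥ a k S ∧ BlanksAt a b S X.1 ∧ EntersAt a b k lam X.1 ∧
      (∀ r c : ℕ, (r, c) ∈ lam ↔ InGrid a b (a + r, a + c) ∧ F.1 (a + r, a + c) = .blank) ∧
      ∀ r c p, tilePos S (r, c) = some p → F.2 (a + r, a + c) = X.2 p := by
  induction hXF using Relation.ReflTransGen.head_induction_on with
  | refl =>
    have hF' : ∀ i j, a ≤ i → a ≤ j → i < b → j < b → F.1 (i, j) = .are →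
        F.1 (i + 1, j + 1) ≠ .blank := by
      intro i j hi hj hi' hj' hr hb
      obtain ⟨D', hD'⟩ := hX.exists_flip hi hj hi' hj' hr hb
      refine hF ⟨(D', Function.update F.2 (i, j) (F.2 (i + 1, j + 1))), droop_iff.2
        ⟨i, j, ⟨⟨hi, hi'.le⟩, hj, hj'.le⟩, ⟨⟨?_, ?_⟩, ?_, ?_⟩, hD', rfl⟩⟩ <;> simp only <;> omega
    obtain ⟨lam, hlam⟩ := hX.exists_shape hF'
    obtain ⟨h1, h2⟩ := hX.minTableau hlam
    refine ⟨lam, _, h1, h2, hX.entersAt ha hk hlam, hlam, fun r c p hp => ?_⟩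
    rw [(tilePos_minTableau.1 hp).2]
  | head hXY hYF ih =>
    rename_i X Y
    obtain ⟨D, L⟩ := X
    obtain ⟨D', L'⟩ := Y
    obtain ⟨i, j, hg, hg', hflip, hL⟩ := droop_iff.1 hXY
    simp only at hX ih ⊢
    have hD' := (hflip.isGrassTiling_iff hg hg').1 hX
    have hik : i + 1 ≤ k := hX.le_of_blank hg' hflip.blank
    obtain ⟨lam, S', hS', hbl, hent, hlam, hlab⟩ := ih hD'
    obtain ⟨⟨r, c⟩, hq⟩ := (hbl (i, j)).1 ⟨hg, hflip.nw⟩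
    obtain ⟨hx, hj⟩ := tilePos_eq_some.1 hq
    simp only at hx hj
    simp only [InGrid] at hg hg'
    have hne := hflip.ne
    have hsw := hflip.sw
    refine ⟨lam, Function.update S' (r, c) (some (i + 1)),
      hS'.increment hx (by omega) (fun h0 => ?_) (fun h0 => ?_),
      hflip.blanksAt hg' hS' hbl hq, (hflip.entersAt_iff hik lam).2 hent, hlam, ?_⟩
    -- An equal entry to the right would be a blank tile at `(i, j + 1)` of the drooped tiling, but
    -- there the pipe passes. In the same way, an entry `i + 1` below is excluded by the tile at `(i
    -- + 1, j)`.
    · obtain ⟨-, h2⟩ := (hbl (i, j + 1)).2 ⟨(r, c + 1), tilePos_eq_some.2 ⟨h0, by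
        simp only; push_cast; omega⟩⟩
      rw [h2] at hne; simp at hne
    · obtain ⟨-, h2⟩ := (hbl (i + 1, j)).2 ⟨(r + 1, c), tilePos_eq_some.2 ⟨h0, by
        simp only; push_cast; omega⟩⟩
      rw [h2] at hsw; simp at hsw
    · intro r' c' p hp
      rw [tilePos_increment hq] at hp
      split_ifs at hp with hqe
      · simp only [Prod.mk.injEq] at hqe
        obtain ⟨rfl, rfl⟩ := hqe
        simp only [Option.some.injEq] at hp
        rw [hlab _ _ _ hq, hL, ← hp]; simp
      · rw [hlab _ _ _ hp, hL, Function.update_of_ne]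
        rintro rfl
        exact hqe (hS'.tilePos_inj hp hq)

/-- Droop moves terminate. -/
theorem IsGrassTiling.exists_droops {a b k : ℤ} {X : LabeledTiling}
    (hX : IsGrassTiling a b k X.1) :
    ∃ F : LabeledTiling, Relation.ReflTransGen (Droop a b) X F ∧ IsGrassTiling a b k F.1 ∧
      ¬ ∃ G, Droop a b F G := by
  classical
  let B : Tiling → Finset (ℤ × ℤ) := fun D =>
    (Finset.Icc a b ×ˢ Finset.Icc a b).filter fun p => D p = .blank
  have hB : ∀ D p, p ∈ B D ↔ InGrid a b p ∧ D p = .blank := by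
    intro D p
    simp only [B, Finset.mem_filter, Finset.mem_product, Finset.mem_Icc, InGrid]
  -- A droop moves one blank tile up by one row and keeps the others, so the sum of the heights `f`
  -- drops.
  let f : ℤ × ℤ → ℕ := fun p => (p.1 - a).toNat
  have key : ∀ n : ℕ, ∀ X : LabeledTiling, IsGrassTiling a b k X.1 → ∑ p ∈ B X.1, f p = n →
      ∃ F : LabeledTiling, Relation.ReflTransGen (Droop a b) X F ∧ IsGrassTiling a b k F.1 ∧
      ¬ ∃ G, Droop a b F G := by
    intro n
    induction n using Nat.strong_induction_on with
    | _ n ih =>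
      intro X hX hn
      by_cases hG : ∃ G, Droop a b X G
      swap
      · exact ⟨X, .refl, hX, hG⟩
      obtain ⟨⟨D', L'⟩, hd⟩ := hG
      obtain ⟨D, L⟩ := X
      obtain ⟨i, j, hg, hg', hflip, hL⟩ := droop_iff.1 hd
      have hD' := (hflip.isGrassTiling_iff hg hg').1 hX
      have hBB : B D' = insert (i, j) ((B D).erase (i + 1, j + 1)) := by
        ext p
        rw [hB, hflip.blank_iff, Finset.mem_insert, Finset.mem_erase, hB]
        constructor
        · rintro ⟨h1, h2⟩; tauto
        · rintro (rfl | h1)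
          · exact ⟨hg, Or.inl rfl⟩
          · tauto
      have hni : (i, j) ∉ (B D).erase (i + 1, j + 1) := by
        rw [Finset.mem_erase, hB, hflip.are]; simp
      have hmem : (i + 1, j + 1) ∈ B D := (hB _ _).2 ⟨hg', hflip.blank⟩
      have h1 := Finset.add_sum_erase _ f hmem
      have hlt : ∑ p ∈ B D', f p < n := by
        rw [hBB, Finset.sum_insert hni, ← hn]
        simp only [InGrid] at hg hg'
        have : f (i, j) < f (i + 1, j + 1) := by simp only [f]; omega
        simp only at h1 ⊢
        omega
      obtain ⟨F, h2, h3⟩ := ih _ hlt (D', L') hD' rfl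
      exact ⟨F, .head hd h2, h3⟩
  exact key _ X hX rfl

/-- The tableau with its origins in a Grassmannian tiling. -/
theorem IsGrassTiling.originTableau_iff {a b k : ℤ} (ha : a ≤ k) (hk : k ≤ b) {D : Tiling}
    (hD : IsGrassTiling a b k D) {lam : YoungDiagram} {lo hi : ℤ} {S : Filling}
    (hS : IsSSYT lam ⊥ lo hi S) (hb : BlanksAt a b S D) (O : ℕ × ℕ → Option (ℤ × ℤ)) :
    OriginTableau a b D O ↔ O = tilePos S := by
  -- The tableau obtained from any complete sequence of droops has the blank positions of `D`, hence
  -- is `S`. This is what makes the result independent of the sequence.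
  have key : ∀ F : LabeledTiling, Relation.ReflTransGen (Droop a b) (D, id) F →
      (¬ ∃ G, Droop a b F G) → ∀ (r c : ℕ) (q : ℤ × ℤ), tilePos S (r, c) = some q ↔
        InGrid a b (a + r, a + c) ∧ F.1 (a + r, a + c) = .blank ∧ F.2 (a + r, a + c) = q := by
    intro F h1 h2 r c q
    obtain ⟨lam', S', hS', hb', -, hlam, hlab⟩ :=
      IsGrassTiling.exists_tableau ha hk (X := (D, id)) hD h1 h2
    have hSS : S = S' := hS.eq_of_tilePos hS' fun p => (hb p).symm.trans (hb' p)
    subst hSS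
    rw [← and_assoc, ← hlam]
    constructor
    · intro h3
      exact ⟨hS'.mem_of_eq (tilePos_eq_some.1 h3).1, hlab _ _ _ h3⟩
    · rintro ⟨h3, h4⟩
      obtain ⟨x, hx⟩ := hS'.exists_eq h3
      have h5 : tilePos S (r, c) = some (x, x + c - r) := tilePos_eq_some.2 ⟨hx, rfl⟩
      rw [h5, ← h4, hlab _ _ _ h5]; rfl
  constructor
  · rintro ⟨F, h1, h2, h3⟩
    funext ⟨r, c⟩
    ext q
    rw [h3, key F h1 h2]
  · rintro rfl
    obtain ⟨F, h1, -, h2⟩ := IsGrassTiling.exists_droops (X := (D, id)) hD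
    exact ⟨F, h1, h2, key F h1 h2⟩

theorem IsGrassTiling.isTableauOf_iff {a b k : ℤ} (ha : a ≤ k) (hk : k ≤ b) {D : Tiling}
    (hD : IsGrassTiling a b k D) {lam : YoungDiagram} {lo hi : ℤ} {S : Filling}
    (hS : IsSSYT lam ⊥ lo hi S) (hb : BlanksAt a b S D) (S' : Filling) :
    IsTableauOf a b D S' ↔ S' = S := by
  constructor
  · rintro ⟨O, hO, h⟩
    rw [hD.originTableau_iff ha hk hS hb] at hO
    subst hO
    funext p
    rw [h, tilePos_map_fst]
  · rintro rfl
    exact ⟨_, (hD.originTableau_iff ha hk hS hb _).2 rfl, fun p => (tilePos_map_fst _ p).symm⟩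

/-! ### Shapes of Grassmannian permutations -/

section Shape

variable {a b k : ℤ} {w : Equiv.Perm ℤ} {lam : YoungDiagram}

theorem IsGrassmannian.le_apply (hw : IsGrassmannian a b k w) (hk : k ≤ b) {i : ℤ} (hi : a ≤ i)
    (hik : i ≤ k) : i ≤ w i := by
  have key : ∀ n : ℕ, ∀ i, i - a = n → i ≤ k → i ≤ w i := by
    intro n
    induction n with
    | zero =>
      intro i hn hi
      obtain rfl : i = a := by push_cast at hn; omega
      exact (hw.mem le_rfl (by omega)).1
    | succ n ih =>
      intro i hn hi
      push_cast at hn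
      have h1 := ih (i - 1) (by omega) (by omega)
      have h2 := hw.lt_of_avoid (by omega) (sub_one_lt i) (by omega) (Or.inl hi)
      omega
  exact key (i - a).toNat i (by omega) hik

theorem IsShapeOf.apply_eq (h : IsShapeOf a k w lam) (hw : IsGrassmannian a b k w) (hk : k ≤ b)
    {s : ℕ} (hs : a + s ≤ k) : w (k - s) = k - s + lam.rowLen s := by
  have h1 := hw.le_apply hk (i := k - s) (by omega) (by omega)
  have h2 : ∀ c : ℕ, c < lam.rowLen s ↔ (c : ℤ) < w (k - s) - (k - s) := by
    intro c
    rw [← YoungDiagram.mem_iff_lt_rowLen, h]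
    exact ⟨fun h0 => h0.2, fun h0 => ⟨by omega, h0⟩⟩
  have h3 := h2 (w (k - s) - (k - s)).toNat
  have h4 := h2 (lam.rowLen s)
  omega

theorem IsShapeOf.row_le (h : IsShapeOf a k w lam) {r c : ℕ} (hm : (r, c) ∈ lam) : a + r ≤ k := by
  have := ((h r c).1 hm).1; omega

theorem IsShapeOf.rowLen_le (h : IsShapeOf a k w lam) (hw : IsGrassmannian a b k w) (hk : k ≤ b)
    (ha : a ≤ k) : k + lam.rowLen 0 ≤ b := by
  have h1 := h.apply_eq hw hk (s := 0) (by simpa using ha)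
  have h2 := (hw.mem ha hk).2
  simp only [Nat.cast_zero, sub_zero] at h1
  omega

theorem IsShapeOf.entersAt_iff (h : IsShapeOf a k w lam) (hw : IsGrassmannian a b k w)
    (hk : k ≤ b) {D : Tiling} : EntersAt a b k lam D ↔
      ∀ j, a ≤ j → j ≤ b → ((D (k, j)).south = true ↔ w.symm j ≤ k) := by
  refine forall_congr' fun j => forall_congr' fun hj => forall_congr' fun hj' => ?_
  have : (∃ s : ℕ, a + s ≤ k ∧ j = k - s + lam.rowLen s) ↔ w.symm j ≤ k := by
    constructor
    · rintro ⟨s, hs, h1⟩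
      rw [← h.apply_eq hw hk hs] at h1
      rw [h1, Equiv.symm_apply_apply]; omega
    · intro h1
      have h2 := (hw.symm_mem hj hj').1
      have h3 := h.apply_eq hw hk (s := (k - w.symm j).toNat) (by omega)
      refine ⟨(k - w.symm j).toNat, by omega, ?_⟩
      rw [← h3, show k - ((k - w.symm j).toNat : ℤ) = w.symm j by omega, Equiv.apply_symm_apply]
  rw [this]

/-- A partition is determined by the columns in which pipes enter row `k`. -/
theorem EntersAt.shape_eq {lam' : YoungDiagram} {D : Tiling} (h : EntersAt a b k lam D)
    (h' : EntersAt a b k lam' D) (ha : a ≤ k) (hlam : ∀ r c, (r, c) ∈ lam → a + r ≤ k)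
    (hlam' : ∀ r c, (r, c) ∈ lam' → a + r ≤ k) (hb : k + lam.rowLen 0 ≤ b) : lam = lam' := by
  have hlt : ∀ (mu : YoungDiagram) (s t : ℕ), s < t →
      k - t + mu.rowLen t < k - s + mu.rowLen s := by
    intro mu s t hst
    have := mu.rowLen_anti s t hst.le
    omega
  have hinj : ∀ (mu : YoungDiagram) (s t : ℕ), k - t + mu.rowLen t = k - s + mu.rowLen s →
      s = t := by
    intro mu s t hst
    rcases lt_trichotomy s t with h1 | h1 | h1
    · have := hlt mu s t h1; omega
    · exact h1
    · have := hlt mu t s h1; omega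
  have hbd : ∀ s : ℕ, k - s + lam.rowLen s ≤ b := by
    intro s
    have := lam.rowLen_anti 0 s (Nat.zero_le s)
    omega
  -- The columns `k - s + lam.rowLen s` decrease strictly in `s`, so the two sets are compared from
  -- the last row, that is, from the smallest column on. Only `lam` is known to fit into the grid;
  -- the column of `lam'` for row `s` turns out to be at most that of `lam`, hence is inside too and
  -- can be compared in the other direction.
  have key : ∀ n s : ℕ, (k - a).toNat - s = n → a + s ≤ k → lam.rowLen s = lam'.rowLen s := by
    intro n
    induction n using Nat.strong_induction_on with
    | _ n ih =>
      intro s hn hs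
      have ih' : ∀ t : ℕ, s < t → a + t ≤ k → lam.rowLen t = lam'.rowLen t := fun t ht ht' =>
        ih _ (by omega) t rfl ht'
      obtain ⟨t, ht, ht'⟩ := (h' _ (by omega) (hbd s)).1
        ((h _ (by omega) (hbd s)).2 ⟨s, hs, rfl⟩)
      have hts : t ≤ s := by
        by_contra hc
        rw [← ih' t (by omega) ht] at ht'
        have := hinj _ _ _ ht'
        omega
      have h1 : k - s + lam'.rowLen s ≤ k - t + lam'.rowLen t := by
        rcases eq_or_lt_of_le hts with rfl | h1
        · exact le_rfl
        · exact (hlt _ _ _ h1).le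
      have hbs := hbd s
      obtain ⟨u, hu, hu'⟩ := (h (k - s + lam'.rowLen s) (by omega) (by omega)).1
        ((h' _ (by omega) (by omega)).2 ⟨s, hs, rfl⟩)
      have hus : u ≤ s := by
        by_contra hc
        rw [ih' u (by omega) hu] at hu'
        have := hinj _ _ _ hu'
        omega
      have h2 : k - s + lam.rowLen s ≤ k - u + lam.rowLen u := by
        rcases eq_or_lt_of_le hus with rfl | h1
        · exact le_rfl
        · exact (hlt _ _ _ h1).le
      omega
  ext ⟨r, c⟩
  rw [YoungDiagram.mem_cells, YoungDiagram.mem_cells]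
  constructor
  · intro hm
    have := hlam r c hm
    rw [YoungDiagram.mem_iff_lt_rowLen] at hm ⊢
    rwa [← key _ r rfl this]
  · intro hm
    have := hlam' r c hm
    rw [YoungDiagram.mem_iff_lt_rowLen] at hm ⊢
    rwa [key _ r rfl this]

/-- Every partition in the rectangle is the partition of a Grassmannian permutation. -/
theorem exists_isShapeOf (ha : a ≤ k) (hlam : ∀ r c, (r, c) ∈ lam → a + r ≤ k)
    (hb : k + lam.rowLen 0 ≤ b) : ∃ w, IsGrassmannian a b k w ∧ IsShapeOf a k w lam := by
  have hcol : ∀ c, (lam.colLen c : ℤ) ≤ k - a + 1 := by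
    intro c
    by_contra hc
    have := hlam (k - a + 1).toNat c (YoungDiagram.mem_iff_lt_colLen.2 (by omega))
    omega
  have hrow0 : ∀ i, i < a → lam.rowLen (k - i).toNat = 0 := by
    intro i hi
    by_contra hc
    have := hlam (k - i).toNat 0 (YoungDiagram.mem_iff_lt_rowLen.2 (by omega))
    omega
  have hcol0 : ∀ i, b < i → lam.colLen (i - k - 1).toNat = 0 := by
    intro i hi
    by_contra hc
    have h1 : (0, (i - k - 1).toNat) ∈ lam := YoungDiagram.mem_iff_lt_colLen.2 (by omega)
    rw [YoungDiagram.mem_iff_lt_rowLen] at h1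
    omega
  -- The two formulas read the boundary path of the diagram: row lengths give the values up to `k`,
  -- and column lengths those beyond `k`. It is the identity outside of `[a, b]`.
  let f : ℤ → ℤ := fun i => if i ≤ k then i + lam.rowLen (k - i).toNat
    else i - lam.colLen (i - k - 1).toNat
  have f1 : ∀ i, i ≤ k → f i = i + lam.rowLen (k - i).toNat := fun i hi => if_pos hi
  have f2 : ∀ i, k < i → f i = i - lam.colLen (i - k - 1).toNat := fun i hi =>
    if_neg (not_le.2 hi)
  have hmono1 : ∀ i j, i < j → j ≤ k → f i < f j := by
    intro i j hij hj
    rw [f1 i (by omega), f1 j hj]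
    have := lam.rowLen_anti (k - j).toNat (k - i).toNat (by omega)
    omega
  have hmono2 : ∀ i j, k < i → i < j → f i < f j := by
    intro i j hi hij
    rw [f2 i hi, f2 j (by omega)]
    have := lam.colLen_anti (i - k - 1).toNat (j - k - 1).toNat (by omega)
    omega
  have hne : ∀ i j, i ≤ k → k < j → f i ≠ f j := by
    intro i j hi hj
    rw [f1 i hi, f2 j hj]
    -- The pair `(i, j)` belongs to a box in row `k - i` and column `j - k - 1`: if the box is in
    -- `lam`, then `f i > f j`, and otherwise `f i < f j`.
    by_cases hm : ((k - i).toNat, (j - k - 1).toNat) ∈ lam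
    · have h1 := YoungDiagram.mem_iff_lt_rowLen.1 hm
      have h2 := YoungDiagram.mem_iff_lt_colLen.1 hm
      omega
    · have h1 := mt YoungDiagram.mem_iff_lt_rowLen.2 hm
      have h2 := mt YoungDiagram.mem_iff_lt_colLen.2 hm
      omega
  have hinj : Function.Injective f := by
    intro i j hij
    by_contra hc
    rcases lt_or_gt_of_ne hc with h1 | h1
    · by_cases h2 : j ≤ k
      · have := hmono1 i j h1 h2; omega
      · by_cases h3 : i ≤ k
        · exact hne i j h3 (by omega) hij
        · have := hmono2 i j (by omega) h1; omega
    · by_cases h2 : i ≤ k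
      · have := hmono1 j i h1 h2; omega
      · by_cases h3 : j ≤ k
        · exact hne j i h3 (by omega) hij.symm
        · have := hmono2 j i (by omega) h1; omega
  have hout : ∀ i, ¬ (a ≤ i ∧ i ≤ b) → f i = i := by
    intro i hi
    by_cases h1 : i < a
    · rw [f1 i (by omega), hrow0 i h1]; simp
    · rw [f2 i (by omega), hcol0 i (by omega)]; simp
  have hmaps : ∀ i, a ≤ i → i ≤ b → a ≤ f i ∧ f i ≤ b := by
    intro i hi hi'
    by_cases h1 : i ≤ k
    · have := lam.rowLen_anti 0 (k - i).toNat (Nat.zero_le _)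
      rw [f1 i h1]; omega
    · have := hcol (i - k - 1).toNat
      rw [f2 i (by omega)]; omega
  have hsurj : Function.Surjective f := by
    intro j
    by_cases hj : a ≤ j ∧ j ≤ b
    · have := Finset.surjOn_of_injOn_of_card_le (s := Finset.Icc a b) (t := Finset.Icc a b) f
        (fun i hi => by
          simp only [Finset.coe_Icc, Set.mem_Icc] at hi ⊢
          exact hmaps i hi.1 hi.2) hinj.injOn le_rfl
      obtain ⟨i, -, hi⟩ := this (by simpa using hj : j ∈ (↑(Finset.Icc a b) : Set ℤ))
      exact ⟨i, hi⟩
    · exact ⟨j, hout j hj⟩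
  have hbij : Function.Bijective f := ⟨hinj, hsurj⟩
  refine ⟨Equiv.ofBijective f hbij, ⟨hout, fun i hi hi' hik => ?_⟩, fun r c => ?_⟩
  · simp only [Equiv.ofBijective_apply]
    by_cases h1 : i + 1 ≤ k
    · exact hmono1 _ _ (by omega) h1
    · exact hmono2 _ _ (by omega) (by omega)
  · simp only [Equiv.ofBijective_apply]
    rw [f1 _ (by omega), show (k - (k - (r : ℤ))).toNat = r by omega]
    constructor
    · intro hm
      have := hlam r c hm
      rw [YoungDiagram.mem_iff_lt_rowLen] at hm
      omega
    · rintro ⟨h1, h2⟩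
      rw [YoungDiagram.mem_iff_lt_rowLen]; omega

end Shape

/-! ### The Rothe tiling -/

open Classical in
/-- The tiling in which each pipe turns only once. -/
noncomputable def rothe (a b : ℤ) (w : Equiv.Perm ℤ) : Tiling := fun p =>
  if InGrid a b p then
    if w p.1 = p.2 then .are
    else if w p.1 < p.2 then (if w.symm p.2 < p.1 then .cross else .horiz)
    else (if w.symm p.2 < p.1 then .vert else .blank)
  else .blank

theorem rothe_edges {a b : ℤ} (w : Equiv.Perm ℤ) {i j : ℤ} (hg : InGrid a b (i, j)) :
    ((rothe a b w (i, j)).north = true ↔ w.symm j < i) ∧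
    ((rothe a b w (i, j)).south = true ↔ w.symm j ≤ i) ∧
    ((rothe a b w (i, j)).west = true ↔ w i < j) ∧
    ((rothe a b w (i, j)).east = true ↔ w i ≤ j) := by
  have h1 : w i = j ↔ w.symm j = i := by rw [Equiv.symm_apply_eq]; exact eq_comm
  simp only [rothe, if_pos hg]
  split_ifs with h2 h3 h4 h4 <;> simp only [Tile.north, Tile.south, Tile.east, Tile.west] <;>
    simp only [h1] at h2 <;> grind

/-- In the Rothe tiling, a cross at `(i, j)` requires an earlier row with the larger value `j`, and
a blank tile a later row with the smaller value `j`. The former is impossible for `i ≤ k`, the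
latter for `i > k`. -/
theorem IsGrassmannian.rothe {a b k : ℤ} {w : Equiv.Perm ℤ} (hw : IsGrassmannian a b k w)
    (ha : a ≤ k) : IsGrassTiling a b k (rothe a b w) := by
  refine ⟨⟨fun p hp => by simp [Taquin.rothe, hp], fun i j h1 h2 h3 h4 => ?_,
    fun i j h1 h2 h3 h4 => ?_, fun t h1 h2 => ⟨?_, ?_, ?_, ?_⟩⟩, fun i j hi hc => ?_,
    fun i j h1 h2 h3 h4 => ?_⟩
  · have e1 := rothe_edges (a := a) (b := b) w (i := i) (j := j) ⟨⟨h1, h2.le⟩, h3, h4⟩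
    have e2 := rothe_edges (a := a) (b := b) w (i := i + 1) (j := j)
      ⟨⟨by simp only; omega, h2⟩, h3, h4⟩
    rw [Bool.eq_iff_iff, e1.2.1, e2.1]; omega
  · have e1 := rothe_edges (a := a) (b := b) w (i := i) (j := j) ⟨⟨h1, h2⟩, h3, h4.le⟩
    have e2 := rothe_edges (a := a) (b := b) w (i := i) (j := j + 1)
      ⟨⟨h1, h2⟩, by simp only; omega, h4⟩
    rw [Bool.eq_iff_iff, e1.2.2.2, e2.2.2.1]; omega
  · rw [Bool.eq_false_iff, Ne, (rothe_edges w ⟨⟨le_rfl, h1.trans h2⟩, h1, h2⟩).1]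
    have := (hw.symm_mem h1 h2).1; omega
  · rw [Bool.eq_false_iff, Ne, (rothe_edges w ⟨⟨h1, h2⟩, le_rfl, h1.trans h2⟩).2.2.1]
    have := (hw.mem h1 h2).1; omega
  · rw [(rothe_edges w ⟨⟨h1.trans h2, le_rfl⟩, h1, h2⟩).2.1]
    exact (hw.symm_mem h1 h2).2
  · rw [(rothe_edges w ⟨⟨h1, h2⟩, h1.trans h2, le_rfl⟩).2.2.2]
    exact (hw.mem h1 h2).2
  · by_cases hg : InGrid a b (i, j)
    · have e := rothe_edges w hg
      rw [hc] at e
      have e1 := e.1.1 rfl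
      have e2 := e.2.2.1.1 rfl
      have h5 := (hw.symm_mem hg.2.1 hg.2.2).1
      have := hw.lt_of_avoid h5 e1 hg.1.2 (Or.inl hi)
      rw [Equiv.apply_symm_apply] at this
      omega
    · simp [Taquin.rothe, hg] at hc
  · have hg : InGrid a b (i, j) := ⟨⟨by simp only; omega, h2⟩, h3, h4⟩
    have e := rothe_edges w hg
    have hlt := hw.symm_lt (i := i) (j := j) (by omega) h1 h2 h3
    constructor
    · intro hc
      rw [hc] at e
      simp only [Tile.north, Tile.east, Bool.false_eq_true, false_iff] at e
      omega
    · simp only [Taquin.rothe, if_pos hg]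
      split_ifs <;> simp

/-! ### The correspondence of tilings and tableaux -/

section Tableau

variable {a b k : ℤ} {D : Tiling} {lam : YoungDiagram} {S : Filling}

theorem IsGrassTiling.exists_blanksAt (hD : IsGrassTiling a b k D) (ha : a ≤ k) (hk : k ≤ b) :
    ∃ lam S, IsSSYT lam ⊥ a k S ∧ BlanksAt a b S D ∧ EntersAt a b k lam D := by
  obtain ⟨F, h1, -, h2⟩ := IsGrassTiling.exists_droops (X := (D, id)) hD
  obtain ⟨lam, S, hS, hb, he, -, -⟩ := IsGrassTiling.exists_tableau ha hk (X := (D, id)) hD h1 h2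
  exact ⟨lam, S, hS, hb, he⟩

/-- The tableau found by drooping has the same blank positions as `S`, so it is `S`; its shape,
which is read off from row `k`, is therefore `lam`. -/
theorem IsGrassTiling.entersAt_of_blanksAt (hD : IsGrassTiling a b k D) (ha : a ≤ k) (hk : k ≤ b)
    {lo hi : ℤ} (hS : IsSSYT lam ⊥ lo hi S) (hb : BlanksAt a b S D) : EntersAt a b k lam D := by
  obtain ⟨lam', S', hS', hb', he⟩ := hD.exists_blanksAt ha hk
  obtain rfl : S = S' := hS.eq_of_tilePos hS' fun p => (hb p).symm.trans (hb' p)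
  obtain rfl := hS.shape_unique hS'
  exact he

theorem BlanksAt.tiling_unique {D' : Tiling} (hD : IsGrassTiling a b k D)
    (hD' : IsGrassTiling a b k D') (h : BlanksAt a b S D) (h' : BlanksAt a b S D') : D = D' :=
  hD.eq_of_blank hD' fun p hp => by
    have h1 := (h p).trans (h' p).symm
    tauto

theorem IsSSYT.row_le (hS : IsSSYT lam ⊥ a k S) (r c : ℕ) (hm : (r, c) ∈ lam) : a + r ≤ k := by
  obtain ⟨x, hx⟩ := hS.exists_eq hm
  have := hS.lo_add_le hx
  have := (hS.bounds _ _ hx).2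
  omega

theorem IsGrassTiling.lt_of_blank (hD : IsGrassTiling a b k D) {i j : ℤ}
    (hg : InGrid a b (i, j)) (hb : D (i, j) = .blank) : i < b ∧ j < b := by
  obtain ⟨⟨g1, g2⟩, g3, g4⟩ := hg
  simp only at g1 g2 g3 g4
  constructor
  · refine lt_of_le_of_ne g2 ?_
    rintro rfl
    have := (hD.border j g3 g4).2.2.1
    rw [hb] at this; simp [Tile.south] at this
  · refine lt_of_le_of_ne g4 ?_
    rintro rfl
    have := (hD.border i g1 g2).2.2.2
    rw [hb] at this; simp [Tile.east] at this

theorem Tile.south_of_blank_left {t : Tile} (h : t ≠ .blank) (hw : t.west = false) :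
    t.south = true := by
  cases t <;> simp_all [Tile.south, Tile.west]

theorem Tile.east_of_blank_above {t : Tile} (h : t ≠ .blank) (hn : t.north = false) :
    t.east = true := by
  cases t <;> simp_all [Tile.east, Tile.north]

theorem Tile.eq_jay {t : Tile} (hn : t.north = true) (hw : t.west = true) (h : t ≠ .cross) :
    t = .jay := by
  cases t <;> simp_all [Tile.west, Tile.north]

/-- The tiles next to an entry of the tableau that can be increased. -/
theorem IsGrassTiling.jay_of_blank (hD : IsGrassTiling a b k D) {i j : ℤ}
    (hg : InGrid a b (i, j)) (hb : D (i, j) = .blank) (hi : i < k)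
    (hright : D (i, j + 1) ≠ .blank) (hbelow : D (i + 1, j) ≠ .blank) :
    D (i + 1, j + 1) = .jay := by
  obtain ⟨hib, hjb⟩ := hD.lt_of_blank hg hb
  obtain ⟨⟨g1, g2⟩, g3, g4⟩ := hg
  simp only at g1 g2 g3 g4
  have v1 := hD.vertical i (j + 1) g1 (by omega) (by omega) hjb
  have v2 := hD.vertical i j g1 (by omega) g3 g4
  have e1 := hD.horizontal i j g1 g2 g3 hjb
  have e2 := hD.horizontal (i + 1) j (by omega) (by omega) g3 hjb
  rw [hb] at e1 v2
  rw [Tile.south_of_blank_left hright e1.symm] at v1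
  rw [Tile.east_of_blank_above hbelow v2.symm] at e2
  exact Tile.eq_jay v1.symm e2.symm (hD.top _ _ (by omega))

/-- A blank tile at `(i, j + 1)` belongs to an entry `i` on the next diagonal. Since entries
increase strictly along columns and diagonals, only the box `(r, c + 1)` is possible. This turns the
comparisons of entries in the algorithm into questions about tiles. -/
theorem BlanksAt.right_iff {lo hi : ℤ} (hb : BlanksAt a b S D) (hS : IsSSYT lam ⊥ lo hi S)
    {r c : ℕ} {i j : ℤ} (hp : tilePos S (r, c) = some (i, j)) (hj : j < b) :
    D (i, j + 1) = .blank ↔ S (r, c + 1) = some i := by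
  obtain ⟨h1, h2⟩ := tilePos_eq_some.1 hp
  obtain ⟨⟨⟨g1, g2⟩, g3, g4⟩, -⟩ := (hb _).2 ⟨_, hp⟩
  simp only at h1 h2 g1 g2 g3 g4
  constructor
  · intro h0
    obtain ⟨⟨r', c'⟩, hq⟩ := (hb (i, j + 1)).1 ⟨⟨⟨g1, g2⟩, by simp only; omega, hj⟩, h0⟩
    obtain ⟨h3, h4⟩ := tilePos_eq_some.1 hq
    simp only at h3 h4
    rcases lt_trichotomy r r' with h5 | h5 | h5
    · have := hS.le_of_le h5.le (by omega) h1 h3; omega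
    · subst h5
      obtain rfl : c' = c + 1 := by omega
      exact h3
    · have := hS.le_of_le h5.le (by omega) h3 h1; omega
  · intro h0
    exact ((hb (i, j + 1)).2 ⟨(r, c + 1), tilePos_eq_some.2 ⟨h0, by
      simp only; push_cast; omega⟩⟩).2

theorem BlanksAt.below_iff {lo hi : ℤ} (hb : BlanksAt a b S D) (hS : IsSSYT lam ⊥ lo hi S)
    {r c : ℕ} {i j : ℤ} (hp : tilePos S (r, c) = some (i, j)) (hi' : i < b) :
    D (i + 1, j) = .blank ↔ S (r + 1, c) = some (i + 1) := by
  obtain ⟨h1, h2⟩ := tilePos_eq_some.1 hp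
  obtain ⟨⟨⟨g1, g2⟩, g3, g4⟩, -⟩ := (hb _).2 ⟨_, hp⟩
  simp only at h1 h2 g1 g2 g3 g4
  constructor
  · intro h0
    obtain ⟨⟨r', c'⟩, hq⟩ := (hb (i + 1, j)).1
      ⟨⟨⟨by simp only; omega, by simp only; omega⟩, g3, g4⟩, h0⟩
    obtain ⟨h3, h4⟩ := tilePos_eq_some.1 hq
    simp only at h3 h4
    rcases lt_trichotomy (r + 1) r' with h5 | h5 | h5
    · have := hS.le_of_le (by omega) (by omega) h1 h3; omega
    · subst h5
      obtain rfl : c' = c := by push_cast at h4; omega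
      exact h3
    · have := hS.le_of_le (by omega : r' ≤ r) (by omega) h3 h1; omega
  · intro h0
    exact ((hb (i + 1, j)).2 ⟨(r + 1, c), tilePos_eq_some.2 ⟨h0, by
      simp only; push_cast; omega⟩⟩).2

/-- An entry of the tableau of a tiling can be increased. -/
theorem IsGrassTiling.exists_increment (hD : IsGrassTiling a b k D)
    (hb : BlanksAt a b S D) (hS : IsSSYT lam ⊥ a k S) {r c : ℕ} {x : ℤ} (hx : S (r, c) = some x)
    (hxk : x < k) (hright : S (r, c + 1) ≠ some x) (hbelow : S (r + 1, c) ≠ some (x + 1)) :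
    ∃ D', IsGrassTiling a b k D' ∧
      BlanksAt a b (Function.update S (r, c) (some (x + 1))) D' := by
  have hpos : tilePos S (r, c) = some (x, x + c - r) := tilePos_eq_some.2 ⟨hx, rfl⟩
  generalize x + (c : ℤ) - r = j at hpos
  obtain ⟨hg, hbl⟩ := (hb _).2 ⟨_, hpos⟩
  obtain ⟨hib, hjb⟩ := hD.lt_of_blank hg hbl
  have hjay := hD.jay_of_blank hg hbl hxk (mt (hb.right_iff hS hpos hjb).1 hright)
    (mt (hb.below_iff hS hpos hib).1 hbelow)
  obtain ⟨D', hflip⟩ := hD.exists_unflip hg.1.1 hg.2.1 hib hjb hbl hjay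
  have hg' : InGrid a b (x + 1, j + 1) := by
    simp only [InGrid] at hg ⊢; omega
  exact ⟨D', (hflip.isGrassTiling_iff hg hg').2 hD, hflip.blanksAt hg' hS hb hpos⟩

/-- The Rothe tiling of the permutation of `lam` is drooped as far as possible. The final blank
tiles form some diagram, which is `lam` because droops do not change the lower edges of row `k`. -/
theorem exists_tiling_minTableau (ha : a ≤ k) (hrow : ∀ r c, (r, c) ∈ lam → a + r ≤ k)
    (hb : k + lam.rowLen 0 ≤ b) :
    ∃ D, IsGrassTiling a b k D ∧ BlanksAt a b (minTableau a lam) D := by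
  have hk : k ≤ b := by omega
  obtain ⟨w, hw, hsh⟩ := exists_isShapeOf ha hrow hb
  have hR := hw.rothe ha
  obtain ⟨F, h1, hF, h2⟩ := IsGrassTiling.exists_droops (X := (rothe a b w, id)) hR
  obtain ⟨lam', S', hS', -, he, hlam, -⟩ :=
    IsGrassTiling.exists_tableau ha hk (X := (rothe a b w, id)) hR h1 h2
  have he' : EntersAt a b k lam (rothe a b w) := (hsh.entersAt_iff hw hk).2 fun j hj hj' =>
    (rothe_edges w ⟨⟨ha, hk⟩, hj, hj'⟩).2.1
  obtain rfl : lam = lam' := he'.shape_eq he ha hrow hS'.row_le hb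
  exact ⟨F.1, hF, (hF.minTableau hlam).2⟩

/-- Every tableau comes from a tiling. -/
theorem IsSSYT.exists_tiling (hS : IsSSYT lam ⊥ a k S) (ha : a ≤ k)
    (hb : k + lam.rowLen 0 ≤ b) : ∃ D, IsGrassTiling a b k D ∧ BlanksAt a b S D := by
  have hbase := exists_tiling_minTableau ha hS.row_le hb
  have key : ∀ n : ℕ, ∀ S, IsSSYT lam ⊥ a k S →
      ∑ q ∈ lam.cells, ((S q).getD a - a).toNat = n →
      ∃ D, IsGrassTiling a b k D ∧ BlanksAt a b S D := by
    intro n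
    induction n using Nat.strong_induction_on with
    | _ n ih =>
      intro S hS hn
      by_cases hmin : ∀ r c x, S (r, c) = some x → x = a + r
      · have : S = minTableau a lam := by
          funext ⟨r, c⟩
          ext x
          rw [minTableau_eq_some]
          constructor
          · exact fun h0 => ⟨hS.mem_of_eq h0, hmin _ _ _ h0⟩
          · rintro ⟨h0, rfl⟩
            obtain ⟨x, hx⟩ := hS.exists_eq h0
            rw [hx, hmin _ _ _ hx]
        rw [this]; exact hbase
      · push Not at hmin
        -- Among the entries that are not minimal, one is taken with `r + c` least. Its left and
        -- upper neighbors are minimal, so it can be decreased by 1; the tiling of the smaller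
        -- tableau is then undrooped once.
        have hex : ∃ m r c x, r + c = m ∧ S (r, c) = some x ∧ x ≠ a + r := by
          obtain ⟨r, c, x, h1, h2⟩ := hmin
          exact ⟨_, r, c, x, rfl, h1, h2⟩
        classical
        obtain ⟨r, c, x, hm, hx, hne⟩ := Nat.find_spec hex
        have hleast : ∀ r' c' y, r' + c' < r + c → S (r', c') = some y → y = a + r' := by
          intro r' c' y hlt hy
          by_contra hc
          exact Nat.find_min hex (by omega) ⟨r', c', y, rfl, hy, hc⟩
        have hgt : a + r < x := lt_of_le_of_ne (hS.lo_add_le hx) (Ne.symm hne)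
        have hmem := hS.mem_of_eq hx
        have hxk := (hS.bounds _ _ hx).2
        obtain ⟨S₁, hS₁def⟩ : ∃ S₁, S₁ = Function.update S (r, c) (some (x - 1)) := ⟨_, rfl⟩
        have hS₁ : IsSSYT lam ⊥ a k S₁ := by
          rw [hS₁def]
          refine hS.update hmem (by omega) (by omega) ?_ ?_ ?_ ?_
          · rintro c' y rfl hy
            have := hleast _ _ _ (by omega) hy; omega
          · intro y hy
            have := hS.row_weak _ _ _ _ hx hy; omega
          · rintro r' y rfl hy
            have := hleast _ _ _ (by omega) hy
            push_cast at hgt; omega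
          · intro y hy
            have := hS.col_strict _ _ _ _ hx hy; omega
        have hlt : ∑ q ∈ lam.cells, ((S₁ q).getD a - a).toNat < n := by
          rw [← hn, hS₁def]
          refine Finset.sum_lt_sum (fun q _ => ?_) ⟨(r, c), (YoungDiagram.mem_cells _).2 hmem, ?_⟩
          · by_cases hq : q = (r, c)
            · subst hq; simp only [Function.update_self, hx, Option.getD_some]; omega
            · simp only [Function.update_of_ne hq, le_refl]
          · simp only [Function.update_self, hx, Option.getD_some]; omega
        obtain ⟨D₁, hD₁, hb₁⟩ := ih _ hlt S₁ hS₁ rfl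
        have hSS : S = Function.update S₁ (r, c) (some (x - 1 + 1)) := by
          rw [hS₁def, Function.update_idem, sub_add_cancel, ← hx, Function.update_eq_self]
        rw [hSS]
        refine hD₁.exists_increment hb₁ hS₁ (by rw [hS₁def, Function.update_self])
          (by omega) (fun h0 => ?_) (fun h0 => ?_)
        · rw [hS₁def, Function.update_apply, if_neg (by simp)] at h0
          have := hS.row_weak _ _ _ _ hx h0; omega
        · rw [hS₁def, Function.update_apply, if_neg (by simp)] at h0
          have := hS.col_strict _ _ _ _ hx h0; omega
  exact key _ S hS rfl

/-- The bumpless pipe dream of a tableau. -/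
theorem IsGrassTiling.isBPD_of_shape {w : Equiv.Perm ℤ} (hD : IsGrassTiling a b k D)
    (hS : IsSSYT lam ⊥ a k S) (hb : BlanksAt a b S D) (ha : a ≤ k) (hk : k ≤ b)
    (hw : IsGrassmannian a b k w) (hsh : IsShapeOf a k w lam) : IsBPD a b w D :=
  hD.isBPD hw ha hk ((hsh.entersAt_iff hw hk).1 (hD.entersAt_of_blanksAt ha hk hS hb))

/-- The straight pipes below row `k` give the columns in which pipes enter row `k` in terms of `w`,
hence the shape of the tableau is the partition of `w`. -/
theorem IsBPD.exists_tableau {w : Equiv.Perm ℤ} (hD : IsBPD a b w D) (ha : a ≤ k) (hk : k ≤ b)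
    (hw : IsGrassmannian a b k w) (hsh : IsShapeOf a k w lam) :
    ∃ S, IsSSYT lam ⊥ a k S ∧ BlanksAt a b S D := by
  have hG := hD.isGrassTiling hw ha hk
  obtain ⟨lam', S, hS, hb, he⟩ := hG.exists_blanksAt ha hk
  have he' : EntersAt a b k lam D := (hsh.entersAt_iff hw hk).2 fun j hj hj' =>
    ((hD.below hw ha hk).1 k le_rfl hk j hj hj').1
  obtain rfl : lam = lam' := he'.shape_eq he ha (fun r c => hsh.row_le) hS.row_le
    (hsh.rowLen_le hw hk ha)
  exact ⟨S, hS, hb⟩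

end Tableau

/-- The bijection between bumpless pipe dreams and semistandard tableaux. -/
theorem bpd_tableau_bijection {a b k : ℤ} (ha : a ≤ k) (hk : k ≤ b) {w : Equiv.Perm ℤ}
    {lam : YoungDiagram} (hw : IsGrassmannian a b k w) (hsh : IsShapeOf a k w lam) :
    (∀ D, IsBPD a b w D →
      ∃ S, IsSSYT lam ⊥ a k S ∧ ∀ S', IsTableauOf a b D S' ↔ S' = S) ∧
    (∀ S, IsSSYT lam ⊥ a k S → ∃! D, IsBPD a b w D ∧ IsTableauOf a b D S) := by
  refine ⟨fun D hD => ?_, fun S hS => ?_⟩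
  · obtain ⟨S, hS, hb⟩ := hD.exists_tableau ha hk hw hsh
    exact ⟨S, hS, (hD.isGrassTiling hw ha hk).isTableauOf_iff ha hk hS hb⟩
  · obtain ⟨D, hD, hb⟩ := hS.exists_tiling ha (hsh.rowLen_le hw hk ha)
    refine ⟨D, ⟨hD.isBPD_of_shape hS hb ha hk hw hsh, (hD.isTableauOf_iff ha hk hS hb S).2 rfl⟩,
      ?_⟩
    rintro D' ⟨hD', hT⟩
    have hG' := hD'.isGrassTiling hw ha hk
    obtain ⟨S', hS', hb'⟩ := hD'.exists_tableau ha hk hw hsh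
    obtain rfl := (hG'.isTableauOf_iff ha hk hS' hb' S).1 hT
    exact BlanksAt.tiling_unique hG' hD hb' hb

/-! ### Incrementing a column -/

/-- The entries `x, x + 1, …, x + m` in the boxes `(r, c), …, (r + m, c)` are incremented. -/
def bump (E : Filling) (r c : ℕ) (x : ℤ) (m : ℕ) : Filling := fun q =>
  if q.2 = c ∧ r ≤ q.1 ∧ q.1 ≤ r + m then some (x + (q.1 - r) + 1) else E q

theorem bump_of_ne {E : Filling} {r c : ℕ} {x : ℤ} {m : ℕ} {q : ℕ × ℕ}
    (h : ¬ (q.2 = c ∧ r ≤ q.1 ∧ q.1 ≤ r + m)) : bump E r c x m q = E q := if_neg h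

theorem bump_add {E : Filling} {r c : ℕ} {x : ℤ} {m t : ℕ} (h : t ≤ m) :
    bump E r c x m (r + t, c) = some (x + t + 1) := by
  rw [bump, if_pos ⟨rfl, by simp only; omega, by simp only; omega⟩]
  simp only [Nat.cast_add, Option.some.injEq]; ring

theorem bump_zero (E : Filling) (r c : ℕ) (x : ℤ) :
    bump E r c x 0 = Function.update E (r, c) (some (x + 1)) := by
  funext ⟨r', c'⟩
  by_cases h : (r', c') = (r, c)
  · rw [h, Function.update_self]
    simpa using bump_add (E := E) (r := r) (c := c) (x := x) (le_refl 0)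
  · rw [Function.update_of_ne h, bump_of_ne]
    simp only [Prod.mk.injEq] at h ⊢; omega

theorem bump_succ (E : Filling) (r c : ℕ) (x : ℤ) (m : ℕ) : bump E r c x (m + 1) =
    Function.update (bump E r c x m) (r + (m + 1), c) (some (x + (m + 1 : ℕ) + 1)) := by
  funext ⟨r', c'⟩
  by_cases h : (r', c') = (r + (m + 1), c)
  · rw [h, Function.update_self, bump_add le_rfl]
  · rw [Function.update_of_ne h]
    simp only [Prod.mk.injEq] at h
    simp only [bump]
    congr 1
    rw [eq_iff_iff]; omega

/-- The recursion `bump_succ` follows the algorithm downwards; this one starts with the lowest box,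
and is used to see that all intermediate tableaux are semistandard. -/
theorem bump_succ' (E : Filling) (r c : ℕ) (x : ℤ) (m : ℕ) : bump E r c x (m + 1) =
    Function.update (bump E (r + 1) c (x + 1) m) (r, c) (some (x + 1)) := by
  funext ⟨r', c'⟩
  by_cases h : (r', c') = (r, c)
  · rw [h, Function.update_self]
    simpa using bump_add (E := E) (r := r) (c := c) (x := x) (Nat.zero_le (m + 1))
  · rw [Function.update_of_ne h]
    simp only [Prod.mk.injEq] at h
    simp only [bump]
    by_cases h2 : c' = c ∧ r + 1 ≤ r' ∧ r' ≤ r + 1 + m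
    · rw [if_pos h2, if_pos (by omega)]; push_cast; congr 1; ring
    · rw [if_neg h2, if_neg (by omega)]

/-- The column of entries that will be incremented. -/
structure IsBumpable (E : Filling) (r c : ℕ) (x : ℤ) (m : ℕ) : Prop where
  col : ∀ t ≤ m, E (r + t, c) = some (x + t)
  next_ne : E (r + (m + 1), c) ≠ some (x + (m + 1 : ℕ))

theorem IsBumpable.head {E : Filling} {r c : ℕ} {x : ℤ} {m : ℕ} (h : IsBumpable E r c x m) :
    E (r, c) = some x := by simpa using h.col 0 (Nat.zero_le m)

/-- The mark moves from `x + t + 1` to the box below exactly if the latter contained `x + t + 1`. So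
the pushes follow the run `x, x + 1, …` of consecutive numbers in the column and end with it. -/
theorem incrementPush_iff {E E' : Filling} {r c : ℕ} {p : ℕ × ℕ} :
    IncrementPush E (r, c) E' p ↔
      ∃ x m, IsBumpable E r c x m ∧ p = (r + m, c) ∧ E' = bump E r c x m := by
  constructor
  · rintro ⟨x, hx, hch, hend⟩
    have key : ∀ X, Relation.ReflTransGen PushDown
        (Function.update E (r, c) (some (x + 1)), (r, c)) X →
        ∃ m : ℕ, (∀ t ≤ m, E (r + t, c) = some (x + t)) ∧ X = (bump E r c x m, (r + m, c)) := by
      intro X hX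
      induction hX with
      | refl =>
        refine ⟨0, fun t ht => ?_, by rw [bump_zero]; rfl⟩
        obtain rfl : t = 0 := by omega
        simpa using hx
      | tail _ h2 ih =>
        obtain ⟨m, hm, rfl⟩ := ih
        generalize hY : (bump E r c x m, (r + m, c)) = Y at h2
        cases h2 with
        | mk E₀ r₀ c₀ y h h' =>
          simp only [Prod.mk.injEq] at hY
          obtain ⟨rfl, rfl, rfl⟩ := hY
          rw [bump_add le_rfl] at h
          simp only [Option.some.injEq] at h
          have h0 : bump E r c x m (r + m + 1, c) = E (r + m + 1, c) :=
            bump_of_ne (by simp only; omega)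
          rw [h0] at h'
          refine ⟨m + 1, fun t ht => ?_, ?_⟩
          · rcases Nat.lt_or_ge t (m + 1) with h3 | h3
            · exact hm t (by omega)
            · obtain rfl : t = m + 1 := by omega
              rw [← add_assoc, h', ← h]; push_cast; congr 1; ring
          · rw [bump_succ, ← h, ← add_assoc]
            push_cast
            rw [← add_assoc]
    obtain ⟨m, hm, hX⟩ := key _ hch
    simp only [Prod.mk.injEq] at hX
    obtain ⟨rfl, rfl⟩ := hX
    refine ⟨x, m, ⟨hm, fun h0 => hend ⟨_, PushDown.mk _ (r + m) c _ (bump_add le_rfl) ?_⟩⟩,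
      rfl, rfl⟩
    rw [bump_of_ne (by simp only; omega), add_assoc, h0]; push_cast; congr 1; ring
  · rintro ⟨x, m, hb, rfl, rfl⟩
    refine ⟨x, hb.head, ?_, ?_⟩
    · have key : ∀ n ≤ m, Relation.ReflTransGen PushDown
          (Function.update E (r, c) (some (x + 1)), (r, c)) (bump E r c x n, (r + n, c)) := by
        intro n
        induction n with
        | zero => intro _; rw [bump_zero]; exact .refl
        | succ n ih =>
          intro hn
          refine (ih (by omega)).tail ?_
          have := PushDown.mk (bump E r c x n) (r + n) c (x + n + 1) (bump_add le_rfl) (by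
            rw [bump_of_ne (by simp only; omega), add_assoc, hb.col (n + 1) hn]
            push_cast; congr 1; ring)
          rw [bump_succ, ← add_assoc]
          convert this using 4
          push_cast; ring
      exact key m le_rfl
    · rintro ⟨S, hS⟩
      generalize hY : (bump E r c x m, (r + m, c)) = Y at hS
      cases hS with
      | mk E₀ r₀ c₀ y h h' =>
        simp only [Prod.mk.injEq] at hY
        obtain ⟨rfl, rfl, rfl⟩ := hY
        rw [bump_add le_rfl] at h
        simp only [Option.some.injEq] at h
        rw [bump_of_ne (by simp only; omega), ← h] at h'
        apply hb.next_ne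
        rw [← add_assoc, h']; push_cast; congr 1; ring

namespace IsSSYT

variable {lam : YoungDiagram} {lo hi : ℤ} {E : Filling}

theorem exists_isBumpable (h : IsSSYT lam ⊥ lo hi E) {r c : ℕ} {x : ℤ} (hx : E (r, c) = some x) :
    ∃ m, IsBumpable E r c x m := by
  classical
  have hex : ∃ m : ℕ, E (r + (m + 1), c) ≠ some (x + (m + 1 : ℕ)) := by
    -- For this `m` the next entry of the run would be `hi + 1`.
    refine ⟨(hi - x).toNat, fun h0 => ?_⟩
    have := (h.bounds _ _ h0).2
    push_cast at this; omega
  refine ⟨Nat.find hex, fun t ht => ?_, Nat.find_spec hex⟩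
  rcases t with _ | t
  · simpa using hx
  · exact not_not.1 (Nat.find_min hex (by omega : t < Nat.find hex))

theorem mono_hi (h : IsSSYT lam ⊥ lo hi E) {hi' : ℤ} (hle : hi ≤ hi') : IsSSYT lam ⊥ lo hi' E :=
  ⟨h.shape, fun p x hx => ⟨(h.bounds p x hx).1, (h.bounds p x hx).2.trans hle⟩, h.row_weak,
    h.col_strict⟩

/-- The entries are increased from the bottom to the top, one unit at a time, so that columns remain
strict throughout. -/
theorem bump {r c : ℕ} {x : ℤ} {m : ℕ} (h : IsSSYT lam ⊥ lo hi E) (hb : IsBumpable E r c x m)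
    (hr : E (r, c + 1) ≠ some x) (hk : x + m < hi) : IsSSYT lam ⊥ lo hi (bump E r c x m) := by
  induction m generalizing r x with
  | zero =>
    rw [bump_zero]
    refine h.increment hb.head (by simpa using hk) hr ?_
    simpa using hb.next_ne
  | succ m ih =>
    have hb' : IsBumpable E (r + 1) c (x + 1) m := by
      refine ⟨fun t ht => ?_, ?_⟩
      · have := hb.col (t + 1) (by omega)
        rw [show r + 1 + t = r + (t + 1) by omega, this]; push_cast; congr 1; ring
      · have := hb.next_ne
        rw [show r + 1 + (m + 1) = r + (m + 1 + 1) by omega]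
        convert this using 2
        push_cast; ring
    -- The condition on the right neighbor passes down the column: an entry `x + 1` to the right in
    -- the next row would leave only `x` for the entry above it, which is excluded.
    have hr' : E (r + 1, c + 1) ≠ some (x + 1) := by
      intro h0
      obtain ⟨y, hy⟩ := h.exists_eq (lam.up_left_mem (Nat.le_succ r) le_rfl (h.mem_of_eq h0))
      have h1 := h.row_weak _ _ _ _ hb.head hy
      have h2 := h.col_strict _ _ _ _ hy h0
      exact hr (by rw [hy]; congr 1; omega)
    have hE := ih hb' hr' (by push_cast at hk; omega)
    rw [bump_succ']
    refine hE.increment ?_ (by push_cast at hk; omega) ?_ ?_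
    · rw [bump_of_ne (by simp only; omega), hb.head]
    · rwa [bump_of_ne (by simp only; omega)]
    · have := bump_add (E := E) (r := r + 1) (c := c) (x := x + 1) (Nat.zero_le m)
      rw [add_zero] at this
      rw [this]; simp

/-- The entries to the right of the incremented ones are large. -/
theorem lt_right {r c : ℕ} {x y : ℤ} (h : IsSSYT lam ⊥ lo hi E) (hx : E (r, c) = some x)
    (hr : E (r, c + 1) ≠ some x) {t : ℕ} (hy : E (r + t, c + 1) = some y) : x + t < y := by
  obtain ⟨z, hz⟩ := h.exists_eq (lam.up_left_mem (Nat.le_add_right r t) le_rfl (h.mem_of_eq hy))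
  have h1 := h.row_weak _ _ _ _ hx hz
  have h2 := h.le_of_col hz t hy
  have : z ≠ x := by rintro rfl; exact hr hz
  omega

/-- Deletion is decided by the number alone: if `x + m = hi`, then an entry below or to the right of
the lowest box of the run would exceed `hi`, so the box is on the SE border. -/
theorem deletable_iff {r c : ℕ} {x : ℤ} {m : ℕ} (h : IsSSYT lam ⊥ lo hi E)
    (hb : IsBumpable E r c x m) (hr : E (r, c + 1) ≠ some x) :
    Deletable hi (Taquin.bump E r c x m) (r + m, c) ↔ x + m = hi := by
  rw [Deletable, bump_add le_rfl]
  simp only [Option.some.injEq]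
  constructor
  · rintro ⟨h1, -⟩; omega
  · intro h1
    refine ⟨by omega, ?_, ?_⟩
    · rw [bump_of_ne (by simp only; omega)]
      cases hE : E (r + m + 1, c) with
      | none => rfl
      | some y =>
        have h2 := h.col_strict _ _ _ _ (hb.col m le_rfl) hE
        have h3 := (h.bounds _ _ hE).2
        omega
    · rw [bump_of_ne (by simp only; omega)]
      cases hE : E (r + m, c + 1) with
      | none => rfl
      | some y =>
        have h2 := h.lt_right hb.head hr hE
        have h3 := (h.bounds _ _ hE).2
        omega

end IsSSYT

/-! ### Young diagrams without a corner -/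

/-- Remove a corner of a Young diagram. -/
def eraseCorner (lam : YoungDiagram) (p : ℕ × ℕ) (hp : ∀ q ∈ lam, p ≤ q → q = p) :
    YoungDiagram where
  cells := lam.cells.erase p
  isLowerSet := by
    intro q q' hle hq
    simp only [Finset.coe_erase, Set.mem_sdiff, Finset.mem_coe, Set.mem_singleton_iff,
      YoungDiagram.mem_cells] at hq ⊢
    refine ⟨lam.isLowerSet hle hq.1, ?_⟩
    rintro rfl
    exact hq.2 (hp q hq.1 hle)

theorem mem_eraseCorner {lam : YoungDiagram} {p : ℕ × ℕ} {hp : ∀ q ∈ lam, p ≤ q → q = p}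
    {q : ℕ × ℕ} : q ∈ eraseCorner lam p hp ↔ q ≠ p ∧ q ∈ lam := by
  rw [← YoungDiagram.mem_cells]
  simp [eraseCorner]

theorem corner_of_notMem {lam : YoungDiagram} {r c : ℕ} (h1 : (r + 1, c) ∉ lam)
    (h2 : (r, c + 1) ∉ lam) : ∀ q ∈ lam, (r, c) ≤ q → q = (r, c) := by
  rintro ⟨r', c'⟩ hq hle
  obtain ⟨hr, hc⟩ := Prod.mk_le_mk.1 hle
  rw [Prod.mk.injEq]
  constructor
  · by_contra hne
    exact h1 (lam.up_left_mem (by omega) hc hq)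
  · by_contra hne
    exact h2 (lam.up_left_mem hr (by omega) hq)

theorem IsSSYT.erase {lam : YoungDiagram} {lo hi hi' : ℤ} {E : Filling} {p : ℕ × ℕ}
    (h : IsSSYT lam ⊥ lo hi E) (hp : ∀ q ∈ lam, p ≤ q → q = p)
    (hb : ∀ q x, q ≠ p → E q = some x → x ≤ hi') :
    IsSSYT (eraseCorner lam p hp) ⊥ lo hi' (Function.update E p none) := by
  have hE : ∀ q x, Function.update E p none q = some x → q ≠ p ∧ E q = some x := by
    intro q x hx
    by_cases hq : q = p
    · subst hq; simp at hx
    · rw [Function.update_of_ne hq] at hx; exact ⟨hq, hx⟩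
  refine ⟨fun q => ?_, fun q x hx => ?_, fun r c x y hx hy => ?_, fun r c x y hx hy => ?_⟩
  · rw [mem_eraseCorner, ← h.isSome_iff]
    by_cases hq : q = p
    · subst hq; simp
    · rw [Function.update_of_ne hq]; simp [hq]
  · obtain ⟨h1, h2⟩ := hE _ _ hx
    exact ⟨(h.bounds _ _ h2).1, hb _ _ h1 h2⟩
  · exact h.row_weak _ _ _ _ (hE _ _ hx).2 (hE _ _ hy).2
  · exact h.col_strict _ _ _ _ (hE _ _ hx).2 (hE _ _ hy).2

/-! ### The invariant of the algorithm -/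

/-- The state of the algorithm: the current shape is `lam`, and the boxes of `inner` carry the
marks that are not active. -/
structure RunInv (a k : ℤ) (nu mu : YoungDiagram) (s : MarkedTableau) (lam inner : YoungDiagram) :
    Prop where
  ssyt : IsSSYT lam ⊥ a k s.entries
  le : lam ≤ nu
  inner_le : inner ≤ mu
  marks_none : s.active = none → s.marks = inner.cells
  marks_some : ∀ p, s.active = some p → p ∉ inner ∧ p ∈ lam ∧ s.marks = insert p inner.cells
  inner_entry : ∀ q ∈ inner, s.entries q = some (a + q.1)
  unmarked : ∀ q x, q ∉ s.marks → s.entries q = some x → 1 ≤ x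
  check : ∀ p, s.active = some p → s.checkRight = false → ¬ EqualRight s.entries p

theorem YoungDiagram.notMem_of_le {mu : YoungDiagram} {r c r' c' : ℕ} (h : (r, c) ∉ mu)
    (hr : r ≤ r') (hc : c ≤ c') : (r', c') ∉ mu := fun h0 => h (mu.up_left_mem hr hc h0)

namespace RunInv

variable {a k : ℤ} {nu mu lam inner : YoungDiagram} {s s' : MarkedTableau}

/-- If the comparison with the right neighbor is pending, then the step itself requires inequality;
if not, then the invariant provides it. So every increment respects the rows. -/
theorem right_ne (h : RunInv a k nu mu s lam inner) {r c : ℕ} (ha : s.active = some (r, c))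
    (hr : ¬ (s.checkRight = true ∧ EqualRight s.entries (r, c))) {x : ℤ}
    (hx : s.entries (r, c) = some x) : s.entries (r, c + 1) ≠ some x := by
  intro h0
  have heq : EqualRight s.entries (r, c) := ⟨x, hx, h0⟩
  cases hc : s.checkRight
  · exact h.check _ ha hc heq
  · exact hr ⟨hc, heq⟩

theorem inner_sub (h : RunInv a k nu mu s lam inner) : ∀ q ∈ inner, q ∈ lam :=
  fun q hq => h.ssyt.mem_of_eq (h.inner_entry q hq)

theorem pick (h : RunInv a k nu mu s lam inner) (hmu : ∀ q ∈ mu, a + (q.1 : ℤ) ≤ 0)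
    {p : ℕ × ℕ} (ha : s.active = none) (hp : Maximal (· ∈ s.marks) p) :
    ∃ inner', inner'.cells = inner.cells.erase p ∧
      RunInv a k nu mu ⟨s.entries, s.marks, some p, false⟩ lam inner' := by
  have hm := h.marks_none ha
  rw [hm] at hp
  have hpi : p ∈ inner := (YoungDiagram.mem_cells _).1 hp.prop
  have hcor : ∀ q ∈ inner, p ≤ q → q = p := fun q hq hle =>
    le_antisymm (hp.2 ((YoungDiagram.mem_cells _).2 hq) hle) hle
  refine ⟨eraseCorner inner p hcor, rfl, h.ssyt, h.le, ?_, by simp, ?_, ?_, h.unmarked, ?_⟩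
  · intro q hq
    exact h.inner_le (mem_eraseCorner.1 hq).2
  · rintro p' hp'
    simp only [Option.some.injEq] at hp'
    subst hp'
    refine ⟨fun h0 => (mem_eraseCorner.1 h0).1 rfl, h.inner_sub _ hpi, ?_⟩
    simp only [hm, eraseCorner]
    rw [Finset.insert_erase hp.prop]
  · exact fun q hq => h.inner_entry q (mem_eraseCorner.1 hq).2
  · rintro p' hp' -
    simp only [Option.some.injEq] at hp'
    subst hp'
    rintro ⟨x, h1, h2⟩
    simp only at h1 h2
    rw [h.inner_entry _ hpi] at h1
    simp only [Option.some.injEq] at h1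
    -- A picked number is at most 0 and its right neighbor, which is not marked, is at least 1.
    -- Hence no comparison is necessary after a pick.
    have h3 : (p.1, p.2 + 1) ∉ s.marks := by
      rw [hm, YoungDiagram.mem_cells]
      intro h0
      have := hcor _ h0 (Prod.mk_le_mk.2 ⟨le_rfl, Nat.le_succ _⟩)
      rw [Prod.ext_iff] at this; simp at this
    have := h.unmarked _ _ h3 h2
    have := hmu _ (h.inner_le hpi)
    omega

theorem inner_ne (h : RunInv a k nu mu s lam inner) {r c : ℕ} (ha : s.active = some (r, c))
    {r' c' : ℕ} (hr : r ≤ r') (hc : c ≤ c') : (r', c') ∉ inner :=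
  YoungDiagram.notMem_of_le (h.marks_some _ ha).1 hr hc

theorem bump_inner (h : RunInv a k nu mu s lam inner) {r c : ℕ} (ha : s.active = some (r, c))
    (x : ℤ) (m : ℕ) : ∀ q ∈ inner, bump s.entries r c x m q = some (a + q.1) := by
  rintro ⟨r', c'⟩ hq
  rw [bump_of_ne, h.inner_entry _ hq]
  rintro ⟨h1, h2, -⟩
  simp only at h1 h2
  exact h.inner_ne ha h2 h1.ge hq

/-- Above its lowest box, the increased run shows in each box the number that stood one box below.
That number was not marked, so it is at least 1. -/
theorem bump_unmarked (h : RunInv a k nu mu s lam inner) {r c : ℕ} (ha : s.active = some (r, c))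
    {x : ℤ} {m : ℕ} (hb : IsBumpable s.entries r c x m) {q : ℕ × ℕ} {y : ℤ} (hq : q ∉ inner)
    (hq' : q ≠ (r + m, c)) (hy : bump s.entries r c x m q = some y) : 1 ≤ y := by
  obtain ⟨r', c'⟩ := q
  have hm := (h.marks_some _ ha).2.2
  by_cases hreg : c' = c ∧ r ≤ r' ∧ r' ≤ r + m
  · obtain ⟨rfl, h1, h2⟩ := hreg
    obtain ⟨t, rfl⟩ := Nat.exists_eq_add_of_le h1
    have htm : t < m := lt_of_le_of_ne (by omega) fun h0 => hq' (by rw [h0])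
    rw [bump_add htm.le] at hy
    simp only [Option.some.injEq] at hy
    have h3 := hb.col (t + 1) htm
    have := h.unmarked (r + (t + 1), c') _ (by
      rw [hm, Finset.mem_insert, YoungDiagram.mem_cells, not_or]
      exact ⟨by simp, h.inner_ne ha (by omega) le_rfl⟩) h3
    push_cast at this; omega
  · rw [bump_of_ne hreg] at hy
    refine h.unmarked _ _ ?_ hy
    rw [hm, Finset.mem_insert, YoungDiagram.mem_cells, not_or]
    refine ⟨fun h0 => hreg ?_, hq⟩
    simp only [Prod.mk.injEq] at h0; omega

theorem move (h : RunInv a k nu mu s lam inner) {r c : ℕ} (ha : s.active = some (r, c))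
    {x : ℤ} {m : ℕ} (hb : IsBumpable s.entries r c x m) (hr : s.entries (r, c + 1) ≠ some x)
    (hk : x + m < k) : RunInv a k nu mu ⟨bump s.entries r c x m,
      insert (r + m, c) (s.marks.erase (r, c)), some (r + m, c), true⟩ lam inner := by
  obtain ⟨h1, h2, h3⟩ := h.marks_some _ ha
  have hmk : insert (r + m, c) (s.marks.erase (r, c)) = insert (r + m, c) inner.cells := by
    rw [h3, Finset.erase_insert (by rwa [YoungDiagram.mem_cells])]
  refine ⟨h.ssyt.bump hb hr hk, h.le, h.inner_le, by simp, ?_, h.bump_inner ha x m, ?_, by simp⟩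
  · rintro p hp
    simp only [Option.some.injEq] at hp
    subst hp
    exact ⟨h.inner_ne ha (by omega) le_rfl, h.ssyt.mem_of_eq (hb.col m le_rfl), hmk⟩
  · intro q y hq hy
    simp only [hmk, Finset.mem_insert, YoungDiagram.mem_cells, not_or] at hq
    exact h.bump_unmarked ha hb hq.2 hq.1 hy

theorem slide (h : RunInv a k nu mu s lam inner) {r c c' : ℕ} (ha : s.active = some (r, c))
    {x : ℤ} (hr : EqualRight s.entries (r, c)) (hc : c < c') (hc' : s.entries (r, c') = some x)
    (hmax : ∀ c'', c' < c'' → s.entries (r, c'') ≠ some x) :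
    RunInv a k nu mu ⟨s.entries, insert (r, c') (s.marks.erase (r, c)), some (r, c'), false⟩
      lam inner := by
  obtain ⟨h1, h2, h3⟩ := h.marks_some _ ha
  have hmk : insert (r, c') (s.marks.erase (r, c)) = insert (r, c') inner.cells := by
    rw [h3, Finset.erase_insert (by rwa [YoungDiagram.mem_cells])]
  refine ⟨h.ssyt, h.le, h.inner_le, by simp, ?_, h.inner_entry, ?_, ?_⟩
  · rintro p hp
    simp only [Option.some.injEq] at hp
    subst hp
    exact ⟨h.inner_ne ha le_rfl hc.le, h.ssyt.mem_of_eq hc', hmk⟩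
  · intro q y hq hy
    simp only [hmk, Finset.mem_insert, YoungDiagram.mem_cells, not_or] at hq
    by_cases hqe : q = (r, c)
    · subst hqe
      obtain ⟨z, hz1, hz2⟩ := hr
      -- The box that loses the mark contains the same number as its right neighbor, which was not
      -- marked.
      simp only at hy hz1 hz2
      rw [hz1] at hy
      simp only [Option.some.injEq] at hy
      subst hy
      refine h.unmarked (r, c + 1) _ ?_ hz2
      rw [h3, Finset.mem_insert, YoungDiagram.mem_cells, not_or]
      exact ⟨by simp, h.inner_ne ha le_rfl (Nat.le_succ c)⟩
    · refine h.unmarked q _ ?_ hy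
      rw [h3, Finset.mem_insert, YoungDiagram.mem_cells, not_or]
      exact ⟨hqe, hq.2⟩
  · rintro p hp -
    simp only [Option.some.injEq] at hp
    subst hp
    rintro ⟨y, h4, h5⟩
    simp only at h4 h5
    rw [hc'] at h4
    simp only [Option.some.injEq] at h4
    exact hmax (c' + 1) (Nat.lt_succ_self _) (by rw [h5, h4])

/-- The box of the deleted entry is a corner. -/
theorem corner (h : RunInv a k nu mu s lam inner) {r c : ℕ}
    {x : ℤ} {m : ℕ} (hb : IsBumpable s.entries r c x m) (hr : s.entries (r, c + 1) ≠ some x)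
    (hk : x + m = k) : ∀ q ∈ lam, (r + m, c) ≤ q → q = (r + m, c) := by
  obtain ⟨-, h1, h2⟩ := (h.ssyt.deletable_iff hb hr).2 hk
  simp only at h1 h2
  rw [bump_of_ne (by simp only; omega)] at h1 h2
  refine corner_of_notMem (fun h0 => ?_) (fun h0 => ?_)
  · obtain ⟨y, hy⟩ := h.ssyt.exists_eq h0; rw [hy] at h1; simp at h1
  · obtain ⟨y, hy⟩ := h.ssyt.exists_eq h0; rw [hy] at h2; simp at h2

theorem remove (h : RunInv a k nu mu s lam inner) {r c : ℕ} (ha : s.active = some (r, c))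
    {x : ℤ} {m : ℕ} (hb : IsBumpable s.entries r c x m) (hr : s.entries (r, c + 1) ≠ some x)
    (hk : x + m = k) : RunInv a k nu mu
      ⟨Function.update (bump s.entries r c x m) (r + m, c) none, s.marks.erase (r, c), none, false⟩
      (eraseCorner lam (r + m, c) (h.corner hb hr hk)) inner := by
  obtain ⟨h1, h2, h3⟩ := h.marks_some _ ha
  have hmk : s.marks.erase (r, c) = inner.cells := by
    rw [h3, Finset.erase_insert (by rwa [YoungDiagram.mem_cells])]
  have hne : ∀ q ∈ inner, q ≠ (r + m, c) := by
    rintro q hq rfl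
    exact h.inner_ne ha (by omega) le_rfl hq
  refine ⟨?_, fun q hq => h.le (mem_eraseCorner.1 hq).2, h.inner_le, fun _ => hmk, by simp, ?_, ?_,
    by simp⟩
  -- With `k + 1` allowed for the moment, the increased tableau is semistandard; its only entry `k +
  -- 1` in the run is in the corner that is erased.
  · refine ((h.ssyt.mono_hi (by omega : k ≤ k + 1)).bump hb hr (by omega)).erase _ ?_
    rintro ⟨r', c'⟩ y hq hy
    by_cases hreg : c' = c ∧ r ≤ r' ∧ r' ≤ r + m
    · obtain ⟨rfl, h4, h5⟩ := hreg
      obtain ⟨t, rfl⟩ := Nat.exists_eq_add_of_le h4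
      have htm : t < m := lt_of_le_of_ne (by omega) fun h0 => hq (by rw [h0])
      rw [bump_add htm.le] at hy
      simp only [Option.some.injEq] at hy
      omega
    · rw [bump_of_ne hreg] at hy
      exact (h.ssyt.bounds _ _ hy).2
  · intro q hq
    simp only
    rw [Function.update_of_ne (hne q hq), h.bump_inner ha x m q hq]
  · intro q y hq hy
    simp only [hmk, YoungDiagram.mem_cells] at hq
    simp only at hy
    by_cases hqe : q = (r + m, c)
    · subst hqe; simp at hy
    · rw [Function.update_of_ne hqe] at hy
      exact h.bump_unmarked ha hb hq hqe hy

end RunInv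

/-! ### Steps of the algorithm and jeu de taquin -/

/-- The data of a step of the algorithm, in explicit form. -/
inductive StepData (k : ℤ) (s : MarkedTableau) : StepKind → MarkedTableau → Prop
  | pick (p : ℕ × ℕ) (ha : s.active = none) (hp : Maximal (· ∈ s.marks) p) :
      StepData k s .pick ⟨s.entries, s.marks, some p, false⟩
  | move (r c : ℕ) (x : ℤ) (m : ℕ) (ha : s.active = some (r, c))
      (hb : IsBumpable s.entries r c x m) (hr : s.entries (r, c + 1) ≠ some x) (hk : x + m < k) :
      StepData k s .move ⟨bump s.entries r c x m, insert (r + m, c) (s.marks.erase (r, c)),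
        some (r + m, c), true⟩
  | remove (r c : ℕ) (x : ℤ) (m : ℕ) (ha : s.active = some (r, c))
      (hb : IsBumpable s.entries r c x m) (hr : s.entries (r, c + 1) ≠ some x) (hk : x + m = k) :
      StepData k s .remove ⟨Function.update (bump s.entries r c x m) (r + m, c) none,
        s.marks.erase (r, c), none, false⟩
  | slide (r c c' : ℕ) (x : ℤ) (ha : s.active = some (r, c)) (hf : s.checkRight = true)
      (hr : EqualRight s.entries (r, c)) (hx : s.entries (r, c) = some x) (hc : c < c')
      (hc' : s.entries (r, c') = some x) (hmax : ∀ c'', c' < c'' → s.entries (r, c'') ≠ some x) :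
      StepData k s .slide ⟨s.entries, insert (r, c') (s.marks.erase (r, c)), some (r, c'), false⟩

namespace RunInv

variable {a k : ℤ} {nu mu lam inner : YoungDiagram} {s s' : MarkedTableau} {κ : StepKind}

theorem stepData_iff (h : RunInv a k nu mu s lam inner) :
    TableauStep k κ s s' ↔ StepData k s κ s' := by
  constructor
  · intro hst
    cases hst with
    | pick _ p ha hp => exact .pick p ha hp
    | move _ p p' E' ha hr hi hd =>
      obtain ⟨r, c⟩ := p
      obtain ⟨x, m, hb, rfl, rfl⟩ := incrementPush_iff.1 hi
      have hne := h.right_ne ha hr hb.head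
      have h1 := (h.ssyt.bounds _ _ (hb.col m le_rfl)).2
      exact .move r c x m ha hb hne
        (lt_of_le_of_ne h1 fun h0 => hd ((h.ssyt.deletable_iff hb hne).2 h0))
    | remove _ p p' E' ha hr hi hd =>
      obtain ⟨r, c⟩ := p
      obtain ⟨x, m, hb, rfl, rfl⟩ := incrementPush_iff.1 hi
      have hne := h.right_ne ha hr hb.head
      exact .remove r c x m ha hb hne ((h.ssyt.deletable_iff hb hne).1 hd)
    | slide _ r c c' x ha hr hx hc hc' hmax => exact .slide r c c' x ha hr.1 hr.2 hx hc hc' hmax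
  · intro hst
    have hnr : ∀ {r c : ℕ} {x : ℤ}, s.entries (r, c) = some x → s.entries (r, c + 1) ≠ some x →
        ¬ (s.checkRight = true ∧ EqualRight s.entries (r, c)) := by
      rintro r c x hx hr ⟨-, y, hy, hy'⟩
      simp only at hy hy'
      rw [hx] at hy
      simp only [Option.some.injEq] at hy
      exact hr (by rw [hy', hy])
    cases hst with
    | pick p ha hp => exact .pick s p ha hp
    | move r c x m ha hb hr hk =>
      exact .move s _ _ _ ha (hnr hb.head hr) (incrementPush_iff.2 ⟨x, m, hb, rfl, rfl⟩)
        (fun h0 => by have := (h.ssyt.deletable_iff hb hr).1 h0; omega)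
    | remove r c x m ha hb hr hk =>
      exact .remove s _ _ _ ha (hnr hb.head hr) (incrementPush_iff.2 ⟨x, m, hb, rfl, rfl⟩)
        ((h.ssyt.deletable_iff hb hr).2 hk)
    | slide r c c' x ha hf hr hx hc hc' hmax =>
      exact .slide s r c c' x ha ⟨hf, hr⟩ hx hc hc' hmax

theorem step (h : RunInv a k nu mu s lam inner) (hmu : ∀ q ∈ mu, a + (q.1 : ℤ) ≤ 0)
    (hst : StepData k s κ s') : ∃ lam' inner', RunInv a k nu mu s' lam' inner' := by
  cases hst with
  | pick p ha hp =>
    obtain ⟨inner', -, h'⟩ := h.pick hmu ha hp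
    exact ⟨_, _, h'⟩
  | move r c x m ha hb hr hk => exact ⟨_, _, h.move ha hb hr hk⟩
  | remove r c x m ha hb hr hk => exact ⟨_, _, h.remove ha hb hr hk⟩
  | slide r c c' x ha hf hr hx hc hc' hmax => exact ⟨_, _, h.slide ha hr hc hc' hmax⟩

/-- The algorithm can be continued while there are marks. -/
theorem exists_step (h : RunInv a k nu mu s lam inner) (hs : s.marks.Nonempty) :
    ∃ κ s', StepData k s κ s' := by
  cases ha : s.active with
  | none =>
    obtain ⟨p, hp⟩ := s.marks.exists_maximal hs
    exact ⟨_, _, .pick p ha hp⟩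
  | some p =>
    obtain ⟨r, c⟩ := p
    obtain ⟨x, hx⟩ := h.ssyt.exists_eq (h.marks_some _ ha).2.1
    by_cases hf : s.checkRight = true ∧ EqualRight s.entries (r, c)
    · classical
      let P : ℕ → Prop := fun c' => s.entries (r, c') = some x
      have hP : P (c + 1) := by
        obtain ⟨y, h1, h2⟩ := hf.2
        simp only at h1 h2
        rw [hx] at h1
        simp only [P, h2, h1]
      have hbd : ∀ c', P c' → c' ≤ lam.rowLen r := fun c' hc' =>
        (YoungDiagram.mem_iff_lt_rowLen.1 (h.ssyt.mem_of_eq hc')).le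
      refine ⟨_, _, .slide r c (Nat.findGreatest P (lam.rowLen r)) x ha hf.1 hf.2 hx ?_ ?_ ?_⟩
      · exact Nat.lt_of_lt_of_le (Nat.lt_succ_self c) (Nat.le_findGreatest (hbd _ hP) hP)
      · exact Nat.findGreatest_spec (P := P) (hbd _ hP) hP
      · intro c'' hc'' h0
        exact absurd (Nat.le_findGreatest (P := P) (hbd c'' h0) h0) (by omega)
    · obtain ⟨m, hb⟩ := h.ssyt.exists_isBumpable hx
      have hne := h.right_ne ha hf hx
      rcases eq_or_lt_of_le (h.ssyt.bounds _ _ (hb.col m le_rfl)).2 with h1 | h1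
      · exact ⟨_, _, .remove r c x m ha hb hne h1⟩
      · exact ⟨_, _, .move r c x m ha hb hne h1⟩

end RunInv

/-- A bound for the number of remaining steps. -/
def runMeasure (a k : ℤ) (s : MarkedTableau) : ℕ :=
  s.marks.card * (2 * (k + 1 - a).toNat + 1) +
    match s.active with
    | none => 2 * (k + 1 - a).toNat + 1
    | some p => 2 * (k + 1 - (s.entries p).getD 0).toNat + (if s.checkRight then 1 else 0)

/-- With `N = 2 * (k + 1 - a) + 1`, each mark counts `N`, and the active number `x` adds `2 * (k + 1
- x)`, plus 1 if a comparison is pending. An increment gains at least 2 and sets at most the flag, a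
slide clears the flag, a pick replaces the extra `N` by less, and a removal loses one `N`, which
compensates for the `N` of the inactive state, and a positive term for `x ≤ k`. -/
theorem RunInv.measure_lt {a k : ℤ} {nu mu lam inner : YoungDiagram} {s s' : MarkedTableau}
    {κ : StepKind} (h : RunInv a k nu mu s lam inner) (hst : StepData k s κ s') :
    runMeasure a k s' < runMeasure a k s := by
  have hins : ∀ {p p' : ℕ × ℕ}, s.active = some p → p' ∉ inner →
      (insert p' (s.marks.erase p)).card = s.marks.card := by
    intro p p' ha hp'
    obtain ⟨h1, -, h3⟩ := h.marks_some _ ha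
    rw [h3, Finset.erase_insert (by rwa [YoungDiagram.mem_cells]),
      Finset.card_insert_of_notMem (by rwa [YoungDiagram.mem_cells]),
      Finset.card_insert_of_notMem (by rwa [YoungDiagram.mem_cells])]
  cases hst with
  | pick p ha hp =>
    have hm := h.marks_none ha
    have hpi : p ∈ inner := (YoungDiagram.mem_cells _).1 (hm ▸ hp.prop)
    have hx := h.inner_entry p hpi
    simp only [runMeasure, ha, hx, Option.getD_some]
    simp only [Bool.false_eq_true, if_false]
    omega
  | move r c x m ha hb hr hk =>
    have hx := hb.head
    have h1 := bump_add (E := s.entries) (r := r) (c := c) (x := x) (le_refl m)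
    simp only [runMeasure, ha, hx, h1, Option.getD_some,
      hins ha (h.inner_ne ha (by omega : r ≤ r + m) le_rfl)]
    split_ifs <;> omega
  | remove r c x m ha hb hr hk =>
    have hx := hb.head
    have hmem : (r, c) ∈ s.marks := by rw [(h.marks_some _ ha).2.2]; simp
    have hcard := Finset.card_erase_add_one hmem
    simp only [runMeasure, ha, hx, Option.getD_some, ← hcard, add_mul]
    omega
  | slide r c c' x ha hf hr hx hc hc' hmax =>
    simp only [runMeasure, ha, hx, hc', Option.getD_some, hf, hins ha (h.inner_ne ha le_rfl hc.le)]
    simp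

/-! ### Simulation of jeu de taquin -/

/-- The stage of jeu de taquin where `inner` is the empty region, and `act` the active box. -/
def jdtState (inner : Finset (ℕ × ℕ)) (E : Filling) (act : Option (ℕ × ℕ)) : JdtState :=
  ⟨inner, fun q => if act = some q ∨ q ∈ inner then none else E q, act⟩

/-- The number in the active box is invisible to jeu de taquin. This is why the first increment of a
pass corresponds to no slide. -/
theorem jdtState_congr {inner : Finset (ℕ × ℕ)} {E E' : Filling} {p : ℕ × ℕ}
    (h : ∀ q, q ≠ p → E q = E' q) :
    jdtState inner E (some p) = jdtState inner E' (some p) := by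
  simp only [jdtState, JdtState.mk.injEq, true_and, and_true]
  funext q
  by_cases hq : q = p
  · simp [hq]
  · rw [h q hq]

theorem RunInv.unmark_eq {a k : ℤ} {nu mu lam inner : YoungDiagram} {s : MarkedTableau}
    (h : RunInv a k nu mu s lam inner) :
    s.unmark = jdtState inner.cells s.entries s.active := by
  cases ha : s.active with
  | none =>
    have hm := h.marks_none ha
    simp only [MarkedTableau.unmark, jdtState, ha, hm]
    simp
  | some p =>
    obtain ⟨h1, -, h3⟩ := h.marks_some _ ha
    simp only [MarkedTableau.unmark, jdtState, ha, h3, JdtState.mk.injEq, and_true]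
    constructor
    · ext q
      simp only [Finset.mem_filter, Finset.mem_insert, Option.some.injEq, ne_eq,
        YoungDiagram.mem_cells]
      constructor
      · rintro ⟨h4 | h4, h5⟩
        · exact absurd h4.symm h5
        · exact h4
      · intro h4
        exact ⟨Or.inr h4, fun h5 => h1 (h5 ▸ h4)⟩
    · funext q
      simp only [Finset.mem_insert, Option.some.injEq, eq_comm]

theorem jdtUp_jdtState {inner : Finset (ℕ × ℕ)} {E E' : Filling} {r c : ℕ} {y : ℤ}
    (h0 : (r, c) ∉ inner) (h1 : (r + 1, c) ∉ inner) (hy : E (r + 1, c) = some y)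
    (hz : ∀ z, E (r, c + 1) = some z → y ≤ z) (hE' : E' (r, c) = some y)
    (hE : ∀ q, q ≠ (r, c) → q ≠ (r + 1, c) → E' q = E q) :
    JdtUp (jdtState inner E (some (r, c))) (jdtState inner E' (some (r + 1, c))) := by
  have h2 := JdtUp.mk (jdtState inner E (some (r, c))) r c y rfl (by
    simp [jdtState, h1, hy]) (by
    intro z hz'
    simp only [jdtState] at hz'
    split_ifs at hz' with h3
    exact hz z hz')
  convert h2 using 1
  simp only [jdtState, JdtState.mk.injEq, true_and, and_true]
  funext q
  simp only [Function.update_apply, Option.some.injEq]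
  by_cases hq1 : q = (r + 1, c)
  · simp [hq1]
  by_cases hq2 : q = (r, c)
  · subst hq2; simp [h0, hE']
  rw [if_neg hq1, if_neg hq2, hE q hq2 hq1]
  simp [Ne.symm hq1, Ne.symm hq2]

theorem jdtLeft_jdtState {inner : Finset (ℕ × ℕ)} {E : Filling} {r c : ℕ} {x : ℤ}
    (h0 : (r, c) ∉ inner) (h1 : (r, c + 1) ∉ inner) (hx : E (r, c) = some x)
    (hx' : E (r, c + 1) = some x) (hz : ∀ z, E (r + 1, c) = some z → x < z) :
    JdtLeft (jdtState inner E (some (r, c))) (jdtState inner E (some (r, c + 1))) := by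
  have h2 := JdtLeft.mk (jdtState inner E (some (r, c))) r c x rfl (by
    simp [jdtState, h1, hx']) (by
    intro z hz'
    simp only [jdtState] at hz'
    split_ifs at hz' with h3
    exact hz z hz')
  convert h2 using 1
  simp only [jdtState, JdtState.mk.injEq, true_and, and_true]
  funext q
  simp only [Function.update_apply, Option.some.injEq]
  by_cases hq1 : q = (r, c + 1)
  · simp [hq1]
  by_cases hq2 : q = (r, c)
  · subst hq2; simp [h0, hx]
  rw [if_neg hq1, if_neg hq2]
  simp [Ne.symm hq1, Ne.symm hq2]

namespace RunInv

variable {a k : ℤ} {nu mu lam inner : YoungDiagram} {s s' : MarkedTableau} {κ : StepKind}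

/-- Incrementing and pushing down corresponds to vertical slides. -/
theorem jdtUp_chain (h : RunInv a k nu mu s lam inner) {r c : ℕ} (ha : s.active = some (r, c))
    {x : ℤ} {m : ℕ} (hb : IsBumpable s.entries r c x m) (hr : s.entries (r, c + 1) ≠ some x) :
    Relation.ReflTransGen JdtUp s.unmark
      (jdtState inner.cells (bump s.entries r c x m) (some (r + m, c))) := by
  have key : ∀ n ≤ m, Relation.ReflTransGen JdtUp s.unmark
      (jdtState inner.cells (bump s.entries r c x n) (some (r + n, c))) := by
    intro n
    induction n with
    | zero =>
      intro _
      rw [h.unmark_eq, ha, bump_zero]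
      simp only [add_zero]
      rw [jdtState_congr (E := s.entries)
        (fun q hq => (Function.update_of_ne hq (some (x + 1)) s.entries).symm)]
    | succ n ih =>
      intro hn
      -- The number below the active box is `x + n + 1`, and all numbers to the right of the run in
      -- this row are larger than `x + n`. So the lower one moves, also in a tie.
      refine (ih (by omega)).tail (jdtUp_jdtState (y := x + (n + 1 : ℕ)) ?_ ?_ ?_ ?_ ?_ ?_)
      · rw [YoungDiagram.mem_cells]; exact h.inner_ne ha (by omega) le_rfl
      · rw [YoungDiagram.mem_cells]; exact h.inner_ne ha (by omega) le_rfl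
      · rw [bump_of_ne (by simp only; omega), add_assoc, hb.col (n + 1) hn]
      · intro z hz
        rw [bump_of_ne (by simp only; omega)] at hz
        have := h.ssyt.lt_right hb.head hr hz
        push_cast; omega
      · rw [bump_add (by omega)]; push_cast; congr 1; ring
      · intro q h1 h2
        rw [bump_succ, ← add_assoc, Function.update_of_ne h2]
  exact key m le_rfl

theorem sim_pick (h : RunInv a k nu mu s lam inner) (hmu : ∀ q ∈ mu, a + (q.1 : ℤ) ≤ 0)
    {p : ℕ × ℕ} (ha : s.active = none) (hp : Maximal (· ∈ s.marks) p) :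
    JdtPick s.unmark (MarkedTableau.unmark ⟨s.entries, s.marks, some p, false⟩) := by
  obtain ⟨inner', h1, h2⟩ := h.pick hmu ha hp
  have hm := h.marks_none ha
  rw [hm] at hp
  have h3 := JdtPick.mk s.unmark p (by simp [MarkedTableau.unmark, ha]) (by
    rw [h.unmark_eq]; exact hp)
  rw [h2.unmark_eq, h1]
  convert h3 using 1
  rw [h.unmark_eq, ha]
  simp only [jdtState, JdtState.mk.injEq, true_and, and_true]
  funext q
  by_cases hq : q = p
  · subst hq
    have := hp.prop
    rw [YoungDiagram.mem_cells] at this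
    simp [this]
  · simp [hq, Ne.symm hq]

/-- All entries between the old and the new place of the mark are equal. Sliding them to the left
thus changes nothing but the place of the empty box, and the numbers below are strictly larger. -/
theorem sim_slide (h : RunInv a k nu mu s lam inner) {r c c' : ℕ} (ha : s.active = some (r, c))
    {x : ℤ} (hr : EqualRight s.entries (r, c)) (hx : s.entries (r, c) = some x) (hc : c < c')
    (hc' : s.entries (r, c') = some x) (hmax : ∀ c'', c' < c'' → s.entries (r, c'') ≠ some x) :
    Relation.TransGen JdtLeft s.unmark (MarkedTableau.unmark
      ⟨s.entries, insert (r, c') (s.marks.erase (r, c)), some (r, c'), false⟩) := by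
  rw [h.unmark_eq, (h.slide ha hr hc hc' hmax).unmark_eq, ha]
  simp only
  have hall : ∀ d, c ≤ d → d ≤ c' → s.entries (r, d) = some x := by
    intro d h1 h2
    obtain ⟨y, hy⟩ := h.ssyt.exists_eq (lam.up_left_mem le_rfl h2 (h.ssyt.mem_of_eq hc'))
    have h3 := h.ssyt.le_of_le le_rfl h1 hx hy
    have h4 := h.ssyt.le_of_le le_rfl h2 hy hc'
    rw [hy]; congr 1; omega
  have step : ∀ d, c ≤ d → d + 1 ≤ c' → JdtLeft (jdtState inner.cells s.entries (some (r, d)))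
      (jdtState inner.cells s.entries (some (r, d + 1))) := by
    intro d h1 h2
    refine jdtLeft_jdtState (x := x) ?_ ?_ (hall d h1 (by omega)) (hall _ (by omega) h2) ?_
    · rw [YoungDiagram.mem_cells]; exact h.inner_ne ha le_rfl h1
    · rw [YoungDiagram.mem_cells]; exact h.inner_ne ha le_rfl (by omega)
    · intro z hz
      exact h.ssyt.col_strict _ _ _ _ (hall d h1 (by omega)) hz
  have key : ∀ n, c + (n + 1) ≤ c' → Relation.TransGen JdtLeft
      (jdtState inner.cells s.entries (some (r, c)))
      (jdtState inner.cells s.entries (some (r, c + (n + 1)))) := by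
    intro n
    induction n with
    | zero => intro hn; exact .single (step c le_rfl hn)
    | succ n ih => intro hn; exact (ih (by omega)).tail (step _ (by omega) (by omega))
  have := key (c' - c - 1) (by omega)
  rwa [show c + (c' - c - 1 + 1) = c' by omega] at this

theorem sim_move (h : RunInv a k nu mu s lam inner) {r c : ℕ} (ha : s.active = some (r, c))
    {x : ℤ} {m : ℕ} (hb : IsBumpable s.entries r c x m) (hr : s.entries (r, c + 1) ≠ some x)
    (hk : x + m < k) : Relation.ReflTransGen JdtUp s.unmark (MarkedTableau.unmark
      ⟨bump s.entries r c x m, insert (r + m, c) (s.marks.erase (r, c)), some (r + m, c), true⟩)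
    := by
  rw [(h.move ha hb hr hk).unmark_eq]
  exact h.jdtUp_chain ha hb hr

theorem sim_remove (h : RunInv a k nu mu s lam inner) {r c : ℕ} (ha : s.active = some (r, c))
    {x : ℤ} {m : ℕ} (hb : IsBumpable s.entries r c x m) (hr : s.entries (r, c + 1) ≠ some x)
    (hk : x + m = k) : ∃ J, Relation.ReflTransGen JdtUp s.unmark J ∧ JdtStop J
      (MarkedTableau.unmark ⟨Function.update (bump s.entries r c x m) (r + m, c) none,
        s.marks.erase (r, c), none, false⟩) := by
  refine ⟨_, h.jdtUp_chain ha hb hr, ?_⟩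
  rw [(h.remove ha hb hr hk).unmark_eq]
  obtain ⟨-, h1, h2⟩ := (h.ssyt.deletable_iff hb hr).2 hk
  have h3 := JdtStop.mk (jdtState inner.cells (bump s.entries r c x m) (some (r + m, c)))
    (r + m) c rfl (by simp only [jdtState]; rw [h1]; simp) (by simp only [jdtState]; rw [h2]; simp)
  convert h3 using 1
  simp only [jdtState, JdtState.mk.injEq, true_and, and_true]
  funext q
  by_cases hq : q = (r + m, c)
  · simp [hq]
  · simp [Function.update_of_ne hq, Ne.symm hq]

end RunInv

/-! ### Complete runs -/

/-- Jeu de taquin is deterministic while a box is active. -/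
theorem jdtStep_unique {J A B : JdtState} (hJ : J.active ≠ none) (hA : JdtStep J A)
    (hB : JdtStep J B) : A = B := by
  rcases hA with hA | hA | hA | hA <;> cases hA <;>
    rcases hB with hB | hB | hB | hB <;> cases hB <;>
    simp_all <;> grind

theorem jdtUp_active {J A : JdtState} (h : JdtUp J A) : J.active ≠ none := by
  cases h; simp_all

theorem jdtLeft_active {J A : JdtState} (h : JdtLeft J A) : J.active ≠ none := by
  cases h; simp_all

theorem jdtStop_active {J A : JdtState} (h : JdtStop J A) : J.active ≠ none := by
  cases h; simp_all

/-- A run is not complete while a box is active, and its next step is then forced. So every complete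
run passes through `A`. -/
theorem jdt_through {J A : JdtState} {R : Filling} (hJ : J.active ≠ none) (hA : JdtStep J A)
    (hZ : Relation.ReflTransGen JdtStep J ⟨∅, R, none⟩) :
    Relation.ReflTransGen JdtStep A ⟨∅, R, none⟩ := by
  rcases hZ.cases_head with rfl | ⟨B, h1, h2⟩
  · exact absurd rfl hJ
  · rwa [jdtStep_unique hJ hA h1]

theorem jdt_through_up {J A : JdtState} {R : Filling} (hA : Relation.ReflTransGen JdtUp J A)
    (hZ : Relation.ReflTransGen JdtStep J ⟨∅, R, none⟩) :
    Relation.ReflTransGen JdtStep A ⟨∅, R, none⟩ := by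
  induction hA with
  | refl => exact hZ
  | tail _ h2 ih => exact jdt_through (jdtUp_active h2) (Or.inr (Or.inl h2)) ih

theorem jdt_through_left {J A : JdtState} {R : Filling} (hA : Relation.TransGen JdtLeft J A)
    (hZ : Relation.ReflTransGen JdtStep J ⟨∅, R, none⟩) :
    Relation.ReflTransGen JdtStep A ⟨∅, R, none⟩ := by
  induction hA with
  | single h2 => exact jdt_through (jdtLeft_active h2) (Or.inr (Or.inr (Or.inl h2))) hZ
  | tail _ h2 ih => exact jdt_through (jdtLeft_active h2) (Or.inr (Or.inr (Or.inl h2))) ih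

namespace RunInv

variable {a k : ℤ} {nu mu lam inner : YoungDiagram} {s s' : MarkedTableau} {κ : StepKind}

/-- Each step of the algorithm is simulated by jeu de taquin. -/
theorem sim (h : RunInv a k nu mu s lam inner) (hmu : ∀ q ∈ mu, a + (q.1 : ℤ) ≤ 0)
    (hst : StepData k s κ s') : Relation.ReflTransGen JdtStep s.unmark s'.unmark := by
  have hup : ∀ {J A}, Relation.ReflTransGen JdtUp J A → Relation.ReflTransGen JdtStep J A :=
    fun h1 => Relation.ReflTransGen.mono (fun _ _ h2 => Or.inr (Or.inl h2)) _ _ h1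
  cases hst with
  | pick p ha hp => exact .single (Or.inl (h.sim_pick hmu ha hp))
  | move r c x m ha hb hr hk => exact hup (h.sim_move ha hb hr hk)
  | remove r c x m ha hb hr hk =>
    obtain ⟨J, h1, h2⟩ := h.sim_remove ha hb hr hk
    exact (hup h1).tail (Or.inr (Or.inr (Or.inr h2)))
  | slide r c c' x ha hf hr hx hc hc' hmax =>
    exact Relation.ReflTransGen.mono (fun _ _ h2 => Or.inr (Or.inr (Or.inl h2))) _ _
      (h.sim_slide ha hr hx hc hc' hmax).to_reflTransGen

/-- Every complete run of jeu de taquin is simulated by the algorithm. -/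
theorem exists_run (h : RunInv a k nu mu s lam inner) (hmu : ∀ q ∈ mu, a + (q.1 : ℤ) ≤ 0)
    {R : Filling} (hZ : Relation.ReflTransGen JdtStep s.unmark ⟨∅, R, none⟩) :
    ∃ s', Relation.ReflTransGen (fun s s' => ∃ κ, TableauStep k κ s s') s s' ∧
      s'.marks = ∅ ∧ s'.entries = R := by
  have key : ∀ n : ℕ, ∀ s lam inner, RunInv a k nu mu s lam inner → runMeasure a k s = n →
      Relation.ReflTransGen JdtStep s.unmark ⟨∅, R, none⟩ →
      ∃ s', Relation.ReflTransGen (fun s s' => ∃ κ, TableauStep k κ s s') s s' ∧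
        s'.marks = ∅ ∧ s'.entries = R := by
    intro n
    induction n using Nat.strong_induction_on with
    | _ n ih =>
      intro s lam inner h hn hZ
      have next : ∀ κ s₁, StepData k s κ s₁ →
          Relation.ReflTransGen JdtStep s₁.unmark ⟨∅, R, none⟩ →
          ∃ s', Relation.ReflTransGen (fun s s' => ∃ κ, TableauStep k κ s s') s s' ∧
            s'.marks = ∅ ∧ s'.entries = R := by
        intro κ s₁ hst hZ₁
        obtain ⟨lam', inner', h'⟩ := h.step hmu hst
        obtain ⟨s', h1, h2⟩ := ih _ (hn ▸ h.measure_lt hst) s₁ lam' inner' h' rfl hZ₁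
        exact ⟨s', .head ⟨κ, h.stepData_iff.2 hst⟩ h1, h2⟩
      cases ha : s.active with
      | none =>
        rcases hZ.cases_head with h0 | ⟨B, h1, h2⟩
        · have hu := h.unmark_eq
          rw [h0, ha] at hu
          simp only [jdtState, JdtState.mk.injEq, and_true] at hu
          obtain ⟨hu1, hu2⟩ := hu
          refine ⟨s, .refl, by rw [h.marks_none ha, ← hu1], ?_⟩
          rw [hu2]
          funext q
          rw [← hu1]; simp
        · have hpick : JdtPick s.unmark B := by
            have hact : s.unmark.active = none := by simp [MarkedTableau.unmark, ha]
            rcases h1 with h1 | h1 | h1 | h1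
            · exact h1
            · exact absurd hact (jdtUp_active h1)
            · exact absurd hact (jdtLeft_active h1)
            · exact absurd hact (jdtStop_active h1)
          cases hpick with
          | mk p hact hp =>
            -- With no active box the marks are exactly the empty boxes of the NW region, so the
            -- algorithm can copy the pick of jeu de taquin.
            have hp' : Maximal (· ∈ s.marks) p := by
              rw [h.unmark_eq] at hp
              rw [h.marks_none ha]; exact hp
            refine next _ _ (.pick p ha hp') ?_
            have h3 := h.sim_pick hmu ha hp'
            have h4 : (MarkedTableau.unmark ⟨s.entries, s.marks, some p, false⟩) =
                ⟨s.unmark.inner.erase p, s.unmark.filling, some p⟩ := by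
              generalize hY : MarkedTableau.unmark ⟨s.entries, s.marks, some p, false⟩ = Y at h3
              cases h3 with
              | mk p' _ _ =>
                have : (some p : Option (ℕ × ℕ)) = some p' := congrArg JdtState.active hY
                simp only [Option.some.injEq] at this
                rw [this]
            rw [h4]; exact h2
      | some p =>
        have hne : s.marks.Nonempty := ⟨p, by rw [(h.marks_some _ ha).2.2]; simp⟩
        -- With an active box jeu de taquin has no choice; any step of the algorithm is simulated by
        -- a part of the given run.
        obtain ⟨κ, s₁, hst⟩ := h.exists_step hne
        refine next κ s₁ hst ?_
        cases hst with
        | pick p' ha' hp => rw [ha] at ha'; simp at ha'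
        | move r c x m ha hb hr hk => exact jdt_through_up (h.sim_move ha hb hr hk) hZ
        | remove r c x m ha hb hr hk =>
          obtain ⟨J, h1, h2⟩ := h.sim_remove ha hb hr hk
          exact jdt_through (jdtStop_active h2) (Or.inr (Or.inr (Or.inr h2))) (jdt_through_up h1 hZ)
        | slide r c c' x ha hf hr hx hc hc' hmax =>
          exact jdt_through_left (h.sim_slide ha hr hx hc hc' hmax) hZ
  exact key _ s lam inner h rfl hZ

end RunInv

/-! ### The start of the algorithm -/

/-- The new numbers are constant along rows, increase by 1 down the columns, and lie in `[a, 0]`,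
while those of `T` are at least 1. So all conditions across the boundary of `mu` hold. -/
theorem completion_isSSYT {nu mu : YoungDiagram} {a k : ℤ} (hle : mu ≤ nu) (hk : 0 ≤ k)
    {T : Filling} (hT : IsSSYT nu mu 1 k T) (ha : a = 1 - (mu.colLen 0 : ℤ)) :
    IsSSYT nu ⊥ a k (completion mu T).entries := by
  have hrow : ∀ {r c : ℕ}, (r, c) ∈ mu → a + r ≤ 0 := by
    intro r c hm
    have := YoungDiagram.mem_iff_lt_colLen.1 (mu.up_left_mem le_rfl (Nat.zero_le c) hm)
    omega
  have hin : ∀ {q : ℕ × ℕ}, q ∈ mu → (completion mu T).entries q = some (a + q.1) := by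
    intro q hq
    simp only [completion, YoungDiagram.mem_cells, hq, if_true]
    congr 1; omega
  have hout : ∀ {q : ℕ × ℕ}, q ∉ mu → (completion mu T).entries q = T q := by
    intro q hq
    simp only [completion, YoungDiagram.mem_cells, hq, if_false]
  refine ⟨fun q => ?_, fun q x hx => ?_, fun r c x y hx hy => ?_, fun r c x y hx hy => ?_⟩
  · by_cases hq : q ∈ mu
    · rw [hin hq]; simpa using hle hq
    · rw [hout hq, hT.shape]; simp [hq]
  · by_cases hq : q ∈ mu
    · rw [hin hq] at hx
      simp only [Option.some.injEq] at hx
      have := hrow (r := q.1) (c := q.2) hq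
      omega
    · rw [hout hq] at hx
      have := hT.bounds _ _ hx
      omega
  · by_cases hq : (r, c) ∈ mu
    · rw [hin hq] at hx
      simp only [Option.some.injEq] at hx
      have := hrow hq
      by_cases hq' : (r, c + 1) ∈ mu
      · rw [hin hq'] at hy
        simp only [Option.some.injEq] at hy
        omega
      · rw [hout hq'] at hy
        have := hT.bounds _ _ hy
        omega
    · have hq' : (r, c + 1) ∉ mu := YoungDiagram.notMem_of_le hq le_rfl (Nat.le_succ c)
      rw [hout hq] at hx
      rw [hout hq'] at hy
      exact hT.row_weak _ _ _ _ hx hy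
  · by_cases hq : (r, c) ∈ mu
    · rw [hin hq] at hx
      simp only [Option.some.injEq] at hx
      have := hrow hq
      by_cases hq' : (r + 1, c) ∈ mu
      · rw [hin hq'] at hy
        simp only [Option.some.injEq] at hy
        push_cast at hy
        omega
      · rw [hout hq'] at hy
        have := hT.bounds _ _ hy
        omega
    · have hq' : (r + 1, c) ∉ mu := YoungDiagram.notMem_of_le hq (Nat.le_succ r) le_rfl
      rw [hout hq] at hx
      rw [hout hq'] at hy
      exact hT.col_strict _ _ _ _ hx hy

theorem runInv_completion {nu mu : YoungDiagram} {a k : ℤ} (hle : mu ≤ nu) (hk : 0 ≤ k)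
    {T : Filling} (hT : IsSSYT nu mu 1 k T) (ha : a = 1 - (mu.colLen 0 : ℤ)) :
    RunInv a k nu mu (completion mu T) nu mu := by
  refine ⟨completion_isSSYT hle hk hT ha, le_rfl, le_rfl, fun _ => rfl, by simp [completion],
    fun q hq => ?_, fun q x hq hx => ?_, by simp [completion]⟩
  · simp only [completion, YoungDiagram.mem_cells, hq, if_true]
    congr 1; omega
  · simp only [completion, YoungDiagram.mem_cells] at hq hx
    rw [if_neg hq] at hx
    exact (hT.bounds _ _ hx).1

theorem completion_unmark {nu mu : YoungDiagram} {lo hi : ℤ} {T : Filling}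
    (hT : IsSSYT nu mu lo hi T) : (completion mu T).unmark = ⟨mu.cells, T, none⟩ := by
  simp only [MarkedTableau.unmark, completion, JdtState.mk.injEq, and_true]
  refine ⟨by simp, ?_⟩
  funext q
  by_cases hq : q ∈ mu
  · have : T q = none := by
      rw [← Option.not_isSome_iff_eq_none, hT.shape]; simp [hq]
    simp [hq, this]
  · simp [hq]

/-! ### Column moves -/

/-- The tiles in columns `j` and `j + 1` around which a column move takes place. -/
structure IsColumn (D : Tiling) (i i' j : ℤ) : Prop where
  lt : i < i'
  nw : D (i, j) = .blank
  ne : D (i, j + 1) = .are ∨ D (i, j + 1) = .vert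
  mid : ∀ t, i < t → t < i' → (D (t, j) = .blank ∧ D (t, j + 1) = .vert) ∨
    (D (t, j) = .horiz ∧ D (t, j + 1) = .cross)
  bot : ((D (i', j) = .horiz ∨ D (i', j) = .are) ∧ D (i', j + 1) = .jay) ∨
    (D (i', j) = .are ∧ D (i', j + 1) = .cross)

namespace IsColumn

variable {D : Tiling} {i i' j : ℤ}

/-- Beside the moving pipe the left column contains only blank tiles and, below row `k` in a
removal, horizontal ones. Hence the cases of `shiftPair` with kinks of other pipes do not occur
here. -/
theorem tile_cases (h : IsColumn D i i' j) (p : ℤ × ℤ) :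
    (p = (i, j) ∧ columnMove D i i' j p = .are) ∨
    (p = (i, j + 1) ∧ ((D p = .are ∧ columnMove D i i' j p = .horiz) ∨
      (D p = .vert ∧ columnMove D i i' j p = .jay))) ∨
    (p = (i', j) ∧ ((D p = .are ∧ columnMove D i i' j p = .vert) ∨
      (D p = .horiz ∧ D (i', j + 1) = .jay ∧ columnMove D i i' j p = .jay))) ∨
    (p = (i', j + 1) ∧ ((D p = .jay ∧ columnMove D i i' j p = .blank) ∨
      (D p = .cross ∧ columnMove D i i' j p = .are))) ∨
    (∃ t, i < t ∧ t < i' ∧ p = (t, j) ∧ ((D p = .blank ∧ columnMove D i i' j p = .vert) ∨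
      (D p = .horiz ∧ D (t, j + 1) = .cross ∧ columnMove D i i' j p = .cross))) ∨
    (∃ t, i < t ∧ t < i' ∧ p = (t, j + 1) ∧
      ((D (t, j) = .blank ∧ D p = .vert ∧ columnMove D i i' j p = .blank) ∨
      (D (t, j) = .horiz ∧ D p = .cross ∧ columnMove D i i' j p = .horiz))) ∨
    (¬ (i ≤ p.1 ∧ p.1 ≤ i' ∧ (p.2 = j ∨ p.2 = j + 1)) ∧ columnMove D i i' j p = D p) := by
  obtain ⟨x, y⟩ := p
  have hlt := h.lt
  have hne : i' ≠ i := by omega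
  by_cases hreg : i ≤ x ∧ x ≤ i' ∧ (y = j ∨ y = j + 1)
  · obtain ⟨h1, h2, rfl | rfl⟩ := hreg
    · rcases eq_or_lt_of_le h1 with rfl | h1
      · exact .inl ⟨rfl, by simp [columnMove]⟩
      rcases eq_or_lt_of_le h2 with rfl | h2
      · refine .inr (.inr (.inl ⟨rfl, ?_⟩))
        rcases h.bot with ⟨h3 | h3, h4⟩ | ⟨h3, h4⟩
        · exact .inr ⟨h3, h4, by simp [columnMove, hne, h3]⟩
        · exact .inl ⟨h3, by simp [columnMove, hne, h3]⟩
        · exact .inl ⟨h3, by simp [columnMove, hne, h3]⟩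
      · refine .inr (.inr (.inr (.inr (.inl ⟨x, h1, h2, rfl, ?_⟩))))
        rcases h.mid x h1 h2 with ⟨h3, h4⟩ | ⟨h3, h4⟩
        · exact .inl ⟨h3, by simp [columnMove, h1.ne', h2.ne, h1, h2, h3, h4, shiftPair]⟩
        · exact .inr ⟨h3, h4, by simp [columnMove, h1.ne', h2.ne, h1, h2, h3, h4, shiftPair]⟩
    · rcases eq_or_lt_of_le h1 with rfl | h1
      · refine .inr (.inl ⟨rfl, ?_⟩)
        rcases h.ne with h3 | h3
        · exact .inl ⟨h3, by simp [columnMove, h3]⟩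
        · exact .inr ⟨h3, by simp [columnMove, h3]⟩
      rcases eq_or_lt_of_le h2 with rfl | h2
      · refine .inr (.inr (.inr (.inl ⟨rfl, ?_⟩)))
        rcases h.bot with ⟨-, h4⟩ | ⟨-, h4⟩
        · exact .inl ⟨h4, by simp [columnMove, hne, h4]⟩
        · exact .inr ⟨h4, by simp [columnMove, hne, h4]⟩
      · refine .inr (.inr (.inr (.inr (.inr (.inl ⟨x, h1, h2, rfl, ?_⟩)))))
        rcases h.mid x h1 h2 with ⟨h3, h4⟩ | ⟨h3, h4⟩
        · exact .inl ⟨h3, h4, by simp [columnMove, h1.ne', h2.ne, h1, h2, h3, h4, shiftPair]⟩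
        · exact .inr ⟨h3, h4, by simp [columnMove, h1.ne', h2.ne, h1, h2, h3, h4, shiftPair]⟩
  · refine .inr (.inr (.inr (.inr (.inr (.inr ⟨hreg, ?_⟩)))))
    simp only [columnMove, Prod.mk.injEq]
    rw [if_neg (by omega), if_neg (by omega), if_neg (by omega), if_neg (by omega),
      if_neg (by omega), if_neg (by omega)]

/-- The vertical edges which are changed by a column move. -/
def vEdge (i i' j : ℤ) (p : ℤ × ℤ) : Bool :=
  decide (i ≤ p.1 ∧ p.1 < i' ∧ (p.2 = j ∨ p.2 = j + 1))

/-- The horizontal edges which are changed by a column move. -/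
def hEdge (i i' j : ℤ) (p : ℤ × ℤ) : Bool := decide (p.2 = j ∧ (p.1 = i ∨ p.1 = i'))

/-- The moving strand goes from one side of a rectangle to the other, so the toggled edges are those
on a closed loop: both vertical sides between rows `i` and `i'`, and the horizontal edges in these
two rows. -/
theorem edges (h : IsColumn D i i' j) (x y : ℤ) :
    (columnMove D i i' j (x, y)).south = ((D (x, y)).south ^^ vEdge i i' j (x, y)) ∧
    (columnMove D i i' j (x, y)).north = ((D (x, y)).north ^^ vEdge i i' j (x - 1, y)) ∧
    (columnMove D i i' j (x, y)).east = ((D (x, y)).east ^^ hEdge i i' j (x, y)) ∧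
    (columnMove D i i' j (x, y)).west = ((D (x, y)).west ^^ hEdge i i' j (x, y - 1)) := by
  have hlt := h.lt
  have e1 : vEdge i i' j (x, y) = decide (i ≤ x ∧ x < i' ∧ (y = j ∨ y = j + 1)) := rfl
  have e2 : vEdge i i' j (x - 1, y) = decide (i + 1 ≤ x ∧ x ≤ i' ∧ (y = j ∨ y = j + 1)) := by
    simp only [vEdge]; congr 1; rw [eq_iff_iff]; omega
  have e3 : hEdge i i' j (x, y) = decide (y = j ∧ (x = i ∨ x = i')) := rfl
  have e4 : hEdge i i' j (x, y - 1) = decide (y = j + 1 ∧ (x = i ∨ x = i')) := by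
    simp only [hEdge]; congr 1; rw [eq_iff_iff]; omega
  have key : ∀ (b1 b2 b3 b4 : Bool), (i ≤ x ∧ x < i' ∧ (y = j ∨ y = j + 1) ↔ b1 = true) →
      (i + 1 ≤ x ∧ x ≤ i' ∧ (y = j ∨ y = j + 1) ↔ b2 = true) →
      (y = j ∧ (x = i ∨ x = i') ↔ b3 = true) → (y = j + 1 ∧ (x = i ∨ x = i') ↔ b4 = true) →
      vEdge i i' j (x, y) = b1 ∧ vEdge i i' j (x - 1, y) = b2 ∧ hEdge i i' j (x, y) = b3 ∧
        hEdge i i' j (x, y - 1) = b4 := by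
    intro b1 b2 b3 b4 h1 h2 h3 h4
    rw [e1, e2, e3, e4]
    simp only [h1, h2, h3, h4, Bool.decide_eq_true, and_self]
  rcases h.tile_cases (x, y) with ⟨hp, h1⟩ | ⟨hp, ⟨h0, h1⟩ | ⟨h0, h1⟩⟩ |
    ⟨hp, ⟨h0, h1⟩ | ⟨h0, -, h1⟩⟩ | ⟨hp, ⟨h0, h1⟩ | ⟨h0, h1⟩⟩ |
    ⟨t, ht, ht', hp, ⟨h0, h1⟩ | ⟨h0, -, h1⟩⟩ |
    ⟨t, ht, ht', hp, ⟨-, h0, h1⟩ | ⟨-, h0, h1⟩⟩ | ⟨hp, h1⟩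
  · have h0 : D (x, y) = .blank := by rw [hp]; exact h.nw
    simp only [Prod.mk.injEq] at hp
    obtain ⟨k1, k2, k3, k4⟩ := key true false true false (by simp; omega) (by simp; omega)
      (by simp; omega) (by simp; omega)
    rw [h1, h0, k1, k2, k3, k4]; decide
  · simp only [Prod.mk.injEq] at hp
    obtain ⟨k1, k2, k3, k4⟩ := key true false false true (by simp; omega) (by simp; omega)
      (by simp; omega) (by simp; omega)
    rw [h1, h0, k1, k2, k3, k4]; decide
  · simp only [Prod.mk.injEq] at hp
    obtain ⟨k1, k2, k3, k4⟩ := key true false false true (by simp; omega) (by simp; omega)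
      (by simp; omega) (by simp; omega)
    rw [h1, h0, k1, k2, k3, k4]; decide
  · simp only [Prod.mk.injEq] at hp
    obtain ⟨k1, k2, k3, k4⟩ := key false true true false (by simp; omega) (by simp; omega)
      (by simp; omega) (by simp; omega)
    rw [h1, h0, k1, k2, k3, k4]; decide
  · simp only [Prod.mk.injEq] at hp
    obtain ⟨k1, k2, k3, k4⟩ := key false true true false (by simp; omega) (by simp; omega)
      (by simp; omega) (by simp; omega)
    rw [h1, h0, k1, k2, k3, k4]; decide
  · simp only [Prod.mk.injEq] at hp
    obtain ⟨k1, k2, k3, k4⟩ := key false true false true (by simp; omega) (by simp; omega)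
      (by simp; omega) (by simp; omega)
    rw [h1, h0, k1, k2, k3, k4]; decide
  · simp only [Prod.mk.injEq] at hp
    obtain ⟨k1, k2, k3, k4⟩ := key false true false true (by simp; omega) (by simp; omega)
      (by simp; omega) (by simp; omega)
    rw [h1, h0, k1, k2, k3, k4]; decide
  · simp only [Prod.mk.injEq] at hp
    obtain ⟨k1, k2, k3, k4⟩ := key true true false false (by simp; omega) (by simp; omega)
      (by simp; omega) (by simp; omega)
    rw [h1, h0, k1, k2, k3, k4]; decide
  · simp only [Prod.mk.injEq] at hp
    obtain ⟨k1, k2, k3, k4⟩ := key true true false false (by simp; omega) (by simp; omega)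
      (by simp; omega) (by simp; omega)
    rw [h1, h0, k1, k2, k3, k4]; decide
  · simp only [Prod.mk.injEq] at hp
    obtain ⟨k1, k2, k3, k4⟩ := key true true false false (by simp; omega) (by simp; omega)
      (by simp; omega) (by simp; omega)
    rw [h1, h0, k1, k2, k3, k4]; decide
  · simp only [Prod.mk.injEq] at hp
    obtain ⟨k1, k2, k3, k4⟩ := key true true false false (by simp; omega) (by simp; omega)
      (by simp; omega) (by simp; omega)
    rw [h1, h0, k1, k2, k3, k4]; decide
  · simp only at hp
    obtain ⟨k1, k2, k3, k4⟩ := key false false false false (by simp; omega) (by simp; omega)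
      (by simp; omega) (by simp; omega)
    rw [h1, k1, k2, k3, k4]; simp

theorem blank_iff (h : IsColumn D i i' j) (p : ℤ × ℤ) : columnMove D i i' j p = .blank ↔
    (D p = .blank ∧ ¬ (i ≤ p.1 ∧ p.1 < i' ∧ p.2 = j)) ∨
    (i < p.1 ∧ p.1 < i' ∧ p.2 = j + 1 ∧ D (p.1, j) = .blank) ∨
    (p = (i', j + 1) ∧ D p = .jay) := by
  have hlt := h.lt
  have hnj : D (i, j + 1) ≠ .blank ∧ D (i, j + 1) ≠ .jay := by
    rcases h.ne with h1 | h1 <;> simp [h1]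
  rcases h.tile_cases p with ⟨rfl, h1⟩ | ⟨rfl, ⟨h0, h1⟩ | ⟨h0, h1⟩⟩ |
    ⟨rfl, ⟨h0, h1⟩ | ⟨h0, -, h1⟩⟩ | ⟨rfl, ⟨h0, h1⟩ | ⟨h0, h1⟩⟩ |
    ⟨t, ht, ht', rfl, ⟨h0, h1⟩ | ⟨h0, -, h1⟩⟩ |
    ⟨t, ht, ht', rfl, ⟨h2, h0, h1⟩ | ⟨h2, h0, h1⟩⟩ | ⟨hp, h1⟩
  · simp [h1, hlt]
  · simp [h1, h0]
  · simp [h1, h0]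
  · simp [h1, h0]
  · simp [h1, h0]
  · simp [h1, h0]
  · simp [h1, h0]
  · simp [h1, ht.le, ht', ht'.ne]
  · simp [h1, h0]
  · simp [h1, h0, h2, ht, ht']
  · simp [h1, h0, h2]
  · rw [h1]
    have h2 : p ≠ (i', j + 1) := by
      rintro rfl; exact hp ⟨hlt.le, le_rfl, .inr rfl⟩
    constructor
    · exact fun h0 => .inl ⟨h0, fun h6 => hp ⟨h6.1, h6.2.1.le, .inl h6.2.2⟩⟩
    · rintro (⟨h0, -⟩ | ⟨h3, h4, h5, -⟩ | ⟨h3, -⟩)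
      · exact h0
      · omega
      · exact absurd h3 h2

/-- A column move preserves the properties of tilings for Grassmannian permutations. -/
theorem isGrassTiling {a b k : ℤ} (h : IsColumn D i i' j) (hD : IsGrassTiling a b k D)
    (hi : a ≤ i) (hik : i ≤ k) (hi' : i' ≤ b) (hj : a ≤ j) (hj' : j < b) :
    IsGrassTiling a b k (columnMove D i i' j) := by
  have hlt := h.lt
  refine ⟨hD.toIsMatched.toggle (vEdge i i' j) (hEdge i i' j) ?_ ?_ (fun x y => (h.edges x y).1)
    (fun x y => (h.edges x y).2.1) (fun x y => (h.edges x y).2.2.1)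
    (fun x y => (h.edges x y).2.2.2), ?_, ?_⟩
  · intro p hp
    simp only [vEdge, decide_eq_true_eq] at hp
    omega
  · intro p hp
    simp only [hEdge, decide_eq_true_eq] at hp
    omega
  · intro x y hx hc
    rcases h.tile_cases (x, y) with ⟨-, h1⟩ | ⟨-, ⟨h0, h1⟩ | ⟨h0, h1⟩⟩ |
      ⟨-, ⟨h0, h1⟩ | ⟨h0, -, h1⟩⟩ | ⟨-, ⟨h0, h1⟩ | ⟨h0, h1⟩⟩ |
      ⟨t, -, -, hp, ⟨h0, h1⟩ | ⟨h0, h2, h1⟩⟩ |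
      ⟨t, -, -, -, ⟨-, h0, h1⟩ | ⟨-, h0, h1⟩⟩ | ⟨-, h1⟩
    all_goals first
      | (rw [h1] at hc; simp at hc; done)
      | skip
    · simp only [Prod.mk.injEq] at hp
      rw [← hp.1] at h2
      exact hD.top x _ hx h2
    · rw [h1] at hc; exact hD.top x y hx hc
  · intro x y h1 h2 h3 h4
    obtain ⟨hb, hjay⟩ := hD.bottom x y h1 h2 h3 h4
    have hnj : ∀ y', D (x, y') ≠ .jay := by
      intro y' h0
      obtain ⟨-, g1, g2⟩ := hD.inGrid_of_ne (p := (x, y')) (by rw [h0]; simp)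
      exact (hD.bottom x y' h1 h2 g1 g2).2 h0
    have hnb : ∀ y', a ≤ y' → y' ≤ b → D (x, y') ≠ .blank := fun y' g1 g2 =>
      (hD.bottom x y' h1 h2 g1 g2).1
    constructor
    · intro hc
      rcases (h.blank_iff (x, y)).1 hc with ⟨h5, -⟩ | ⟨-, -, -, h5⟩ | ⟨-, h5⟩
      · exact hb h5
      · exact hnb j hj hj'.le h5
      · exact hjay h5
    · intro hc
      rcases h.tile_cases (x, y) with ⟨-, h6⟩ | ⟨hp, ⟨-, h6⟩ | ⟨-, h6⟩⟩ |
        ⟨hp, ⟨-, h6⟩ | ⟨-, h7, h6⟩⟩ | ⟨-, ⟨-, h6⟩ | ⟨-, h6⟩⟩ |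
        ⟨t, -, -, -, ⟨-, h6⟩ | ⟨-, -, h6⟩⟩ |
        ⟨t, -, -, -, ⟨-, -, h6⟩ | ⟨-, -, h6⟩⟩ | ⟨-, h6⟩
      all_goals first
        | (rw [h6] at hc; simp at hc; done)
        | skip
      · simp only [Prod.mk.injEq] at hp
        omega
      · simp only [Prod.mk.injEq] at hp
        rw [← hp.1] at h7
        exact hnj _ h7
      · rw [h6] at hc
        exact hjay hc

end IsColumn

/-! ### The columns below a removable or movable blank tile -/

section column

variable {a b k : ℤ} {D : Tiling}

theorem Tile.are_or_vert {t : Tile} (h : t ≠ .blank) (hw : t.west = false) :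
    t = .are ∨ t = .vert := by
  cases t <;> simp_all [Tile.west]

theorem Tile.eq_vert {t : Tile} (hn : t.north = true) (hw : t.west = false) : t = .vert := by
  cases t <;> simp_all [Tile.north, Tile.west]

theorem Tile.horiz_or_are {t : Tile} (h : t ≠ .blank) (hn : t.north = false) :
    t = .horiz ∨ t = .are := by
  cases t <;> simp_all [Tile.north]

theorem Tile.eq_cross {t : Tile} (hn : t.north = true) (hw : t.west = true) (h : t ≠ .jay) :
    t = .cross := by
  cases t <;> simp_all [Tile.west, Tile.north]

theorem Tile.vert_or_cross {t : Tile} (hn : t.north = true) (h : t ≠ .jay) :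
    t = .vert ∨ t = .cross := by
  cases t <;> simp_all [Tile.north]

/-- Next to a column of blank tiles there is a vertical pipe. -/
theorem IsMatched.beside_blanks (hD : IsMatched a b D) {i n j : ℤ} (hin : i ≤ n)
    (hbl : ∀ t, i ≤ t → t ≤ n → InGrid a b (t, j) ∧ D (t, j) = .blank) (hj : j < b)
    (hright : D (i, j + 1) ≠ .blank) :
    (D (i, j + 1) = .are ∨ D (i, j + 1) = .vert) ∧
      ∀ t, i < t → t ≤ n → D (t, j + 1) = .vert := by
  -- A blank tile closes the west side of its right neighbor. Such a neighbor, if not blank, has a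
  -- pipe to the south, and this pipe continues vertically along the whole block.
  have hw : ∀ t, i ≤ t → t ≤ n → (D (t, j + 1)).west = false := by
    intro t h1 h2
    obtain ⟨⟨⟨g1, g2⟩, g3, g4⟩, h3⟩ := hbl t h1 h2
    rw [← hD.horizontal t j g1 g2 g3 hj, h3]; rfl
  have h0 := Tile.are_or_vert hright (hw i le_rfl hin)
  refine ⟨h0, ?_⟩
  have key : ∀ m : ℕ, i + m + 1 ≤ n → D (i + m + 1, j + 1) = .vert := by
    intro m
    have hs : ∀ t, i ≤ t → t + 1 ≤ n → (D (t, j + 1)).south = true → D (t + 1, j + 1) = .vert := by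
      intro t h1 h2 h3
      obtain ⟨⟨⟨g1, -⟩, g3, -⟩, -⟩ := hbl t h1 (by omega)
      obtain ⟨⟨⟨-, g2⟩, -, -⟩, -⟩ := hbl (t + 1) (by omega) h2
      simp only at g1 g2 g3
      exact Tile.eq_vert (by rw [← hD.vertical t (j + 1) g1 (by omega) (by omega) hj, h3])
        (hw _ (by omega) h2)
    induction m with
    | zero =>
      intro h1
      simp only [Nat.cast_zero, add_zero] at h1 ⊢
      exact hs i le_rfl h1 (by rcases h0 with h0 | h0 <;> rw [h0] <;> rfl)
    | succ m ih =>
      intro h1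
      push_cast at h1 ⊢
      rw [← add_assoc] at h1 ⊢
      exact hs _ (by omega) h1 (by rw [ih (by omega)]; rfl)
  intro t h1 h2
  have := key (t - i - 1).toNat (by omega)
  rwa [show i + ((t - i - 1).toNat : ℤ) + 1 = t by omega] at this

/-- The column move below a column of blank tiles that does not reach row `k`. -/
theorem IsGrassTiling.column_move (hD : IsGrassTiling a b k D) {i n j : ℤ} (hin : i ≤ n)
    (hbl : ∀ t, i ≤ t → t ≤ n → InGrid a b (t, j) ∧ D (t, j) = .blank)
    (hright : D (i, j + 1) ≠ .blank) (hn : n < k) (hbelow : D (n + 1, j) ≠ .blank) :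
    IsColumn D i (n + 1) j ∧ D (n + 1, j + 1) = .jay ∧ CanUndroop D i (n + 1) j := by
  obtain ⟨hg, hb⟩ := hbl n hin le_rfl
  obtain ⟨hnb, hjb⟩ := hD.lt_of_blank hg hb
  obtain ⟨h0, h1⟩ := hD.beside_blanks hin hbl hjb hright
  have hr : D (n, j + 1) ≠ .blank := by
    rcases eq_or_lt_of_le hin with rfl | h2
    · exact hright
    · rw [h1 n h2 le_rfl]; simp
  have hjay := hD.jay_of_blank hg hb hn hr hbelow
  obtain ⟨⟨g1, -⟩, g3, g4⟩ := hg
  have hno : (D (n + 1, j)).north = false := by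
    rw [← hD.vertical n j g1 hnb g3 g4, hb]; rfl
  refine ⟨⟨by omega, (hbl i le_rfl hin).2, h0, fun t ht ht' =>
    .inl ⟨(hbl t ht.le (by omega)).2, h1 t ht (by omega)⟩,
    .inl ⟨Tile.horiz_or_are hbelow hno, hjay⟩⟩, hjay, by omega, hjay, fun t ht ht' =>
    .inl (h1 t ht (by omega))⟩

/-- Below row `k` there are no `jay`-tiles, so a pipe that is vertical there has come straight up
from the south border, and its label is its column. -/
theorem IsGrassTiling.visits_up (hD : IsGrassTiling a b k D) {i j : ℤ} (ha : a ≤ k) (hi : k ≤ i)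
    (hib : i ≤ b) (hj : a ≤ j) (hjb : j ≤ b) (hs : (D (i, j)).south = true) :
    Visits b D j true (i, j) := by
  have key : ∀ n : ℕ, ∀ i, i + n = b → k ≤ i → (D (i, j)).south = true →
      Visits b D j true (i, j) := by
    intro n
    induction n with
    | zero =>
      intro i h1 _ _
      obtain rfl : i = b := by simpa using h1
      exact .start
    | succ n ih =>
      intro i h1 h2 h3
      push_cast at h1
      have h4 : (D (i + 1, j)).north = true := by
        rw [← hD.vertical i j (by omega) (by omega) hj hjb, h3]
      have h5 := Tile.vert_or_cross h4 (hD.bottom (i + 1) j (by omega) (by omega) hj hjb).2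
      have h6 := ih (i + 1) (by omega) (by omega) (by rcases h5 with h5 | h5 <;> rw [h5] <;> rfl)
      simpa using Visits.up _ _ h6 h5
  exact key (b - i).toNat i (by omega) hi hs

/-- The column move below a column of blank tiles that reaches row `k`. -/
theorem IsGrassTiling.column_remove (hD : IsGrassTiling a b k D) {i j : ℤ} (hin : i ≤ k)
    (hbl : ∀ t, i ≤ t → t ≤ k → InGrid a b (t, j) ∧ D (t, j) = .blank)
    (hright : D (i, j + 1) ≠ .blank) :
    (¬ ∃ i'', CanUndroop D i i'' j) ∧ ∃ i', k < i' ∧ i' ≤ b ∧ IsColumn D i i' j ∧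
      CrossAt b D (j + 1) j (i', j + 1) ∧ ∀ t, k < t → t < i' → D (t, j) ≠ .blank := by
  obtain ⟨hg, hb⟩ := hbl k hin le_rfl
  obtain ⟨hnb, hjb⟩ := hD.lt_of_blank hg hb
  obtain ⟨h0, h1⟩ := hD.beside_blanks hin hbl hjb hright
  obtain ⟨⟨g1, -⟩, g3, g4⟩ := hg
  simp only at g1 g3 g4
  constructor
  · rintro ⟨i'', h2, h3, -⟩
    rcases le_or_gt i'' k with h4 | h4
    · rw [h1 i'' h2 h4] at h3; simp at h3
    · obtain ⟨⟨-, g5⟩, g6, g7⟩ := hD.inGrid_of_ne (p := (i'', j + 1)) (by rw [h3]; simp)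
      exact (hD.bottom _ _ h4 g5 g6 g7).2 h3
  have hsr : (D (k, j + 1)).south = true := by
    rcases eq_or_lt_of_le hin with rfl | h2
    · rcases h0 with h0 | h0 <;> rw [h0] <;> rfl
    · rw [h1 k h2 le_rfl]; rfl
  have hcross : ∀ t, k ≤ t → t < b → (D (t, j + 1)).south = true →
      (D (t + 1, j)).east = true → D (t + 1, j + 1) = .cross := by
    intro t h2 h3 h4 h5
    refine Tile.eq_cross ?_ ?_ (hD.bottom _ _ (by omega) (by omega) (by omega) (by omega)).2
    · rw [← hD.vertical t (j + 1) (by omega) h3 (by omega) (by omega), h4]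
    · rw [← hD.horizontal (t + 1) j (by omega) (by omega) g3 hjb, h5]
  have hcol : ∀ t, k ≤ t → t < b → (D (t, j)).south = false →
      D (t + 1, j) = .horiz ∨ D (t + 1, j) = .are := by
    intro t h2 h3 h4
    refine Tile.horiz_or_are (hD.bottom _ _ (by omega) (by omega) g3 (by omega)).1 ?_
    rw [← hD.vertical t j (by omega) h3 g3 (by omega), h4]
  -- Below row `k`, column `j` is closed from above until the first `are`, and consists of
  -- horizontal tiles up to there; it must open eventually, because the south border is open.
  -- Meanwhile column `j + 1` consists of crosses. In the row of the `are`, pipe `j` turns right and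
  -- crosses pipe `j + 1`.
  have key : ∀ n : ℕ, ∀ t, t + n = b → k ≤ t → (D (t, j)).south = false →
      (D (t, j + 1)).south = true → ∃ i', t < i' ∧ i' ≤ b ∧ D (i', j) = .are ∧
        D (i', j + 1) = .cross ∧
        ∀ u, t < u → u < i' → D (u, j) = .horiz ∧ D (u, j + 1) = .cross := by
    intro n
    induction n with
    | zero =>
      intro t h2 _ h3 _
      obtain rfl : t = b := by simpa using h2
      rw [(hD.border j g3 (by omega)).2.2.1] at h3
      simp at h3
    | succ n ih =>
      intro t h2 h3 h4 h5
      push_cast at h2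
      have h6 := hcol t h3 (by omega) h4
      have h7 := hcross t h3 (by omega) h5 (by rcases h6 with h6 | h6 <;> rw [h6] <;> rfl)
      rcases h6 with h6 | h6
      · obtain ⟨i', h8, h9, h10, h11, h12⟩ := ih (t + 1) (by omega) (by omega)
          (by rw [h6]; rfl) (by rw [h7]; rfl)
        refine ⟨i', by omega, h9, h10, h11, fun u h13 h14 => ?_⟩
        rcases eq_or_lt_of_le (show t + 1 ≤ u by omega) with rfl | h15
        · exact ⟨h6, h7⟩
        · exact h12 u h15 h14
      · exact ⟨t + 1, by omega, by omega, h6, h7, fun u _ _ => by omega⟩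
  obtain ⟨i', h2, h3, h4, h5, h6⟩ := key (b - k).toNat k (by omega) le_rfl (by rw [hb]; rfl) hsr
  refine ⟨i', h2, h3, ⟨by omega, (hbl i le_rfl hin).2, h0, fun t ht ht' => ?_, .inr ⟨h4, h5⟩⟩,
    ⟨h5, hD.visits_up g1 h2.le h3 (by omega) (by omega) (by rw [h5]; rfl),
      .turnEast _ _ (hD.visits_up g1 h2.le h3 g3 (by omega) (by rw [h4]; rfl)) h4⟩,
    fun t ht ht' => by rw [(h6 t ht ht').1]; simp⟩
  rcases le_or_gt t k with h7 | h7
  · exact .inl ⟨(hbl t ht.le h7).2, h1 t ht h7⟩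
  · exact .inr (h6 t h7 ht')

end column

/-- The steps on marked bumpless pipe dreams are deterministic, once a tile is active. -/
theorem BPDStep.deterministic {a b : ℤ} {w : Equiv.Perm ℤ} {M M' M'' : MarkedBPD}
    {κ κ' : StepKind} {i j : ℤ} (hM : IsBPD a b w M.tiles) (ha : M.active = some (i, j))
    (hj : a ≤ j) (hjb : j < b) (h : BPDStep b κ M M') (h' : BPDStep b κ' M M'') :
    κ = κ' ∧ M' = M'' := by
  have hslide : ∀ {j₁ j₂ : ℤ}, (∀ y, j < y → y ≤ j₁ → M.tiles (i, y) = .blank) → j < j₂ →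
      M.tiles (i, j₂ + 1) ≠ .blank → j₁ ≤ j₂ := by
    intro j₁ j₂ h1 h2 h3
    by_contra h4
    exact h3 (h1 _ (by omega) (by omega))
  have hmove : ∀ {i₁ i₂ : ℤ}, CanUndroop M.tiles i i₁ j → CanUndroop M.tiles i i₂ j →
      i₁ ≤ i₂ := by
    rintro i₁ i₂ ⟨-, -, h1⟩ ⟨h2, h3, -⟩
    by_contra h4
    rcases h1 i₂ h2 (by omega) with h5 | h5 <;> rw [h5] at h3 <;> simp at h3
  cases h with
  | pick _ p h0 _ => rw [h0] at ha; simp at ha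
  | slide _ i₁ j₁ j₂ h0 h1 h2 h3 =>
    rw [h0] at ha
    simp only [Option.some.injEq, Prod.mk.injEq] at ha
    obtain ⟨rfl, rfl⟩ := ha
    cases h' with
    | pick _ p h4 _ => rw [h0] at h4; simp at h4
    | slide _ i₃ j₃ j₄ h4 h5 h6 h7 =>
      rw [h0] at h4
      simp only [Option.some.injEq, Prod.mk.injEq] at h4
      obtain ⟨rfl, rfl⟩ := h4
      obtain rfl : j₂ = j₄ := le_antisymm (hslide h2 h5 h7) (hslide h6 h1 h3)
      exact ⟨rfl, rfl⟩
    | move _ i₃ i₄ j₃ h4 h5 h6 =>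
      rw [h0] at h4
      simp only [Option.some.injEq, Prod.mk.injEq] at h4
      obtain ⟨rfl, rfl⟩ := h4
      exact absurd (h2 _ (by omega) (by omega)) h5
    | remove _ i₃ i₄ j₃ h4 h5 h6 h7 h8 =>
      rw [h0] at h4
      simp only [Option.some.injEq, Prod.mk.injEq] at h4
      obtain ⟨rfl, rfl⟩ := h4
      exact absurd (h2 _ (by omega) (by omega)) h5
  | move _ i₁ i₂ j₁ h0 h1 h2 =>
    rw [h0] at ha
    simp only [Option.some.injEq, Prod.mk.injEq] at ha
    obtain ⟨rfl, rfl⟩ := ha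
    cases h' with
    | pick _ p h4 _ => rw [h0] at h4; simp at h4
    | slide _ i₃ j₃ j₄ h4 h5 h6 h7 =>
      rw [h0] at h4
      simp only [Option.some.injEq, Prod.mk.injEq] at h4
      obtain ⟨rfl, rfl⟩ := h4
      exact absurd (h6 _ (by omega) (by omega)) h1
    | move _ i₃ i₄ j₃ h4 h5 h6 =>
      rw [h0] at h4
      simp only [Option.some.injEq, Prod.mk.injEq] at h4
      obtain ⟨rfl, rfl⟩ := h4
      obtain rfl : i₂ = i₄ := le_antisymm (hmove h2 h6) (hmove h6 h2)
      exact ⟨rfl, rfl⟩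
    | remove _ i₃ i₄ j₃ h4 h5 h6 h7 h8 =>
      rw [h0] at h4
      simp only [Option.some.injEq, Prod.mk.injEq] at h4
      obtain ⟨rfl, rfl⟩ := h4
      exact absurd ⟨_, h2⟩ h6
  | remove _ i₁ i₂ j₁ h0 h1 h2 hlt hc =>
    rw [h0] at ha
    simp only [Option.some.injEq, Prod.mk.injEq] at ha
    obtain ⟨rfl, rfl⟩ := ha
    cases h' with
    | pick _ p h4 _ => rw [h0] at h4; simp at h4
    | slide _ i₃ j₃ j₄ h4 h5 h6 h7 =>
      rw [h0] at h4
      simp only [Option.some.injEq, Prod.mk.injEq] at h4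
      obtain ⟨rfl, rfl⟩ := h4
      exact absurd (h6 _ (by omega) (by omega)) h1
    | move _ i₃ i₄ j₃ h4 h5 h6 =>
      rw [h0] at h4
      simp only [Option.some.injEq, Prod.mk.injEq] at h4
      obtain ⟨rfl, rfl⟩ := h4
      exact absurd ⟨_, h6⟩ h2
    | remove _ i₃ i₄ j₃ h4 h5 h6 h7 h8 =>
      rw [h0] at h4
      simp only [Option.some.injEq, Prod.mk.injEq] at h4
      obtain ⟨rfl, rfl⟩ := h4
      -- Two removals could only differ in the crossing that is used, but the pipes `j` and `j + 1`
      -- cross at most once.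
      have h9 := hM.reduced (j₁ + 1) j₁ (by omega) (by omega) hj (by omega) _ _
        (.inl hc) (.inl h8)
      simp only [Prod.mk.injEq] at h9
      obtain ⟨rfl, -⟩ := h9
      exact ⟨rfl, rfl⟩

/-! ### Corresponding marked tableaux and marked bumpless pipe dreams -/

/-- The explicit form of the correspondence. -/
structure TileMatch (a b k : ℤ) (s : MarkedTableau) (M : MarkedBPD) : Prop where
  tiling : IsGrassTiling a b k M.tiles
  blanks : BlanksAt a b s.entries M.tiles
  marks : ∀ q, q ∈ M.marks ↔ ∃ p ∈ s.marks, tilePos s.entries p = some q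
  active : s.active.map (tilePos s.entries) = M.active.map some

section correspondence

variable {a b k : ℤ} {nu mu lam inner : YoungDiagram} {s s' : MarkedTableau} {κ : StepKind}
  {M : MarkedBPD}

theorem IsSSYT.exists_tilePos {lo hi : ℤ} {S : Filling} (hS : IsSSYT lam ⊥ lo hi S)
    {p : ℕ × ℕ} (hp : p ∈ lam) : ∃ q, tilePos S p = some q := by
  obtain ⟨x, hx⟩ := hS.exists_eq hp
  exact ⟨(x, x + p.2 - p.1), tilePos_eq_some.2 ⟨hx, rfl⟩⟩

theorem TileMatch.exists_perm (h : TileMatch a b k s M) (hS : IsSSYT lam ⊥ a k s.entries)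
    (ha : a ≤ k) (hb : k + lam.rowLen 0 ≤ b) :
    ∃ w, IsGrassmannian a b k w ∧ IsBPD a b w M.tiles := by
  obtain ⟨w, hw, hsh⟩ := exists_isShapeOf ha hS.row_le hb
  exact ⟨w, hw, h.tiling.isBPD_of_shape hS h.blanks ha (by omega) hw hsh⟩

/-- Drooping yields the tableau with the blank positions of `M`, and the entries of `s` are the
first coordinates of these positions. So the map `O` of origins has to be `tilePos s.entries`. -/
theorem corresponds_iff (hS : IsSSYT lam ⊥ a k s.entries) (ha : a ≤ k)
    (hb : k + lam.rowLen 0 ≤ b) (hm : ∀ p ∈ s.marks, p ∈ lam) :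
    Corresponds a b k s M ↔ TileMatch a b k s M := by
  have hkb : k ≤ b := by omega
  constructor
  · rintro ⟨⟨w, hw, hD⟩, hmb, O, hO, hE, hmarks, hact⟩
    have hG := hD.isGrassTiling hw ha hkb
    obtain ⟨lam', S', hS', hb', -⟩ := hG.exists_blanksAt ha hkb
    rw [hG.originTableau_iff ha hkb hS' hb'] at hO
    subst hO
    have hSS : s.entries = S' := by
      funext p
      rw [hE, tilePos_map_fst]
    rw [← hSS] at hmarks hact hb'
    refine ⟨hG, hb', fun q => ⟨fun hq => ?_, ?_⟩, hact⟩
    · obtain ⟨p, hp⟩ := (hb' q).1 (hmb q hq)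
      exact ⟨p, (hmarks p).2 ⟨q, hq, hp⟩, hp⟩
    · rintro ⟨p, hp, hpq⟩
      obtain ⟨q', hq', h1⟩ := (hmarks p).1 hp
      rw [hpq] at h1
      simp only [Option.some.injEq] at h1
      rwa [h1]
  · intro h
    refine ⟨h.exists_perm hS ha hb, fun q hq => ?_, tilePos s.entries,
      (h.tiling.originTableau_iff ha hkb hS h.blanks _).2 rfl,
      fun p => (tilePos_map_fst _ p).symm, fun p => ⟨fun hp => ?_, ?_⟩, h.active⟩
    · obtain ⟨p, -, hp⟩ := (h.marks q).1 hq
      exact (h.blanks q).2 ⟨p, hp⟩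
    · obtain ⟨q, hq⟩ := hS.exists_tilePos (hm p hp)
      exact ⟨q, (h.marks q).2 ⟨p, hp, hq⟩, hq⟩
    · rintro ⟨q, hq, hpq⟩
      obtain ⟨p', hp', h1⟩ := (h.marks q).1 hq
      rwa [hS.tilePos_inj hpq h1]

/-- A marked tableau corresponds to exactly one marked bumpless pipe dream. -/
theorem existsUnique_tileMatch (hS : IsSSYT lam ⊥ a k s.entries) (ha : a ≤ k)
    (hb : k + lam.rowLen 0 ≤ b) (hm : ∀ p ∈ s.marks, p ∈ lam)
    (hact : ∀ p, s.active = some p → p ∈ lam) : ∃! M, TileMatch a b k s M := by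
  obtain ⟨D, hD, hbl⟩ := hS.exists_tiling ha hb
  have hact' : s.active.map (tilePos s.entries) = (s.active.bind (tilePos s.entries)).map some := by
    cases h0 : s.active with
    | none => rfl
    | some p =>
      obtain ⟨q, hq⟩ := hS.exists_tilePos (hact p h0)
      simp [hq]
  refine ⟨⟨D, s.marks.image fun p => (tilePos s.entries p).getD 0,
    s.active.bind (tilePos s.entries)⟩, ⟨hD, hbl, fun q => ?_, hact'⟩, ?_⟩
  · simp only [Finset.mem_image]
    refine exists_congr fun p => and_congr_right fun hp => ?_
    obtain ⟨q', hq'⟩ := hS.exists_tilePos (hm p hp)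
    simp [hq']
  · rintro ⟨D', m', act'⟩ ⟨h1, h2, h3, h4⟩
    simp only at h1 h2 h3 h4
    rw [MarkedBPD.mk.injEq]
    refine ⟨h2.tiling_unique h1 hD hbl, ?_, ?_⟩
    · ext q
      rw [h3, Finset.mem_image]
      refine exists_congr fun p => and_congr_right fun hp => ?_
      obtain ⟨q', hq'⟩ := hS.exists_tilePos (hm p hp)
      simp [hq']
    · rw [hact'] at h4
      exact Option.map_injective (Option.some_injective _) h4.symm

theorem RunInv.marks_mem (h : RunInv a k nu mu s lam inner) : ∀ p ∈ s.marks, p ∈ lam := by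
  intro p hp
  cases h0 : s.active with
  | none =>
    rw [h.marks_none h0] at hp
    exact h.inner_sub p hp
  | some p' =>
    obtain ⟨-, h1, h2⟩ := h.marks_some p' h0
    rw [h2, Finset.mem_insert] at hp
    rcases hp with rfl | hp
    · exact h1
    · exact h.inner_sub p hp

theorem rowLen_le_of_le (h : lam ≤ nu) (r : ℕ) : lam.rowLen r ≤ nu.rowLen r := by
  by_contra hc
  have h1 : (r, nu.rowLen r) ∈ lam := YoungDiagram.mem_iff_lt_rowLen.2 (by omega)
  exact absurd (YoungDiagram.mem_iff_lt_rowLen.1 (h h1)) (lt_irrefl _)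

theorem RunInv.corresponds_iff (h : RunInv a k nu mu s lam inner) (ha : a ≤ k)
    (hb : k + nu.rowLen 0 ≤ b) : Corresponds a b k s M ↔ TileMatch a b k s M :=
  Taquin.corresponds_iff h.ssyt ha (by have := rowLen_le_of_le h.le 0; omega) h.marks_mem

theorem RunInv.existsUnique_corresponds (h : RunInv a k nu mu s lam inner) (ha : a ≤ k)
    (hb : k + nu.rowLen 0 ≤ b) : ∃! M, Corresponds a b k s M := by
  simp only [h.corresponds_iff ha hb]
  exact existsUnique_tileMatch h.ssyt ha (by have := rowLen_le_of_le h.le 0; omega) h.marks_mem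
    fun p hp => (h.marks_some p hp).2.1

theorem RunInv.tilePos_inner (h : RunInv a k nu mu s lam inner) {p : ℕ × ℕ} (hp : p ∈ inner) :
    tilePos s.entries p = some (a + p.1, a + p.2) :=
  tilePos_eq_some.2 ⟨h.inner_entry p hp, by simp only; ring⟩

/-- The marked tiles when no tile is active. -/
theorem TileMatch.marks_of_none (hM : TileMatch a b k s M) (h : RunInv a k nu mu s lam inner)
    (ha : s.active = none) :
    M.marks = inner.cells.image fun p => (a + (p.1 : ℤ), a + (p.2 : ℤ)) := by
  ext q
  rw [hM.marks, h.marks_none ha, Finset.mem_image]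
  refine exists_congr fun p => and_congr_right fun hp => ?_
  rw [h.tilePos_inner ((YoungDiagram.mem_cells _).1 hp), Option.some.injEq]

theorem TileMatch.active_of_none (hM : TileMatch a b k s M) (ha : s.active = none) :
    M.active = none := by
  have := hM.active
  rw [ha] at this
  simpa using this.symm

theorem TileMatch.active_of_some (hM : TileMatch a b k s M) {p : ℕ × ℕ} {q : ℤ × ℤ}
    (ha : s.active = some p) (hp : tilePos s.entries p = some q) : M.active = some q := by
  have := hM.active
  rw [ha, Option.map_some, hp] at this
  cases hq : M.active with
  | none => rw [hq] at this; simp at this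
  | some q' => rw [hq] at this; simpa using this.symm

/-- SE-most marks correspond to SE-most marks. -/
theorem TileMatch.maximal_iff (hM : TileMatch a b k s M) (h : RunInv a k nu mu s lam inner)
    (ha : s.active = none) {q : ℤ × ℤ} : Maximal (· ∈ M.marks) q ↔
      ∃ p, Maximal (· ∈ s.marks) p ∧ q = (a + (p.1 : ℤ), a + (p.2 : ℤ)) := by
  have hle : ∀ p p' : ℕ × ℕ, ((a + (p.1 : ℤ), a + (p.2 : ℤ)) : ℤ × ℤ) ≤ (a + p'.1, a + p'.2) ↔
      p ≤ p' := by
    intro p p'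
    rw [Prod.mk_le_mk, Prod.le_def]
    omega
  rw [hM.marks_of_none h ha, h.marks_none ha]
  constructor
  · rintro ⟨h1, h2⟩
    obtain ⟨p, hp, rfl⟩ := Finset.mem_image.1 h1
    exact ⟨p, ⟨hp, fun p' hp' hpp => (hle _ _).1
      (h2 (Finset.mem_image_of_mem _ hp') ((hle _ _).2 hpp))⟩, rfl⟩
  · rintro ⟨p, ⟨h1, h2⟩, rfl⟩
    refine ⟨Finset.mem_image_of_mem _ h1, fun q' hq' hqq => ?_⟩
    obtain ⟨p', hp', rfl⟩ := Finset.mem_image.1 hq'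
    exact (hle _ _).2 (h2 hp' ((hle _ _).1 hqq))

theorem TileMatch.pick (hM : TileMatch a b k s M) (h : RunInv a k nu mu s lam inner)
    {p : ℕ × ℕ} (hp : Maximal (· ∈ s.marks) p) (ha : s.active = none) :
    TileMatch a b k ⟨s.entries, s.marks, some p, false⟩
      ⟨M.tiles, M.marks, some (a + (p.1 : ℤ), a + (p.2 : ℤ))⟩ := by
  have hp' : p ∈ inner := by
    have := hp.prop
    rwa [h.marks_none ha, YoungDiagram.mem_cells] at this
  refine ⟨hM.tiling, hM.blanks, hM.marks, ?_⟩
  simp [h.tilePos_inner hp']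

theorem TileMatch.mem_erase (hM : TileMatch a b k s M) (hS : IsSSYT lam ⊥ a k s.entries)
    {p : ℕ × ℕ} {q : ℤ × ℤ} (hp : tilePos s.entries p = some q) {S' : Filling}
    (hS' : ∀ p' ∈ s.marks.erase p, tilePos S' p' = tilePos s.entries p') (q' : ℤ × ℤ) :
    q' ∈ M.marks.erase q ↔ ∃ p' ∈ s.marks.erase p, tilePos S' p' = some q' := by
  rw [Finset.mem_erase, hM.marks]
  constructor
  · rintro ⟨hne, p', hp', h1⟩
    have : p' ∈ s.marks.erase p := by
      rw [Finset.mem_erase]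
      refine ⟨?_, hp'⟩
      rintro rfl
      rw [hp] at h1
      exact hne (by simpa using h1.symm)
    exact ⟨p', this, by rw [hS' p' this, h1]⟩
  · rintro ⟨p', hp', h1⟩
    rw [hS' p' hp'] at h1
    rw [Finset.mem_erase] at hp'
    refine ⟨?_, p', hp'.2, h1⟩
    rintro rfl
    exact hp'.1 (hS.tilePos_inj h1 hp)

theorem TileMatch.mem_insert_erase (hM : TileMatch a b k s M)
    (hS : IsSSYT lam ⊥ a k s.entries) {p p₁ : ℕ × ℕ} {q q₁ : ℤ × ℤ}
    (hp : tilePos s.entries p = some q) {S' : Filling} (hp₁ : tilePos S' p₁ = some q₁)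
    (hS' : ∀ p' ∈ s.marks.erase p, tilePos S' p' = tilePos s.entries p') (q' : ℤ × ℤ) :
    q' ∈ insert q₁ (M.marks.erase q) ↔
      ∃ p' ∈ insert p₁ (s.marks.erase p), tilePos S' p' = some q' := by
  rw [Finset.mem_insert, hM.mem_erase hS hp hS']
  simp only [Finset.mem_insert, or_and_right, exists_or, exists_eq_left, hp₁, Option.some.injEq]
  rw [eq_comm]

theorem TileMatch.slide (hM : TileMatch a b k s M) (h : RunInv a k nu mu s lam inner)
    {r c c' : ℕ} {x : ℤ} (ha : s.active = some (r, c)) (hx : s.entries (r, c) = some x)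
    (hc : c < c') (hc' : s.entries (r, c') = some x)
    (hmax : ∀ c'', c' < c'' → s.entries (r, c'') ≠ some x) :
    ∃ M', BPDStep b .slide M M' ∧ TileMatch a b k
      ⟨s.entries, insert (r, c') (s.marks.erase (r, c)), some (r, c'), false⟩ M' := by
  have hpos : ∀ c'', s.entries (r, c'') = some x →
      tilePos s.entries (r, c'') = some (x, x + c'' - r) := fun c'' h0 =>
    tilePos_eq_some.2 ⟨h0, rfl⟩
  refine ⟨_, .slide M x (x + c - r) (x + c' - r) (hM.active_of_some ha (hpos c hx)) (by omega)
    ?_ ?_, hM.tiling, hM.blanks, ?_, ?_⟩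
  · intro y h1 h2
    obtain ⟨n, hn⟩ := Int.eq_ofNat_of_zero_le (show 0 ≤ y - x + r by omega)
    obtain rfl : y = x + n - r := by omega
    have h3 : c ≤ n := by omega
    have h4 : n ≤ c' := by omega
    obtain ⟨z, hz⟩ := h.ssyt.exists_eq (lam.up_left_mem le_rfl h4 (h.ssyt.mem_of_eq hc'))
    have h5 := h.ssyt.le_of_le le_rfl h3 hx hz
    have h6 := h.ssyt.le_of_le le_rfl h4 hz hc'
    obtain rfl : z = x := by omega
    exact ((hM.blanks _).2 ⟨_, hpos n hz⟩).2
  · obtain ⟨g1, g2⟩ := (hM.blanks _).2 ⟨_, hpos c' hc'⟩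
    rw [Ne, hM.blanks.right_iff h.ssyt (hpos c' hc') (hM.tiling.lt_of_blank g1 g2).2]
    exact hmax _ (Nat.lt_succ_self c')
  · exact hM.mem_insert_erase h.ssyt (hpos c hx) (hpos c' hc') fun _ _ => rfl
  · simp [hpos c' hc']

/-- The common form of the two changes: `m + 1` blank tiles in a column are replaced by `n` blank
tiles one step to the SE. A column move has `n = m + 1`, and a removal has `n = m`. -/
theorem BlanksAt.of_shift {S S' : Filling} {D D' : Tiling} (h : BlanksAt a b S D)
    {r c m n : ℕ} {x j : ℤ}
    (hcol : ∀ p q, tilePos S q = some p → ((∃ t ≤ m, q = (r + t, c)) ↔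
      ∃ t : ℕ, t ≤ m ∧ p = (x + t, j)))
    (hS : ∀ p q, tilePos S' q = some p ↔ (tilePos S q = some p ∧ ¬ ∃ t ≤ m, q = (r + t, c)) ∨
      ∃ t < n, q = (r + t, c) ∧ p = (x + t + 1, j + 1))
    (hD : ∀ p, D' p = .blank ↔ (D p = .blank ∧ ¬ ∃ t : ℕ, t ≤ m ∧ p = (x + t, j)) ∨
      ∃ t : ℕ, t < n ∧ p = (x + t + 1, j + 1))
    (hg : ∀ t : ℕ, t < n → InGrid a b (x + t + 1, j + 1)) :
    BlanksAt a b S' D' := by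
  intro p
  simp only [hS, hD]
  constructor
  · rintro ⟨h1, ⟨h2, h3⟩ | ⟨t, ht, rfl⟩⟩
    · obtain ⟨q, hq⟩ := (h p).1 ⟨h1, h2⟩
      exact ⟨q, .inl ⟨hq, fun h0 => h3 ((hcol p q hq).1 h0)⟩⟩
    · exact ⟨_, .inr ⟨t, ht, rfl, rfl⟩⟩
  · rintro ⟨q, ⟨h1, h2⟩ | ⟨t, ht, -, rfl⟩⟩
    · obtain ⟨h3, h4⟩ := (h p).2 ⟨q, h1⟩
      exact ⟨h3, .inl ⟨h4, fun h0 => h2 ((hcol p q h1).2 h0)⟩⟩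
    · exact ⟨hg t ht, .inr ⟨t, ht, rfl⟩⟩

theorem IsBumpable.tilePos_eq {S : Filling} {r c m : ℕ} {x : ℤ} (hb : IsBumpable S r c x m)
    {t : ℕ} (ht : t ≤ m) : tilePos S (r + t, c) = some (x + t, x + c - r) :=
  tilePos_eq_some.2 ⟨hb.col t ht, by push_cast; ring⟩

theorem IsBumpable.mem_col_iff {lo hi : ℤ} {S : Filling} {r c m : ℕ} {x : ℤ}
    (hb : IsBumpable S r c x m) (hS : IsSSYT lam ⊥ lo hi S) (p : ℤ × ℤ) (q : ℕ × ℕ)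
    (hpq : tilePos S q = some p) :
    (∃ t ≤ m, q = (r + t, c)) ↔ ∃ t : ℕ, t ≤ m ∧ p = (x + t, x + c - r) := by
  constructor
  · rintro ⟨t, ht, rfl⟩
    rw [hb.tilePos_eq ht] at hpq
    exact ⟨t, ht, by simpa using hpq.symm⟩
  · rintro ⟨t, ht, rfl⟩
    exact ⟨t, ht, hS.tilePos_inj hpq (hb.tilePos_eq ht)⟩

theorem tilePos_bump_iff {S : Filling} {r c m : ℕ} {x : ℤ} (p : ℤ × ℤ) (q : ℕ × ℕ) :
    tilePos (bump S r c x m) q = some p ↔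
      (tilePos S q = some p ∧ ¬ ∃ t ≤ m, q = (r + t, c)) ∨
      ∃ t < m + 1, q = (r + t, c) ∧ p = (x + t + 1, x + c - r + 1) := by
  by_cases hq : ∃ t ≤ m, q = (r + t, c)
  · obtain ⟨t, ht, rfl⟩ := hq
    have h1 : tilePos (bump S r c x m) (r + t, c) = some (x + t + 1, x + c - r + 1) :=
      tilePos_eq_some.2 ⟨bump_add ht, by push_cast; ring⟩
    rw [h1, Option.some.injEq]
    constructor
    · rintro rfl
      exact .inr ⟨t, by omega, rfl, rfl⟩
    · rintro (⟨-, h2⟩ | ⟨t', -, h2, rfl⟩)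
      · exact absurd ⟨t, ht, rfl⟩ h2
      · simp only [Prod.mk.injEq, and_true] at h2
        obtain rfl : t = t' := by omega
        rfl
  · have h1 : tilePos (bump S r c x m) q = tilePos S q := by
      rw [tilePos, tilePos, bump_of_ne]
      rintro ⟨h2, h3, h4⟩
      exact hq ⟨q.1 - r, by omega, Prod.ext (by simp only; omega) h2⟩
    rw [h1]
    constructor
    · exact fun h2 => .inl ⟨h2, hq⟩
    · rintro (⟨h2, -⟩ | ⟨t, ht, h2, -⟩)
      · exact h2
      · exact absurd ⟨t, by omega, h2⟩ hq

theorem tilePos_bump_erase_iff {S : Filling} {r c m : ℕ} {x : ℤ} (p : ℤ × ℤ) (q : ℕ × ℕ) :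
    tilePos (Function.update (bump S r c x m) (r + m, c) none) q = some p ↔
      (tilePos S q = some p ∧ ¬ ∃ t ≤ m, q = (r + t, c)) ∨
      ∃ t < m, q = (r + t, c) ∧ p = (x + t + 1, x + c - r + 1) := by
  by_cases hq : q = (r + m, c)
  · subst hq
    simp only [tilePos, Function.update_self, Option.map_none, reduceCtorEq, false_iff, not_or]
    refine ⟨fun h0 => h0.2 ⟨m, le_rfl, rfl⟩, ?_⟩
    rintro ⟨t, ht, h1, -⟩
    simp only [Prod.mk.injEq] at h1
    omega
  · have h1 : tilePos (Function.update (bump S r c x m) (r + m, c) none) q =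
        tilePos (bump S r c x m) q := by
      rw [tilePos, tilePos, Function.update_of_ne hq]
    rw [h1, tilePos_bump_iff]
    refine or_congr Iff.rfl (exists_congr fun t => ?_)
    constructor
    · rintro ⟨h2, rfl, h3⟩
      exact ⟨lt_of_le_of_ne (by omega) fun h0 => hq (by rw [h0]), rfl, h3⟩
    · rintro ⟨h2, h3⟩
      exact ⟨by omega, h3⟩

end correspondence

/-! ### The algorithms agree -/

section agree

variable {a b k : ℤ} {nu mu lam inner : YoungDiagram} {s s' : MarkedTableau} {κ : StepKind}
  {M : MarkedBPD}

/-- The tiles around a column of entries that will be incremented. -/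
theorem TileMatch.column_tiles (hM : TileMatch a b k s M) (hS : IsSSYT lam ⊥ a k s.entries)
    {r c m : ℕ} {x : ℤ} (hb : IsBumpable s.entries r c x m)
    (hr : s.entries (r, c + 1) ≠ some x) :
    (∀ t, x ≤ t → t ≤ x + m → InGrid a b (t, x + c - r) ∧ M.tiles (t, x + c - r) = .blank) ∧
    M.tiles (x, x + c - r + 1) ≠ .blank ∧ M.tiles (x + m + 1, x + c - r) ≠ .blank ∧
    x + m < b ∧ x + c - r < b := by
  have h1 : ∀ t, x ≤ t → t ≤ x + m →
      InGrid a b (t, x + c - r) ∧ M.tiles (t, x + c - r) = .blank := by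
    intro t ht ht'
    refine (hM.blanks _).2 ⟨(r + (t - x).toNat, c), ?_⟩
    rw [hb.tilePos_eq (by omega), show x + ((t - x).toNat : ℤ) = t by omega]
  obtain ⟨h2, h3⟩ := h1 (x + m) (by omega) le_rfl
  obtain ⟨h4, h5⟩ := hM.tiling.lt_of_blank h2 h3
  refine ⟨h1, ?_, ?_, h4, h5⟩
  · have h6 : tilePos s.entries (r, c) = some (x, x + c - r) := by
      simpa using hb.tilePos_eq (Nat.zero_le m)
    rwa [Ne, hM.blanks.right_iff hS h6 h5]
  · rw [Ne, hM.blanks.below_iff hS (hb.tilePos_eq le_rfl) h4]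
    have := hb.next_ne
    push_cast at this
    rwa [← add_assoc, ← add_assoc] at this

theorem RunInv.tilePos_bump_marks (h : RunInv a k nu mu s lam inner) {r c : ℕ}
    (ha : s.active = some (r, c)) (x : ℤ) (m : ℕ) {p : ℕ × ℕ} (hp : p ∈ s.marks.erase (r, c)) :
    tilePos (bump s.entries r c x m) p = tilePos s.entries p ∧ p ≠ (r + m, c) := by
  obtain ⟨h1, -, h2⟩ := h.marks_some _ ha
  rw [h2, Finset.erase_insert (by rwa [YoungDiagram.mem_cells]), YoungDiagram.mem_cells] at hp
  constructor
  · rw [tilePos, tilePos, h.bump_inner ha x m p hp, h.inner_entry p hp]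
  · rintro rfl
    exact h.inner_ne ha (Nat.le_add_right r m) le_rfl hp

theorem TileMatch.move (hM : TileMatch a b k s M) (h : RunInv a k nu mu s lam inner)
    {r c m : ℕ} {x : ℤ} (ha : s.active = some (r, c)) (hb : IsBumpable s.entries r c x m)
    (hr : s.entries (r, c + 1) ≠ some x) (hk : x + m < k) :
    ∃ M', BPDStep b .move M M' ∧ TileMatch a b k ⟨bump s.entries r c x m,
      insert (r + m, c) (s.marks.erase (r, c)), some (r + m, c), true⟩ M' := by
  obtain ⟨hbl, hright, hbelow, hmb, hjb⟩ := hM.column_tiles h.ssyt hb hr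
  obtain ⟨hcol, hjay, hund⟩ := hM.tiling.column_move (by omega) hbl hright hk hbelow
  obtain ⟨⟨⟨g1, g2⟩, g3, g4⟩, -⟩ := hbl x le_rfl (by omega)
  simp only at g1 g2 g3 g4
  have hpos : tilePos s.entries (r, c) = some (x, x + c - r) := by
    simpa using hb.tilePos_eq (Nat.zero_le m)
  have hpos' : tilePos (bump s.entries r c x m) (r + m, c) = some (x + m + 1, x + c - r + 1) :=
    (tilePos_bump_iff _ _).2 (.inr ⟨m, Nat.lt_succ_self m, rfl, rfl⟩)
  have hcolb := hb.mem_col_iff h.ssyt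
  have hS' := tilePos_bump_iff (S := s.entries) (r := r) (c := c) (m := m) (x := x)
  generalize x + (c : ℤ) - r = j at *
  refine ⟨_, .move M x (x + m + 1) j (hM.active_of_some ha hpos) hright hund,
    hcol.isGrassTiling hM.tiling g1 (by omega) (by omega) g3 hjb, ?_, ?_, ?_⟩
  · refine hM.blanks.of_shift (m := m) (n := m + 1) (r := r) (c := c) (x := x) (j := j) hcolb
      hS' ?_ ?_
    · rintro ⟨i, y⟩
      rw [hcol.blank_iff]
      simp only [Prod.mk.injEq]
      refine or_congr (and_congr_right fun _ => not_congr ?_) ?_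
      · constructor
        · rintro ⟨h1, h2, h3⟩
          exact ⟨(i - x).toNat, by omega, by omega, h3⟩
        · rintro ⟨t, h1, h2, h3⟩
          exact ⟨by omega, by omega, h3⟩
      · constructor
        · rintro (⟨h1, h2, h3, -⟩ | ⟨⟨h1, h2⟩, -⟩)
          · exact ⟨(i - x - 1).toNat, by omega, by omega, h3⟩
          · exact ⟨m, by omega, h1, h2⟩
        · rintro ⟨t, h1, rfl, rfl⟩
          -- The lowest new blank tile is the former `jay`; the other ones are blank tiles of column
          -- `j` that were shifted to column `j + 1`.
          rcases Nat.lt_or_ge t m with h2 | h2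
          · exact .inl ⟨by omega, by omega, rfl, (hbl _ (by omega) (by omega)).2⟩
          · obtain rfl : t = m := by omega
            exact .inr ⟨⟨rfl, rfl⟩, hjay⟩
    · intro t ht
      exact ⟨⟨by simp only; omega, by simp only; omega⟩, by simp only; omega, by simp only; omega⟩
  · exact hM.mem_insert_erase h.ssyt hpos hpos' fun p hp => (h.tilePos_bump_marks ha x m hp).1
  · simp [hpos']

theorem TileMatch.remove (hM : TileMatch a b k s M) (h : RunInv a k nu mu s lam inner)
    {r c m : ℕ} {x : ℤ} (ha : s.active = some (r, c)) (hb : IsBumpable s.entries r c x m)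
    (hr : s.entries (r, c + 1) ≠ some x) (hk : x + m = k) :
    ∃ M', BPDStep b .remove M M' ∧ TileMatch a b k
      ⟨Function.update (bump s.entries r c x m) (r + m, c) none, s.marks.erase (r, c),
        none, false⟩ M' := by
  obtain ⟨hbl, hright, hbelow, hmb, hjb⟩ := hM.column_tiles h.ssyt hb hr
  rw [hk] at hbl
  obtain ⟨hund, i', hki, hib, hcol, hcr, hnb⟩ := hM.tiling.column_remove (by omega) hbl hright
  obtain ⟨⟨⟨g1, g2⟩, g3, g4⟩, -⟩ := hbl x le_rfl (by omega)
  simp only at g1 g2 g3 g4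
  have hpos : tilePos s.entries (r, c) = some (x, x + c - r) := by
    simpa using hb.tilePos_eq (Nat.zero_le m)
  have hcolb := hb.mem_col_iff h.ssyt
  have hS' := tilePos_bump_erase_iff (S := s.entries) (r := r) (c := c) (m := m) (x := x)
  generalize x + (c : ℤ) - r = j at *
  refine ⟨_, .remove M x i' j (hM.active_of_some ha hpos) hright hund (by omega) hcr,
    hcol.isGrassTiling hM.tiling g1 (by omega) (by omega) g3 hjb, ?_, ?_, rfl⟩
  · refine hM.blanks.of_shift (m := m) (n := m) (r := r) (c := c) (x := x) (j := j) hcolb hS' ?_ ?_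
    · rintro ⟨i, y⟩
      rw [hcol.blank_iff]
      simp only [Prod.mk.injEq]
      refine or_congr (and_congr_right fun h0 => not_congr ?_) ?_
      · constructor
        · rintro ⟨h1, h2, rfl⟩
          -- Below row `k` there are no blank tiles in column `j` down to the crossing, so only the
          -- block that ends in row `k` is affected.
          have : i ≤ k := by
            by_contra hc
            exact hnb i (by omega) h2 h0
          exact ⟨(i - x).toNat, by omega, by omega, rfl⟩
        · rintro ⟨t, h1, h2, h3⟩
          exact ⟨by omega, by omega, h3⟩
      · constructor
        · rintro (⟨h1, h2, h3, h4⟩ | ⟨⟨rfl, rfl⟩, h2⟩)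
          · have : i ≤ k := by
              by_contra hc
              exact hnb i (by omega) h2 h4
            exact ⟨(i - x - 1).toNat, by omega, by omega, h3⟩
          · rw [hcr.1] at h2; simp at h2
        · rintro ⟨t, h1, rfl, rfl⟩
          exact .inl ⟨by omega, by omega, rfl, (hbl _ (by omega) (by omega)).2⟩
    · intro t ht
      exact ⟨⟨by simp only; omega, by simp only; omega⟩, by simp only; omega, by simp only; omega⟩
  · refine hM.mem_erase h.ssyt hpos fun p hp => ?_
    obtain ⟨h1, h2⟩ := h.tilePos_bump_marks ha x m hp
    rw [← h1]
    simp only [tilePos, Function.update_of_ne h2]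

/-- Each step on marked tableaux is matched by a step on marked bumpless pipe dreams. -/
theorem TileMatch.exists_step (hM : TileMatch a b k s M) (h : RunInv a k nu mu s lam inner)
    (hst : StepData k s κ s') : ∃ M', BPDStep b κ M M' ∧ TileMatch a b k s' M' := by
  cases hst with
  | pick p ha hp =>
    exact ⟨_, .pick M _ (hM.active_of_none ha) ((hM.maximal_iff h ha).2 ⟨p, hp, rfl⟩),
      hM.pick h hp ha⟩
  | move r c x m ha hb hr hk => exact hM.move h ha hb hr hk
  | remove r c x m ha hb hr hk => exact hM.remove h ha hb hr hk
  | slide r c c' x ha hf hr hx hc hc' hmax => exact hM.slide h ha hx hc hc' hmax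

/-- Each step on marked bumpless pipe dreams is matched by a step on marked tableaux. -/
theorem TileMatch.exists_step_tableau (hM : TileMatch a b k s M)
    (h : RunInv a k nu mu s lam inner) (hak : a ≤ k) (hb : k + nu.rowLen 0 ≤ b) {M' : MarkedBPD}
    (hst : BPDStep b κ M M') : ∃ s', StepData k s κ s' ∧ TileMatch a b k s' M' := by
  cases ha : s.active with
  | none =>
    have hact := hM.active_of_none ha
    cases hst with
    | pick _ q _ hq =>
      obtain ⟨p, hp, rfl⟩ := (hM.maximal_iff h ha).1 hq
      exact ⟨_, .pick p ha hp, hM.pick h hp ha⟩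
    | slide _ i j j' h0 => rw [h0] at hact; simp at hact
    | move _ i i' j h0 => rw [h0] at hact; simp at hact
    | remove _ i i' j h0 => rw [h0] at hact; simp at hact
  | some p =>
    obtain ⟨-, hp, hm⟩ := h.marks_some p ha
    -- The tableau can make some step, which is matched by a step from `M`. Since a tile is active,
    -- this coincides with the given step in kind and result.
    obtain ⟨κ', s', hs'⟩ := h.exists_step (by rw [hm]; exact Finset.insert_nonempty _ _)
    obtain ⟨M'', hst', hM''⟩ := hM.exists_step h hs'
    obtain ⟨⟨i, j⟩, hq⟩ := h.ssyt.exists_tilePos hp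
    obtain ⟨hg, hbl⟩ := (hM.blanks _).2 ⟨p, hq⟩
    obtain ⟨w, -, hw⟩ := hM.exists_perm h.ssyt hak
      (by have := rowLen_le_of_le h.le 0; omega)
    obtain ⟨rfl, rfl⟩ := BPDStep.deterministic hw (hM.active_of_some ha hq) hg.2.1
      (hM.tiling.lt_of_blank hg hbl).2 hst hst'
    exact ⟨s', hs', hM''⟩

end agree

theorem RunInv.of_reachable {a : ℤ} {k : ℕ} {nu mu : YoungDiagram} {T : Filling}
    (h₀ : RunInv a k nu mu (completion mu T) nu mu) (hmu : ∀ q ∈ mu, a + (q.1 : ℤ) ≤ 0)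
    {s : MarkedTableau} (hs : Reachable k mu T s) : ∃ lam inner, RunInv a k nu mu s lam inner := by
  induction hs with
  | refl => exact ⟨_, _, h₀⟩
  | tail _ h2 ih =>
    obtain ⟨lam, inner, h⟩ := ih
    obtain ⟨κ, h2⟩ := h2
    exact h.step hmu (h.stepData_iff.1 h2)

/-- The position of the marked tiles for the completed tableau. -/
theorem RunInv.corresponds_marks {a b k : ℤ} {nu mu lam inner : YoungDiagram} {s : MarkedTableau}
    {M : MarkedBPD} (h : RunInv a k nu mu s lam inner) (ha : a ≤ k) (hb : k + nu.rowLen 0 ≤ b)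
    (hM : Corresponds a b k s M) (hact : s.active = none) : M.active = none ∧
      M.marks = inner.cells.image fun p => (a + (p.1 : ℤ), a + (p.2 : ℤ)) :=
  have hM' := (h.corresponds_iff ha hb).1 hM
  ⟨hM'.active_of_none hact, hM'.marks_of_none h hact⟩

end Taquin

/-! ### The proposition, assembled from the invariant and the two simulations -/

theorem mainTheorem6 (ν μ : YoungDiagram) (k : ℕ) (hμν : μ ≤ ν)
    (hlm : μ.colLen 0 < ν.colLen 0) (hmk : ν.colLen 0 ≤ k)
    (T : Filling) (hT : IsSSYT ν μ 1 k T)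
    (a b : ℤ) (ha : a = 1 - (μ.colLen 0 : ℤ)) (hb : (k : ℤ) + (ν.rowLen 0 : ℤ) ≤ b) :
    -- the bijection between bumpless pipe dreams and semistandard tableaux
    (∀ (w : Equiv.Perm ℤ) (lam : YoungDiagram), IsGrassmannian a b k w → IsShapeOf a k w lam →
      (∀ D, IsBPD a b w D →
        ∃ S, IsSSYT lam ⊥ a k S ∧ ∀ S', IsTableauOf a b D S' ↔ S' = S) ∧
      (∀ S, IsSSYT lam ⊥ a k S → ∃! D, IsBPD a b w D ∧ IsTableauOf a b D S)) ∧
    -- the completion is semistandard, and the algorithm runs until there are no marks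
    IsSSYT ν ⊥ a k (completion μ T).entries ∧
    (∀ s, Reachable k μ T s → s.marks.Nonempty → ∃ κ s', TableauStep k κ s s') ∧
    (¬ ∃ f : ℕ → MarkedTableau, f 0 = completion μ T ∧
      ∀ n, ∃ κ, TableauStep k κ (f n) (f (n + 1))) ∧
    -- the algorithm simulates jeu de taquin on `T`
    (completion μ T).unmark = ⟨μ.cells, T, none⟩ ∧
    (∀ s s', Reachable k μ T s →
      (TableauStep k .pick s s' → JdtPick s.unmark s'.unmark) ∧
      (TableauStep k .move s s' → Relation.ReflTransGen JdtUp s.unmark s'.unmark) ∧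
      (TableauStep k .slide s s' → Relation.TransGen JdtLeft s.unmark s'.unmark) ∧
      (TableauStep k .remove s s' →
        ∃ J, Relation.ReflTransGen JdtUp s.unmark J ∧ JdtStop J s'.unmark)) ∧
    (∀ R, JdtRectifiesTo μ T R ↔ ∃ s, Reachable k μ T s ∧ s.marks = ∅ ∧ s.entries = R) ∧
    -- the algorithm agrees in each step with the one on marked bumpless pipe dreams
    (∃ M, Corresponds a b k (completion μ T) M ∧ M.active = none ∧
      M.marks = μ.cells.image (fun p => (a + (p.1 : ℤ), a + (p.2 : ℤ)))) ∧
    (∀ s, Reachable k μ T s →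
      (∃! M, Corresponds a b k s M) ∧
      ∀ M, Corresponds a b k s M →
        (∀ κ s', TableauStep k κ s s' →
          ∃ M', BPDStep b κ M M' ∧ Corresponds a b k s' M') ∧
        (∀ κ M', BPDStep b κ M M' →
          ∃ s', TableauStep k κ s s' ∧ Corresponds a b k s' M')) := by
  have hak : a ≤ k := by omega
  have hkb : (k : ℤ) ≤ b := by omega
  have hmu : ∀ q ∈ μ, a + (q.1 : ℤ) ≤ 0 := by
    intro q hq
    have := YoungDiagram.mem_iff_lt_colLen.1 (μ.up_left_mem le_rfl (Nat.zero_le q.2) hq)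
    omega
  have h₀ := runInv_completion hμν (by omega) hT ha
  have hinv : ∀ {s}, Reachable k μ T s → ∃ lam inner, RunInv a k ν μ s lam inner :=
    fun hs => h₀.of_reachable hmu hs
  refine ⟨fun w lam hw hsh => bpd_tableau_bijection hak hkb hw hsh, h₀.ssyt, ?_, ?_,
    completion_unmark hT, ?_, ?_, ?_, ?_⟩
  · intro s hs hne
    obtain ⟨lam, inner, h⟩ := hinv hs
    obtain ⟨κ, s', hst⟩ := h.exists_step hne
    exact ⟨κ, s', h.stepData_iff.2 hst⟩
  · rintro ⟨f, hf0, hf⟩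
    have hreach : ∀ n, Reachable k μ T (f n) := by
      intro n
      induction n with
      | zero => rw [hf0]; exact .refl
      | succ n ih => exact ih.tail (hf n)
    -- An infinite run would give a strictly decreasing sequence of natural numbers.
    refine not_strictAnti_of_wellFoundedLT (fun n => runMeasure a k (f n))
      (strictAnti_nat_of_succ_lt fun n => ?_)
    obtain ⟨lam, inner, h⟩ := hinv (hreach n)
    obtain ⟨κ, hst⟩ := hf n
    exact h.measure_lt (h.stepData_iff.1 hst)
  · intro s s' hs
    obtain ⟨lam, inner, h⟩ := hinv hs
    simp only [h.stepData_iff]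
    refine ⟨fun hst => ?_, fun hst => ?_, fun hst => ?_, fun hst => ?_⟩
    · cases hst with
      | pick p hp hp' => exact h.sim_pick hmu hp hp'
    · cases hst with
      | move r c x m h1 h2 h3 h4 => exact h.sim_move h1 h2 h3 h4
    · cases hst with
      | slide r c c' x h1 h2 h3 h4 h5 h6 h7 => exact h.sim_slide h1 h3 h4 h5 h6 h7
    · cases hst with
      | remove r c x m h1 h2 h3 h4 => exact h.sim_remove h1 h2 h3 h4
  · intro R
    constructor
    · intro hR
      rw [JdtRectifiesTo, ← completion_unmark hT] at hR
      exact h₀.exists_run hmu hR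
    · rintro ⟨s, hs, hm, rfl⟩
      have hsim : Relation.ReflTransGen JdtStep (completion μ T).unmark s.unmark := by
        clear hm
        induction hs with
        | refl => exact .refl
        | tail h1 h2 ih =>
          obtain ⟨lam, inner, h⟩ := hinv h1
          obtain ⟨κ, h2⟩ := h2
          exact ih.trans (h.sim hmu (h.stepData_iff.1 h2))
      obtain ⟨lam, inner, h⟩ := hinv hs
      have hact : s.active = none := by
        cases h0 : s.active with
        | none => rfl
        | some p =>
          have := (h.marks_some p h0).2.2
          rw [hm] at this
          exact absurd this.symm (Finset.insert_ne_empty _ _)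
      rw [completion_unmark hT] at hsim
      have hfin : s.unmark = ⟨∅, s.entries, none⟩ := by
        simp [MarkedTableau.unmark, hm, hact]
      rwa [hfin] at hsim
  · obtain ⟨M, hM, -⟩ := h₀.existsUnique_corresponds hak hb
    obtain ⟨h1, h2⟩ := h₀.corresponds_marks hak hb hM rfl
    exact ⟨M, hM, h1, h2⟩
  · intro s hs
    obtain ⟨lam, inner, h⟩ := hinv hs
    refine ⟨h.existsUnique_corresponds hak hb, fun M hM => ?_⟩
    rw [h.corresponds_iff hak hb] at hM
    simp only [h.stepData_iff]
    constructor
    · intro κ s' hst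
      obtain ⟨lam', inner', h'⟩ := h.step hmu hst
      obtain ⟨M', h1, h2⟩ := hM.exists_step h hst
      exact ⟨M', h1, (h'.corresponds_iff hak hb).2 h2⟩
    · intro κ M' hst
      obtain ⟨s', h1, h2⟩ := hM.exists_step_tableau h hak hb hst
      obtain ⟨lam', inner', h'⟩ := h.step hmu h1
      exact ⟨s', h1, (h'.corresponds_iff hak hb).2 h2⟩
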